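/- **Setting.** There are $N\ge 1$ agents, the vertices of a connected graph $G$, $K\ge 2$ arms and $T\ge 3$ rounds. In round $t$ arm $k$ has loss $\ell_t(i,k)\in[0,1]$ for agent $i$, and $\bar\ell_t(k)=\frac1N\sum_{i}\ell_t(i,k)$. Let $W$ be a gossip matrix: symmetric, doubly stochastic, with $W(i,j)>0$ only if $i=j$ or $ij$ is an edge of $G$. Let $\sigma_2<1$ be its second largest singular value ($\sigma_2=0$ if $N=1$), $\rho=1-\sigma_2$, and $$B=\left\lceil\frac{\ln\big((KT)^6\sqrt{14N}\big)}{(1-1/\sqrt2)\sqrt{1-\sigma_2}}\right\rceil,\qquad \kappa=\frac1{1+\sqrt{1-\sigma_2^2}},\qquad \alpha=\frac1T .$$ **Algorithm.** The rounds are divided into consecutive blocks $\mathcal T_1,\mathcal T_2,\dots$ of length $B$ (the last block may be shorter). Each agent $i$ runs two copies of the learner FTRL below, one queried in the odd blocks and one in the even blocks. At the start of block $\tau$ the copy in charge outputs $\mathbf p'_\tau(i)$, and in every round $t$ of the block agent $i$ plays $A_t(i)\sim\mathbf p_\tau(i)=(1-\alpha)\mathbf p'_\tau(i)+\frac{\alpha}{K}\mathbf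 1$, independently over agents and rounds given the past. It forms $\hat\ell_t(i,k)=\frac{\ell_t(i,k)}{p_\tau(i,k)}\mathbf 1\{A_t(i)=k\}$. During block $\tau+1$ the agents run $B$ accelerated gossip steps $$\mathbf z^{b+1}(i)=(1+\kappa)\sum_{j}W(i,j)\mathbf z^{b}(j)-\kappa\,\mathbf z^{b-1}(i),\qquad \mathbf z^{-1}(i)=\mathbf z^{0}(i)=\sum_{t\in\mathcal T_\tau}\hat{\boldsymbol\ell}_t(i),$$ where $j$ runs over $i$ and its neighbours, and at the end of block $\tau+1$ the vector $\mathbf z^B(i)$ is given as feedback to the copy that was in charge of block $\tau$. FTRL outputs $\mathbf q_1=\frac1K\mathbf 1$ and, after its $t$-th feedback vector $\mathbf z_t$, outputs $\mathbf q_{t+1}=\arg\min_{\mathbf q\in\Delta(K)}\big\{\sum_{s\le t}\langle\mathbf z_s,\mathbf q\rangle+\psi_t(\mathbf q)\big\}$, with $$\psi_t(\mathbf q)=\frac1{\eta_t}\sum_{k}q(k)\log q(k)-\frac2{\gamma_t}\sum_{k}\sqrt{q(k)},\qquad \eta_t=\min\Big\{\frac1B,\sqrt{\frac{\log K}{tB^2}}\Big\},\qquad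 \gamma_t=\sqrt{\frac{N}{tB}} .$$ **Regret.** $\mathrm{Reg}_T=\max_i\Big(\mathbb E\big[\sum_{t\le T}\bar\ell_t(A_t(i))\big]-\min_k\mathbb E\big[\sum_{t\le T}\bar\ell_t(k)\big]\Big)$, the expectation being over the internal randomization of the agents and, in the stochastic environment, also over the losses. **Theorem.** There are universal constants $C>0$ and $c\in\mathbb N$ such that the following holds for all $N,K,T,G,W$ as above. 1. *(Adversarial environment.)* For every fixed choice of the losses in $[0,1]$, $$\mathrm{Reg}_T\le C\Big(\sqrt{BT\log K}+\sqrt{\tfrac{KT}{N}}+B\log K\Big)$$ and $$\mathrm{Reg}_T\le C\,(\log (KNT))^{c}\Big(\sqrt{\rho^{-1/2}T}+\sqrt{\tfrac{KT}{N}}+\rho^{-1/2}\Big).$$ 2. *(Stochastic environment.)* Suppose that $B\le T$ and that the loss tables $(\ell_t(i,k))_{i,k}$, $t=1,\dots,T$, are independent and identically distributed over $t$, with values in $[0,1]$ and means $\mu(i,k)$. The laws may differ between agents and arms, and the losses within one round may depend on each other in any way; they are independent of the internal randomization of the agents. Put $\mu(k)=\frac1N\sum_i\mu(i,k)$, suppose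 that $k^\star$ is the unique minimizer of $\mu$, and put $\delta(k)=\mu(k)-\mu(k^\star)$. Then the expected loss of each agent given the losses is an integrable function of the losses, and $$\mathrm{Reg}_T\le C\Big(\frac BN\sum_{k\ne k^\star}\frac{\log(T/B)}{\delta(k)}+\sum_{k\ne k^\star}\frac{B^2}{\delta(k)\log K}+B^2\log K\Big).$$ -/

import Mathlib

open MeasureTheory ProbabilityTheory Finset

noncomputable section

namespace DistBandit

/-! Conventions: agents are `Fin N`, arms are `Fin K`, rounds are `Fin T`. Rounds and blocks are
numbered from `0` here, so round `t` lies in block `t / B`, and block `τ` of this file is block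
`τ + 1` in one-based numbering. The last block is shorter than `B` when `B` does not divide `T`. -/

/-- A table of losses: `ℓ t i k` is the loss of arm `k` for agent `i` in round `t`. -/
abbrev Losses (T N K : ℕ) := Fin T → Fin N → Fin K → ℝ

/-- A table of actions: `a t i` is the arm played by agent `i` in round `t`. -/
abbrev Actions (T N K : ℕ) := Fin T → Fin N → Fin K

/-! ### Communication network and accelerated gossip -/

/-- A gossip matrix on the graph `G`: symmetric, doubly stochastic, supported on `G`. -/
structure IsGossipMatrix {N : ℕ} (G : SimpleGraph (Fin N)) (W : Matrix (Fin N) (Fin N) ℝ) :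
    Prop where
  symm : W.IsSymm
  doublyStochastic : W ∈ doublyStochastic ℝ (Fin N)
  support : ∀ i j, 0 < W i j → G.Adj i j ∨ i = j

/-- The second largest singular value (singular values are numbered from `0`, in decreasing order
and with multiplicity; the value is `0` when `N = 1`). -/
def sigma2 {N : ℕ} (W : Matrix (Fin N) (Fin N) ℝ) : ℝ :=
  (Matrix.toEuclideanLin W).singularValues 1

/-- The spectral gap `ρ = 1 - σ₂`. -/
def spectralGap {N : ℕ} (W : Matrix (Fin N) (Fin N) ℝ) : ℝ := 1 - sigma2 W

/-- The mixing coefficient `κ`. -/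
def kappa {N : ℕ} (W : Matrix (Fin N) (Fin N) ℝ) : ℝ := 1 / (1 + √(1 - sigma2 W ^ 2))

/-- The block length `B`. -/
def blockLength {N : ℕ} (W : Matrix (Fin N) (Fin N) ℝ) (K T : ℕ) : ℕ :=
  ⌈Real.log (((K : ℝ) * T) ^ 6 * √(14 * N)) / ((1 - 1 / √2) * √(1 - sigma2 W))⌉₊

open Classical in
/-- Weighted average of the vectors held in the closed neighbourhood of agent `i`. -/
def neighborAverage {N K : ℕ} (G : SimpleGraph (Fin N)) (W : Matrix (Fin N) (Fin N) ℝ)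
    (x : Fin N → Fin K → ℝ) : Fin N → Fin K → ℝ :=
  fun i k => ∑ j with G.Adj i j ∨ j = i, W i j * x j k

/-- The accelerated gossip iterates started at `x`; entry `n` of the sequence is the iterate with
index `b = n - 1`, so the entries `0` and `1` are the two initial values `x^{-1} = x^0 = x`. -/
def gossipSeq {N K : ℕ} (G : SimpleGraph (Fin N)) (W : Matrix (Fin N) (Fin N) ℝ)
    (x : Fin N → Fin K → ℝ) : ℕ → Fin N → Fin K → ℝ
  | 0 => x
  | 1 => x
  | n + 2 => fun i k =>
      (1 + kappa W) * neighborAverage G W (gossipSeq G W x (n + 1)) i k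
        - kappa W * gossipSeq G W x n i k

/-- The result `x^b` of `b` accelerated gossip steps. -/
def gossip {N K : ℕ} (G : SimpleGraph (Fin N)) (W : Matrix (Fin N) (Fin N) ℝ) (b : ℕ)
    (x : Fin N → Fin K → ℝ) : Fin N → Fin K → ℝ :=
  gossipSeq G W x (b + 1)

/-! ### Base learner: FTRL with the hybrid Shannon / Tsallis regularizer -/

/-- The learning rate `η_t`. -/
def eta (K B t : ℕ) : ℝ := min (1 / (B : ℝ)) (√(Real.log K / (t * (B : ℝ) ^ 2)))

/-- The learning rate `γ_t`. -/
def gammaRate (N B t : ℕ) : ℝ := √((N : ℝ) / (t * B))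

/-- The regularizer `ψ_t`. -/
def regularizer (N K B t : ℕ) (q : Fin K → ℝ) : ℝ :=
  (1 / eta K B t) * ∑ k, q k * Real.log (q k) - (2 / gammaRate N B t) * ∑ k, √(q k)

/-- A minimizer of `F` over the probability simplex on `K` arms. The objective to which this is
applied has exactly one minimizer there, see `ftrlObjective_minimizer` and
`ftrlObjective_minimizer_unique`. -/
def argminSimplex {K : ℕ} (F : (Fin K → ℝ) → ℝ) : Fin K → ℝ :=
  Classical.epsilon fun q => q ∈ stdSimplex ℝ (Fin K) ∧ IsMinOn F (stdSimplex ℝ (Fin K)) q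

/-- The FTRL objective after `t` feedback vectors with sum `Z`. -/
def ftrlObjective (N K B t : ℕ) (Z q : Fin K → ℝ) : ℝ :=
  ∑ k, Z k * q k + regularizer N K B t q

theorem ftrlObjective_minimizer (N B t : ℕ) {K : ℕ} (hK : 0 < K) (Z : Fin K → ℝ) :
    ∃ q ∈ stdSimplex ℝ (Fin K),
      IsMinOn (ftrlObjective N K B t Z) (stdSimplex ℝ (Fin K)) q := by
  have : Nonempty (Fin K) := ⟨⟨0, hK⟩⟩
  refine (isCompact_stdSimplex ℝ (Fin K)).exists_isMinOn
    ⟨_, single_mem_stdSimplex ℝ (⟨0, hK⟩ : Fin K)⟩ ?_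
  have h1 : ∀ k : Fin K, Continuous fun q : Fin K → ℝ => q k * Real.log (q k) := fun k =>
    Real.continuous_mul_log.comp (continuous_apply k)
  unfold ftrlObjective regularizer
  exact Continuous.continuousOn (by fun_prop)

theorem ftrlObjective_minimizer_unique {N B t K : ℕ} (hB : 0 < B) (ht : 0 < t) (hK : 2 ≤ K)
    (Z : Fin K → ℝ) {p q : Fin K → ℝ} (hp : p ∈ stdSimplex ℝ (Fin K))
    (hq : q ∈ stdSimplex ℝ (Fin K))
    (hpm : IsMinOn (ftrlObjective N K B t Z) (stdSimplex ℝ (Fin K)) p)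
    (hqm : IsMinOn (ftrlObjective N K B t Z) (stdSimplex ℝ (Fin K)) q) : p = q := by
  have heta : 0 < 1 / eta K B t := by
    have hlog : 0 < Real.log K := Real.log_pos (by exact_mod_cast hK)
    have hB' : (0 : ℝ) < B := by exact_mod_cast hB
    have ht' : (0 : ℝ) < t := by exact_mod_cast ht
    unfold eta
    positivity
  have hgam : 0 ≤ 2 / gammaRate N B t := by
    unfold gammaRate
    positivity
  have hcoord : ∀ k, StrictConvexOn ℝ (Set.Ici (0 : ℝ)) fun x =>
      (1 / eta K B t * (x * Real.log x) + Z k * x) + (2 / gammaRate N B t) * -√x := by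
    intro k
    refine StrictConvexOn.add_convexOn (StrictConvexOn.add_convexOn ?_ ?_) ?_
    · have h := Real.strictConvexOn_mul_log
      refine ⟨h.1, fun x hx y hy hxy a b ha hb hab => ?_⟩
      have h2 := mul_lt_mul_of_pos_left (h.2 hx hy hxy ha hb hab) heta
      simp only [smul_eq_mul] at h2 ⊢
      linarith
    · refine ⟨convex_Ici 0, fun x _ y _ a b _ _ _ => le_of_eq ?_⟩
      simp only [smul_eq_mul]
      ring
    · exact (Real.strictConcaveOn_sqrt.concaveOn.neg).smul hgam
  have hobj : ∀ r : Fin K → ℝ, ftrlObjective N K B t Z r =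
      ∑ k, ((1 / eta K B t * (r k * Real.log (r k)) + Z k * r k)
        + (2 / gammaRate N B t) * -√(r k)) := by
    intro r
    simp only [ftrlObjective, regularizer, Finset.sum_add_distrib, Finset.mul_sum, mul_neg,
      Finset.sum_neg_distrib]
    ring
  refine StrictConvexOn.eq_of_isMinOn ⟨convex_stdSimplex ℝ (Fin K), ?_⟩ hpm hqm hp hq
  intro x hx y hy hxy a b ha hb hab
  obtain ⟨k₀, hk₀⟩ := Function.ne_iff.mp hxy
  simp only [hobj, smul_eq_mul, Finset.mul_sum, ← Finset.sum_add_distrib]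
  refine Finset.sum_lt_sum (fun k _ => ?_) ⟨k₀, Finset.mem_univ _, ?_⟩
  · have := (hcoord k).convexOn.2 (hx.1 k) (hy.1 k) ha.le hb.le hab
    simpa [smul_eq_mul] using this
  · have := (hcoord k₀).2 (hx.1 k₀) (hy.1 k₀) hk₀ ha hb hab
    simpa [smul_eq_mul] using this

/-- The FTRL output `q_{t+1}` after `t` feedback vectors whose sum is `Z`; `q_1` is uniform. -/
def ftrl (N K B : ℕ) : ℕ → (Fin K → ℝ) → Fin K → ℝ
  | 0, _ => fun _ => 1 / (K : ℝ)
  | t + 1, Z => argminSimplex (ftrlObjective N K B (t + 1) Z)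

/-! ### The distributed algorithm -/

/-- Mixing with uniform exploration of weight `α = 1 / T`. -/
def mixUniform {K : ℕ} (T : ℕ) (q : Fin K → ℝ) : Fin K → ℝ :=
  fun k => (1 - 1 / (T : ℝ)) * q k + 1 / (T : ℝ) / K

/-- Sum over block `τ` of the importance weighted loss estimates, when the sampling distributions
used in that block are `p`. -/
def blockEstimate {T N K : ℕ} (B τ : ℕ) (p : Fin N → Fin K → ℝ) (ℓ : Losses T N K)
    (a : Actions T N K) : Fin N → Fin K → ℝ :=
  fun i k => ∑ t ∈ univ.filter (fun t : Fin T => (t : ℕ) / B = τ),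
    if a t i = k then ℓ t i k / p i k else 0

/-- Agent `i` runs two copies of FTRL, one queried in the even and one in the odd blocks.
`feedbackSum … τ i` is the sum of all feedback vectors which the copy queried in block `τ` has
received by then, namely the gossiped estimates of the blocks `τ - 2, τ - 4, …` (the estimate of a
block is gossiped during the next block and delivered at its end). There are `τ / 2` of them. -/
def feedbackSum {T N K : ℕ} (G : SimpleGraph (Fin N)) (W : Matrix (Fin N) (Fin N) ℝ)
    (ℓ : Losses T N K) (a : Actions T N K) : ℕ → Fin N → Fin K → ℝ
  | 0 => fun _ _ => 0
  | 1 => fun _ _ => 0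
  | τ + 2 => fun i k =>
      feedbackSum G W ℓ a τ i k
        + gossip G W (blockLength W K T)
            (blockEstimate (blockLength W K T) τ
              (fun j => mixUniform T
                (ftrl N K (blockLength W K T) (τ / 2) (feedbackSum G W ℓ a τ j))) ℓ a) i k

/-- The distribution from which agent `i` samples in all rounds of block `τ`. It depends on the
actions `a` only through the rounds of the blocks before `τ`. -/
def policy {T N K : ℕ} (G : SimpleGraph (Fin N)) (W : Matrix (Fin N) (Fin N) ℝ)
    (ℓ : Losses T N K) (a : Actions T N K) (τ : ℕ) (i : Fin N) : Fin K → ℝ :=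
  mixUniform T (ftrl N K (blockLength W K T) (τ / 2) (feedbackSum G W ℓ a τ i))

/-- The probability that the agents play exactly the actions `a` against the losses `ℓ`: given the
past, each agent samples independently from its current distribution. -/
def actionProb {T N K : ℕ} (G : SimpleGraph (Fin N)) (W : Matrix (Fin N) (Fin N) ℝ)
    (ℓ : Losses T N K) (a : Actions T N K) : ℝ :=
  ∏ t : Fin T, ∏ i, policy G W ℓ a ((t : ℕ) / blockLength W K T) i (a t i)

/-! ### Regret -/

/-- The global average loss of arm `k` in round `t`. -/
def avgLoss {T N K : ℕ} (ℓ : Losses T N K) (t : Fin T) (k : Fin K) : ℝ :=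
  (1 / (N : ℝ)) * ∑ i, ℓ t i k

/-- Expectation, over the internal randomization of the agents, of the cumulative global average
loss of agent `i`, for fixed losses. -/
def expectedLoss {T N K : ℕ} (G : SimpleGraph (Fin N)) (W : Matrix (Fin N) (Fin N) ℝ)
    (ℓ : Losses T N K) (i : Fin N) : ℝ :=
  ∑ a : Actions T N K, actionProb G W ℓ a * ∑ t, avgLoss ℓ t (a t i)

/-- The regret `Reg_T` (maximum over the agents) for a fixed table of losses. -/
def regret {T N K : ℕ} (G : SimpleGraph (Fin N)) (W : Matrix (Fin N) (Fin N) ℝ)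
    (ℓ : Losses T N K) : ℝ :=
  ⨆ i : Fin N, (expectedLoss G W ℓ i - ⨅ k : Fin K, ∑ t, avgLoss ℓ t k)

/-- The (pseudo-)regret `Reg_T` (maximum over the agents) for random losses drawn independently of
the internal randomization of the agents. -/
def stochRegret {T N K : ℕ} {Ω : Type*} [MeasurableSpace Ω] (P : Measure Ω)
    (G : SimpleGraph (Fin N)) (W : Matrix (Fin N) (Fin N) ℝ) (ℓ : Ω → Losses T N K) : ℝ :=
  ⨆ i : Fin N, ((∫ ω, expectedLoss G W (ℓ ω) i ∂P)
    - ⨅ k : Fin K, ∫ ω, ∑ t, avgLoss (ℓ ω) t k ∂P)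

/-- A stochastic environment with means `μ i k`: losses in `[0,1]`, and the loss tables of the
different rounds are independent and identically distributed. Losses of different agents and arms
may have different laws, and may depend on each other within a round. -/
structure IsStochasticEnv {T N K : ℕ} {Ω : Type*} [MeasurableSpace Ω] (P : Measure Ω)
    (ℓ : Ω → Losses T N K) (μ : Fin N → Fin K → ℝ) : Prop where
  measurable : ∀ t, Measurable fun ω => ℓ ω t
  mem_Icc : ∀ ω t i k, ℓ ω t i k ∈ Set.Icc (0 : ℝ) 1
  indep : iIndepFun (fun t ω => ℓ ω t) P
  identDistrib : ∀ s t, IdentDistrib (fun ω => ℓ ω s) (fun ω => ℓ ω t) P P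
  mean : ∀ t i k, ∫ ω, ℓ ω t i k ∂P = μ i k

/-- The global average mean loss of arm `k`. -/
def globalMean {N K : ℕ} (μ : Fin N → Fin K → ℝ) (k : Fin K) : ℝ := (1 / (N : ℝ)) * ∑ i, μ i k

/-- The sub-optimality gap of arm `k` relative to the arm `kstar`. -/
def gap {N K : ℕ} (μ : Fin N → Fin K → ℝ) (kstar k : Fin K) : ℝ :=
  globalMean μ k - globalMean μ kstar

end DistBandit

end

/-! The network is compared with one centralized learner. The block length B is chosen so that one
block of accelerated gossip averages the estimates up to an error that is tiny against powers of KT,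
and the FTRL map is Lipschitz in its accumulated feedback because the entropy makes the objective
strongly convex. So, for every realization of the actions, each agent samples from a distribution
within 2/(KT)^4 of that of a reference learner fed with the exact network averages (`gossip_error`,
`ftrl_lipschitz`, `policy_sub_refPolicy_le`). Uniform exploration keeps the probabilities above
1/(KT), so the additive closeness is also closeness up to a factor 2. The regret of each agent is
then that of the reference learner plus at most 3 + B.

Given the past, the averaged estimate of a block is unbiased, and its variance at an arm of
reference probability p is at most 2B/(Np), because N agents draw independently
(`actionExp_mul_refEst`, `actionExp_mul_noise_sq_le`). Feedback arrives one block late, so the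
blocks of one parity form an FTRL run without delay; the two runs are bounded separately.

For FTRL write β = 1/η and g = 1/γ. Both regularizers have divergences governed by the same quantity
(√y - √q)²: the entropy at least with weight β, the Tsallis part exactly with weight g/√q. Hence
feedback z costs at most 2z²q/(β + g/√q) per arm (`hybrid_stability`, `ftrl_regret`). Split z into
mean and noise. The mean is at most B and is charged to β, costing B²/β; the noise is charged to g,
where the factor 1/p of the variance cancels a factor q and leaves B√q/(Ng). With β of order
B√(s/log K) and g = √(sB/N) in the s-th block of a run, these sum to √(BT log K) and √(KT/N). The
second adversarial bound inserts B ≤ 31 log(KNT)/√ρ.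

In the stochastic case a common shift of the estimates, invisible on the simplex, removes the
optimal arm k⋆ from the stability terms (`stability_late_le`). It is admissible once β is large
against B; the O(log K) earlier blocks are paid for directly. What remains is a sum over k ≠ k⋆ of
terms in √q, the entropy of q, and q itself. Young type inequalities trade each of them for a
fraction of Bδ(k)q(k) and a residue. The residue of √q is of order 1/(Nδ(k)s) and yields log(T/B);
the others have the form exp(-c√s)/√s and are summable uniformly in the horizon.

The law of the reference distribution in a block depends only on the losses of earlier blocks, hence
is independent of the losses of the block (`meanDist_congr`, `indepFun_meanDist`). So the expected
regret of a complete block equals the sum of Bδ(k)E q(k), and the fluctuation of its excess loss has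
variance at most B. In the sum over a run, at most half of the regret reappears on the right hand
side and is absorbed (`sum_meanProb_le`). -/

noncomputable section

namespace DistBandit

/-! ### The hybrid regularizer -/

/-- The objective `⟨Z, q⟩ + β ∑ q log q - 2 g ∑ √q`. -/
def hybridObj {K : ℕ} (β g : ℝ) (Z q : Fin K → ℝ) : ℝ :=
  ∑ k, Z k * q k + (β * ∑ k, q k * Real.log (q k) - 2 * g * ∑ k, √(q k))

theorem ftrlObjective_eq_hybridObj (N K B t : ℕ) :
    ftrlObjective N K B t = hybridObj (1 / eta K B t) (1 / gammaRate N B t) := by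
  funext Z q
  simp only [ftrlObjective, regularizer, hybridObj]
  ring

theorem hybridObj_eq_sum {K : ℕ} (β g : ℝ) (Z q : Fin K → ℝ) :
    hybridObj β g Z q = ∑ k, (Z k * q k + β * (q k * Real.log (q k)) - 2 * g * √(q k)) := by
  simp only [hybridObj, Finset.sum_add_distrib, Finset.sum_sub_distrib, Finset.mul_sum]
  ring

theorem convexOn_hybrid_coord {β g : ℝ} (hβ : 0 ≤ β) (hg : 0 ≤ g) (z : ℝ) :
    ConvexOn ℝ (Set.Ici (0 : ℝ)) fun x => z * x + β * (x * Real.log x) - 2 * g * √x := by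
  have h1 : ConvexOn ℝ (Set.Ici (0 : ℝ)) fun x : ℝ => z * x :=
    ⟨convex_Ici 0, fun x _ y _ a b _ _ _ => le_of_eq (by simp only [smul_eq_mul]; ring)⟩
  have h2 := (Real.convexOn_mul_log).smul hβ
  have h3 := (Real.strictConcaveOn_sqrt.concaveOn.neg).smul (show 0 ≤ 2 * g by positivity)
  have := (h1.add h2).add h3
  refine this.congr (fun x _ => ?_)
  simp only [Pi.add_apply, smul_eq_mul, Pi.neg_apply]
  ring

/-- Minimizers of the hybrid objective lie in the interior of the simplex. -/
theorem hybridObj_minimizer_pos {K : ℕ} {β g : ℝ} (hβ : 0 < β) (hg : 0 ≤ g)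
    {Z q : Fin K → ℝ} (hq : q ∈ stdSimplex ℝ (Fin K))
    (hmin : IsMinOn (hybridObj β g Z) (stdSimplex ℝ (Fin K)) q) (k : Fin K) : 0 < q k := by
  by_contra hk
  have hk0 : q k = 0 := le_antisymm (not_lt.mp hk) (hq.1 k)
  have hK : 0 < K := Fin.pos k
  have hKr : (0 : ℝ) < K := by exact_mod_cast hK
  set f : Fin K → ℝ → ℝ := fun j x => Z j * x + β * (x * Real.log x) - 2 * g * √x with hf
  set u : ℝ := 1 / K with hu
  have hu0 : 0 < u := by positivity
  set D : ℝ := ∑ j ∈ univ.erase k, (f j u - f j (q j)) with hD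
  -- the objective along the segment towards the uniform distribution
  have key : ∀ ε : ℝ, 0 < ε → ε ≤ 1 → 0 ≤ D + Z k * u + β * u * Real.log (ε * u) := by
    intro ε he he1
    have hmem : (fun j => (1 - ε) * q j + ε * u) ∈ stdSimplex ℝ (Fin K) := by
      refine ⟨fun j => ?_, ?_⟩
      · have := hq.1 j
        have : 0 ≤ 1 - ε := by linarith
        positivity
      · rw [Finset.sum_add_distrib, ← Finset.mul_sum, hq.2]
        simp [hu]
        field_simp
        ring
    have h1 : hybridObj β g Z q ≤ _ := hmin hmem
    rw [hybridObj_eq_sum, hybridObj_eq_sum, ← Finset.add_sum_erase _ _ (mem_univ k),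
      ← Finset.add_sum_erase _ _ (mem_univ k)] at h1
    have h2 : ∑ j ∈ univ.erase k, f j ((1 - ε) * q j + ε * u)
        ≤ ∑ j ∈ univ.erase k, f j (q j) + ε * D := by
      rw [hD, Finset.mul_sum, ← Finset.sum_add_distrib]
      refine Finset.sum_le_sum fun j _ => ?_
      have := (convexOn_hybrid_coord hβ.le hg (Z j)).2 (hq.1 j) hu0.le
        (show 0 ≤ 1 - ε by linarith) he.le (by ring)
      simp only [smul_eq_mul] at this
      simp only [hf]
      linarith
    simp only [hf] at h2
    simp only [hk0, mul_zero, Real.sqrt_zero, zero_add, Real.log_zero, sub_zero] at h1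
    have h3 : 0 ≤ 2 * g * √(ε * u) := by positivity
    have h4 : 0 ≤ ε * (D + Z k * u + β * u * Real.log (ε * u)) := by nlinarith
    exact nonneg_of_mul_nonneg_right h4 he
  -- The entropy has slope -∞ at 0: the bracket of `key` tends to -∞, so a short step towards the
  -- uniform distribution would lower the objective below its minimum.
  have hlim : Filter.Tendsto (fun ε : ℝ => D + Z k * u + β * u * Real.log (ε * u))
      (nhdsWithin 0 (Set.Ioi 0)) Filter.atBot := by
    have h0 : Filter.Tendsto (fun ε : ℝ => ε * u) (nhdsWithin 0 (Set.Ioi 0))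
        (nhdsWithin 0 (Set.Ioi 0)) := by
      refine tendsto_nhdsWithin_iff.mpr ⟨?_, ?_⟩
      · have : Filter.Tendsto (fun ε : ℝ => ε * u) (nhds 0) (nhds (0 * u)) :=
          (continuous_id.mul continuous_const).tendsto 0
        rw [zero_mul] at this
        exact this.mono_left nhdsWithin_le_nhds
      · filter_upwards [self_mem_nhdsWithin] with x hx
        exact mul_pos hx hu0
    have h1 := (Real.tendsto_log_nhdsGT_zero).comp h0
    exact Filter.tendsto_atBot_add_const_left _ _
      (h1.const_mul_atBot (show 0 < β * u by positivity))
  have h1 := hlim.eventually (Filter.eventually_lt_atBot (0 : ℝ))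
  have h2 : ∀ᶠ ε : ℝ in nhdsWithin 0 (Set.Ioi 0), ε ∈ Set.Ioc (0 : ℝ) 1 :=
    Ioc_mem_nhdsGT one_pos
  obtain ⟨ε, h3, h4⟩ := (h1.and h2).exists
  exact absurd (key ε h4.1 h4.2) (not_le.mpr h3)

/-- Apply log u ≥ 1 - 1/u to u = √y/√x. This bounds the entropy divergence below by the Hellinger
term that also governs the Tsallis part. -/
theorem sq_sub_sqrt_le_entropy_div {x y : ℝ} (hx : 0 < x) (hy : 0 ≤ y) :
    (√y - √x) ^ 2 ≤ y * Real.log y - x * Real.log x - (Real.log x + 1) * (y - x) := by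
  have hxs := Real.sq_sqrt hx.le
  have hys := Real.sq_sqrt hy
  rcases hy.eq_or_lt with rfl | hy
  · simp only [Real.sqrt_zero, zero_mul, zero_sub, Real.log_zero]
    nlinarith
  · have hsx : 0 < √x := Real.sqrt_pos.mpr hx
    have hsy : 0 < √y := Real.sqrt_pos.mpr hy
    have h1 := Real.one_sub_inv_le_log_of_pos (div_pos hsy hsx)
    rw [inv_div, Real.log_div hsy.ne' hsx.ne', Real.log_sqrt hy.le, Real.log_sqrt hx.le] at h1
    have h2 := mul_le_mul_of_nonneg_left h1 hy.le
    have h3 : y * (1 - √x / √y) = y - √x * √y := by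
      field_simp
      nlinarith
    rw [h3] at h2
    nlinarith

/-- The Bregman divergence of -2√ is computed exactly; with (y - x) = (√y - √x)(√y + √x) it is a
perfect square over √x. -/
theorem tsallis_div_eq {x y : ℝ} (hx : 0 < x) (hy : 0 ≤ y) :
    -2 * √y + 2 * √x + (y - x) / √x = (√y - √x) ^ 2 / √x := by
  have hsx : 0 < √x := Real.sqrt_pos.mpr hx
  have hxs := Real.sq_sqrt hx.le
  have hys := Real.sq_sqrt hy
  field_simp
  nlinarith

/-- The derivative of one coordinate of the hybrid objective. -/
def hybridDeriv (β g z x : ℝ) : ℝ := z + β * (Real.log x + 1) - g / √x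

/-- Both divergences are measured by (√y - √x)², so their curvatures simply add up to β + g/√x. -/
theorem hybrid_coord_bregman {β g : ℝ} (hβ : 0 ≤ β) (z : ℝ) {x y : ℝ}
    (hx : 0 < x) (hy : 0 ≤ y) :
    (√y - √x) ^ 2 * (β + g / √x) + hybridDeriv β g z x * (y - x) ≤
      (z * y + β * (y * Real.log y) - 2 * g * √y)
        - (z * x + β * (x * Real.log x) - 2 * g * √x) := by
  have h1 := mul_le_mul_of_nonneg_left (sq_sub_sqrt_le_entropy_div hx hy) hβ
  have h2 := congrArg (fun r => g * r) (tsallis_div_eq hx hy)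
  simp only [hybridDeriv]
  have e1 : (√y - √x) ^ 2 * (β + g / √x)
      = β * (√y - √x) ^ 2 + g * ((√y - √x) ^ 2 / √x) := by ring
  have e2 : (z + β * (Real.log x + 1) - g / √x) * (y - x)
      = z * (y - x) + β * ((Real.log x + 1) * (y - x)) - g * ((y - x) / √x) := by ring
  rw [e1, e2]
  nlinarith

theorem hasDerivAt_hybrid_coord (β g z : ℝ) {x : ℝ} (hx : 0 < x) :
    HasDerivAt (fun x => z * x + β * (x * Real.log x) - 2 * g * √x) (hybridDeriv β g z x) x := by
  have h1 := (hasDerivAt_id x).const_mul z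
  have h2 := (Real.hasDerivAt_mul_log hx.ne').const_mul β
  have h3 := (Real.hasDerivAt_sqrt hx.ne').const_mul (2 * g)
  refine ((h1.add h2).sub h3).congr_deriv ?_
  unfold hybridDeriv
  have : √x ≠ 0 := (Real.sqrt_pos.mpr hx).ne'
  field_simp

/-- First order optimality. -/
theorem hybridObj_first_order {K : ℕ} {β g : ℝ} (hβ : 0 < β) (hg : 0 ≤ g)
    {Z q : Fin K → ℝ} (hq : q ∈ stdSimplex ℝ (Fin K))
    (hmin : IsMinOn (hybridObj β g Z) (stdSimplex ℝ (Fin K)) q) {y : Fin K → ℝ}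
    (hy : y ∈ stdSimplex ℝ (Fin K)) :
    0 ≤ ∑ k, hybridDeriv β g (Z k) (q k) * (y k - q k) := by
  have hpos := hybridObj_minimizer_pos hβ hg hq hmin
  set φ : ℝ → ℝ := fun ε => hybridObj β g Z (fun k => q k + ε * (y k - q k)) with hφ
  have hd : HasDerivAt φ (∑ k, hybridDeriv β g (Z k) (q k) * (y k - q k)) 0 := by
    have : φ = fun ε => ∑ k, (fun x => Z k * x + β * (x * Real.log x) - 2 * g * √x)
        (q k + ε * (y k - q k)) := by
      funext ε
      rw [hφ]
      simp only [hybridObj_eq_sum]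
    rw [this]
    refine HasDerivAt.fun_sum fun k _ => ?_
    have h1 : HasDerivAt (fun ε : ℝ => q k + ε * (y k - q k)) (y k - q k) 0 := by
      simpa using ((hasDerivAt_id (0 : ℝ)).mul_const (y k - q k)).const_add (q k)
    have h2 : HasDerivAt (fun x => Z k * x + β * (x * Real.log x) - 2 * g * √x)
        (hybridDeriv β g (Z k) (q k)) (q k + 0 * (y k - q k)) := by
      simpa using hasDerivAt_hybrid_coord β g (Z k) (hpos k)
    exact h2.comp (0 : ℝ) h1
  have hmin' : ∀ ε ∈ Set.Ioc (0 : ℝ) 1, φ 0 ≤ φ ε := by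
    intro ε he
    have hmem : (fun k => q k + ε * (y k - q k)) ∈ stdSimplex ℝ (Fin K) := by
      have := (convex_stdSimplex ℝ (Fin K)) hq hy (show 0 ≤ 1 - ε by linarith [he.2]) he.1.le
        (by ring)
      convert this using 1
      funext k
      simp only [Pi.add_apply, Pi.smul_apply, smul_eq_mul]
      ring
    have := hmin hmem
    simpa [hφ] using this
  have h1 := (hasDerivAt_iff_tendsto_slope.mp hd)
  have h2 : Filter.Tendsto (slope φ 0) (nhdsWithin 0 (Set.Ioi 0))
      (nhds (∑ k, hybridDeriv β g (Z k) (q k) * (y k - q k))) :=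
    h1.mono_left (nhdsWithin_mono _ (fun x hx => ne_of_gt hx))
  refine ge_of_tendsto h2 ?_
  filter_upwards [Ioc_mem_nhdsGT (show (0 : ℝ) < 1 by norm_num)] with ε he
  rw [slope_def_field]
  exact div_nonneg (by linarith [hmin' ε he]) (by linarith [he.1])

/-- Growth of the objective around its minimizer. -/
theorem hybridObj_growth {K : ℕ} {β g : ℝ} (hβ : 0 < β) (hg : 0 ≤ g)
    {Z q : Fin K → ℝ} (hq : q ∈ stdSimplex ℝ (Fin K))
    (hmin : IsMinOn (hybridObj β g Z) (stdSimplex ℝ (Fin K)) q) {y : Fin K → ℝ}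
    (hy : y ∈ stdSimplex ℝ (Fin K)) :
    ∑ k, (√(y k) - √(q k)) ^ 2 * (β + g / √(q k)) ≤ hybridObj β g Z y - hybridObj β g Z q := by
  have hpos := hybridObj_minimizer_pos hβ hg hq hmin
  have h1 := hybridObj_first_order hβ hg hq hmin hy
  have h2 := Finset.sum_le_sum fun k (_ : k ∈ univ) =>
    hybrid_coord_bregman (g := g) hβ.le (Z k) (hpos k) (hy.1 k)
  rw [Finset.sum_add_distrib, Finset.sum_sub_distrib, ← hybridObj_eq_sum,
    ← hybridObj_eq_sum] at h2
  linarith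

theorem le_one_of_mem_stdSimplex {K : ℕ} {q : Fin K → ℝ} (hq : q ∈ stdSimplex ℝ (Fin K))
    (k : Fin K) : q k ≤ 1 := by
  rw [← hq.2]
  exact Finset.single_le_sum (fun j _ => hq.1 j) (mem_univ k)

theorem sq_sub_le_four_mul {x y : ℝ} (hx : 0 ≤ x) (hy : 0 ≤ y) (hx1 : x ≤ 1) (hy1 : y ≤ 1) :
    (y - x) ^ 2 ≤ 4 * (√y - √x) ^ 2 := by
  have e : y - x = (√y - √x) * (√y + √x) := by
    have := Real.sq_sqrt hx
    have := Real.sq_sqrt hy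
    nlinarith
  have h1 : √y ≤ 1 := Real.sqrt_le_one.mpr hy1
  have h2 : √x ≤ 1 := Real.sqrt_le_one.mpr hx1
  have h3 := Real.sqrt_nonneg x
  have h4 := Real.sqrt_nonneg y
  rw [e, mul_pow]
  have : (√y + √x) ^ 2 ≤ 4 := by nlinarith
  nlinarith [sq_nonneg (√y - √x)]

/-- Minimizers depend on the linear part in a Lipschitz way. -/
theorem hybridObj_minimizer_lipschitz {K : ℕ} {β g : ℝ} (hβ : 0 < β) (hg : 0 ≤ g)
    {Z Z' q q' : Fin K → ℝ} (hq : q ∈ stdSimplex ℝ (Fin K)) (hq' : q' ∈ stdSimplex ℝ (Fin K))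
    (hmin : IsMinOn (hybridObj β g Z) (stdSimplex ℝ (Fin K)) q)
    (hmin' : IsMinOn (hybridObj β g Z') (stdSimplex ℝ (Fin K)) q') {ε : ℝ}
    (hε : ∀ k, |Z k - Z' k| ≤ ε) (k : Fin K) : |q k - q' k| ≤ 2 * K * ε / β := by
  have hK : 0 < K := Fin.pos k
  have hpos := hybridObj_minimizer_pos hβ hg hq hmin
  have hpos' := hybridObj_minimizer_pos hβ hg hq' hmin'
  have h1 := hybridObj_growth hβ hg hq hmin hq'
  have h2 := hybridObj_growth hβ hg hq' hmin' hq
  have hlow : ∀ {x y : Fin K → ℝ}, x ∈ stdSimplex ℝ (Fin K) → y ∈ stdSimplex ℝ (Fin K) →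
      β / 4 * ∑ k, (y k - x k) ^ 2 ≤ ∑ k, (√(y k) - √(x k)) ^ 2 * (β + g / √(x k)) := by
    intro x y hx hy
    rw [Finset.mul_sum]
    refine Finset.sum_le_sum fun k _ => ?_
    have a1 := sq_sub_le_four_mul (hx.1 k) (hy.1 k) (le_one_of_mem_stdSimplex hx k)
      (le_one_of_mem_stdSimplex hy k)
    have a2 : 0 ≤ g / √(x k) := by positivity
    have a3 := sq_nonneg (√(y k) - √(x k))
    nlinarith [mul_nonneg a3 a2]
  have h3 := hlow hq hq'
  have h4 := hlow hq' hq
  -- When the two growth inequalities are added, the regularizers cancel and only the pairing of the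
  -- two differences is left.
  have h5 : (hybridObj β g Z q' - hybridObj β g Z q)
      + (hybridObj β g Z' q - hybridObj β g Z' q') = ∑ k, (Z k - Z' k) * (q' k - q k) := by
    simp only [hybridObj_eq_sum, ← Finset.sum_sub_distrib, ← Finset.sum_add_distrib]
    exact Finset.sum_congr rfl fun k _ => by ring
  obtain ⟨m, -, hm⟩ := Finset.exists_max_image univ (fun k => |q k - q' k|) ⟨k, mem_univ k⟩
  have h6 : ∑ k, (Z k - Z' k) * (q' k - q k) ≤ K * (ε * |q m - q' m|) := by
    calc ∑ k, (Z k - Z' k) * (q' k - q k) ≤ ∑ _k : Fin K, ε * |q m - q' m| := by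
          refine Finset.sum_le_sum fun j _ => (le_abs_self _).trans ?_
          rw [abs_mul, abs_sub_comm (q' j)]
          exact mul_le_mul (hε j) (hm j (mem_univ j)) (abs_nonneg _)
            ((abs_nonneg _).trans (hε j))
      _ = _ := by simp
  have h7 : |q m - q' m| ^ 2 ≤ ∑ k, (q k - q' k) ^ 2 := by
    rw [sq_abs]
    exact Finset.single_le_sum (f := fun k => (q k - q' k) ^ 2) (fun j _ => sq_nonneg _)
      (mem_univ m)
  have h8 : ∑ k, (q' k - q k) ^ 2 = ∑ k, (q k - q' k) ^ 2 :=
    Finset.sum_congr rfl fun k _ => by ring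
  rw [h8] at h3
  have h9 : β / 2 * |q m - q' m| ^ 2 ≤ K * (ε * |q m - q' m|) := by nlinarith
  have h10 : |q m - q' m| ≤ 2 * K * ε / β := by
    rw [le_div_iff₀ hβ]
    rcases (abs_nonneg (q m - q' m)).eq_or_lt with h0 | h0
    · rw [← h0]
      have : 0 ≤ ε := (abs_nonneg _).trans (hε k)
      simp only [zero_mul]
      positivity
    · have : |q m - q' m| * (β / 2 * |q m - q' m|) ≤ |q m - q' m| * (K * ε) := by nlinarith
      have := le_of_mul_le_mul_left this h0
      linarith
  exact (hm k (mem_univ k)).trans h10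

/-! ### Stability and the regret inequality of FTRL -/

/-- The one step stability of the learner. -/
theorem hybrid_stability {K : ℕ} {β g : ℝ} (hβ : 0 < β) (hg : 0 ≤ g) {q y z : Fin K → ℝ}
    (hq : q ∈ stdSimplex ℝ (Fin K)) (hpos : ∀ k, 0 < q k)
    (hy : y ∈ stdSimplex ℝ (Fin K)) {c : ℝ} (hc : ∀ k, -(β / 2) ≤ z k - c) :
    ∑ k, z k * (q k - y k) - ∑ k, (√(y k) - √(q k)) ^ 2 * (β + g / √(q k)) ≤
      ∑ k, 2 * (z k - c) ^ 2 * (q k / (β + g / √(q k))) := by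
  -- Both points have total mass 1, so a constant may be subtracted from the feedback.
  have e : ∑ k, z k * (q k - y k) = ∑ k, (z k - c) * (q k - y k) := by
    simp only [sub_mul, Finset.sum_sub_distrib, mul_sub, ← Finset.mul_sum, hq.2, hy.2]
    ring
  rw [e, ← Finset.sum_sub_distrib]
  refine Finset.sum_le_sum fun k _ => ?_
  have hsq : 0 < √(q k) := Real.sqrt_pos.mpr (hpos k)
  set w := z k - c with hw
  set G := β + g / √(q k) with hG
  set s := √(y k) - √(q k) with hs
  have hGβ : β ≤ G := by
    have : 0 ≤ g / √(q k) := by positivity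
    linarith
  have hGp : 0 < G := by linarith
  have e1 : q k - y k = -(s * (s + 2 * √(q k))) := by
    have h1 := Real.sq_sqrt (hpos k).le
    have h2 := Real.sq_sqrt (hy.1 k)
    simp only [hs]
    nlinarith
  have hwG : -(G / 2) ≤ w := by linarith [hc k]
  have e2 : 2 * w ^ 2 * (q k / G) = 2 * w ^ 2 * √(q k) ^ 2 / G := by
    rw [Real.sq_sqrt (hpos k).le]
    ring
  rw [e1, e2, le_div_iff₀ hGp]
  -- The left side is -(G + w)s² - 2ws√q. Since G + w ≥ G/2, it is at most the maximum of -(G/2)s² -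
  -- 2ws√q over s, which is 2w²q/G.
  nlinarith [sq_nonneg (G * s + 2 * w * √(q k)), mul_nonneg (mul_nonneg hGp.le (sq_nonneg s))
    (show 0 ≤ w + G / 2 by linarith)]

/-- The regret inequality of follow the regularized leader with the hybrid regularizer. -/
theorem ftrl_regret {K : ℕ} (β g : ℕ → ℝ) (hβ : ∀ s, 0 < β s) (hg : ∀ s, 0 ≤ g s)
    (z q : ℕ → Fin K → ℝ) (c : ℕ → ℝ) (n : ℕ)
    (hq : ∀ s ≤ n, q s ∈ stdSimplex ℝ (Fin K))
    (hmin : ∀ s ≤ n, IsMinOn (hybridObj (β s) (g s) (fun k => ∑ r ∈ range s, z r k))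
      (stdSimplex ℝ (Fin K)) (q s))
    (hc : ∀ s ≤ n, ∀ k, -(β s / 2) ≤ z s k - c s) {u : Fin K → ℝ}
    (hu : u ∈ stdSimplex ℝ (Fin K)) :
    ∑ s ∈ range (n + 1), ∑ k, z s k * (q s k - u k) ≤
      ∑ s ∈ range (n + 1),
          ∑ k, 2 * (z s k - c s) ^ 2 * (q s k / (β s + g s / √(q s k)))
        + (hybridObj (β n) (g n) 0 u - hybridObj (β 0) (g 0) 0 (q 0))
        + ∑ s ∈ range n, (hybridObj (β s) (g s) 0 (q (s + 1))
            - hybridObj (β (s + 1)) (g (s + 1)) 0 (q (s + 1))) := by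
  set Z : ℕ → Fin K → ℝ := fun s k => ∑ r ∈ range s, z r k with hZ
  have hsplit : ∀ (b' g' : ℝ) (Y p : Fin K → ℝ),
      hybridObj b' g' Y p = ∑ k, Y k * p k + hybridObj b' g' 0 p := by
    intro b' g' Y p
    simp [hybridObj]
  have hstep : ∀ s ≤ n, ∀ y ∈ stdSimplex ℝ (Fin K),
      ∑ k, z s k * (q s k - y k) ≤
        ∑ k, 2 * (z s k - c s) ^ 2 * (q s k / (β s + g s / √(q s k)))
        + (hybridObj (β s) (g s) (Z s) y - hybridObj (β s) (g s) (Z s) (q s)) := by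
    intro s hs y hy
    have h1 := hybridObj_growth (hβ s) (hg s) (hq s hs) (hmin s hs) hy
    have h2 := hybrid_stability (hβ s) (hg s) (hq s hs)
      (hybridObj_minimizer_pos (hβ s) (hg s) (hq s hs) (hmin s hs)) hy (hc s hs)
    linarith
  have hZs : ∀ s (p : Fin K → ℝ), ∑ k, Z (s + 1) k * p k
      = ∑ k, Z s k * p k + ∑ k, z s k * p k := by
    intro s p
    simp only [hZ, Finset.sum_range_succ, add_mul, Finset.sum_add_distrib]
  -- Telescoping of minimal values: passing from the m-th to the next minimizer costs one stability
  -- term and the change of regularizer at the new point.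
  have hind : ∀ m ≤ n, ∑ s ∈ range m, ∑ k, z s k * q s k ≤
      ∑ s ∈ range m, ∑ k, 2 * (z s k - c s) ^ 2 * (q s k / (β s + g s / √(q s k)))
        + (hybridObj (β m) (g m) (Z m) (q m) - hybridObj (β 0) (g 0) 0 (q 0))
        + ∑ s ∈ range m, (hybridObj (β s) (g s) 0 (q (s + 1))
            - hybridObj (β (s + 1)) (g (s + 1)) 0 (q (s + 1))) := by
    intro m
    induction m with
    | zero =>
      intro _
      rw [hsplit _ _ (Z 0)]
      simp [hZ]
    | succ m ih =>
      intro hm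
      have h1 := ih (by omega)
      have h2 := hstep m (by omega) (q (m + 1)) (hq _ hm)
      have h3 := hZs m (q (m + 1))
      rw [Finset.sum_range_succ, Finset.sum_range_succ _ m, Finset.sum_range_succ _ m]
      simp only [mul_sub, Finset.sum_sub_distrib] at h2
      rw [hsplit _ _ (Z m) (q (m + 1))] at h2
      rw [hsplit _ _ (Z (m + 1)) (q (m + 1))]
      linarith
  have h1 := hind n le_rfl
  -- The last feedback is compared with `u` directly, so the comparator is charged the regularizer
  -- of index `n` and no minimizer of index `n + 1` is needed.
  have h2 := hstep n le_rfl u hu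
  have h3 : ∑ s ∈ range (n + 1), ∑ k, z s k * u k = ∑ k, Z n k * u k + ∑ k, z n k * u k := by
    rw [← hZs n u, Finset.sum_comm]
    simp only [hZ, Finset.sum_mul]
  rw [hsplit _ _ (Z n) u] at h2
  simp only [mul_sub, Finset.sum_sub_distrib] at h2 ⊢
  rw [h3, Finset.sum_range_succ, Finset.sum_range_succ _ n]
  simp only [Finset.sum_sub_distrib] at h1
  linarith

/-! ### Extremal values of the two entropies -/

theorem neg_sum_mul_log_le {K : ℕ} {q : Fin K → ℝ} (hq : q ∈ stdSimplex ℝ (Fin K)) :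
    -∑ k, q k * Real.log (q k) ≤ Real.log K := by
  rcases Nat.eq_zero_or_pos K with rfl | hK
  · simp
  have hKr : (0 : ℝ) < K := by exact_mod_cast hK
  have h : ∀ k, q k * (-Real.log (q k)) ≤ q k * Real.log K + (1 / K - q k) := by
    intro k
    rcases (hq.1 k).eq_or_lt with h0 | h0
    · rw [← h0]
      simp
    · have h1 := Real.log_le_sub_one_of_pos (show 0 < 1 / (K * q k) by positivity)
      rw [one_div, Real.log_inv, Real.log_mul hKr.ne' h0.ne'] at h1
      have h2 := mul_le_mul_of_nonneg_left h1 h0.le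
      have h3 : q k * ((K * q k)⁻¹ - 1) = 1 / K - q k := by field_simp
      rw [h3] at h2
      nlinarith
  have := Finset.sum_le_sum fun k (_ : k ∈ univ) => h k
  rw [Finset.sum_add_distrib, ← Finset.sum_mul, hq.2, Finset.sum_sub_distrib, hq.2] at this
  simp only [mul_neg, Finset.sum_neg_distrib, Finset.sum_const, card_univ, Fintype.card_fin,
    nsmul_eq_mul] at this
  have e : (K : ℝ) * (1 / K) = 1 := by field_simp
  rw [e] at this
  linarith

theorem sum_sqrt_le {K : ℕ} {q : Fin K → ℝ} (hq : q ∈ stdSimplex ℝ (Fin K)) :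
    ∑ k, √(q k) ≤ √K := by
  refine Real.le_sqrt_of_sq_le ?_
  have := sq_sum_le_card_mul_sum_sq (s := univ) (f := fun k => √(q k))
  simp only [Real.sq_sqrt (hq.1 _), hq.2] at this
  simpa using this

theorem uniform_mem_stdSimplex {K : ℕ} (hK : 0 < K) :
    (fun _ => 1 / (K : ℝ)) ∈ stdSimplex ℝ (Fin K) := by
  have hKr : (K : ℝ) ≠ 0 := by positivity
  exact ⟨fun k => by positivity, by simp [hKr]⟩

/-- Shannon and Tsallis entropy are maximal at the same point. Hence the prescribed uniform start is
itself an FTRL iterate, for any rates, and needs no separate treatment in the regret inequality. -/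
theorem hybridObj_uniform_isMinOn {K : ℕ} (hK : 0 < K) {β g : ℝ} (hβ : 0 ≤ β) (hg : 0 ≤ g) :
    IsMinOn (hybridObj β g (0 : Fin K → ℝ)) (stdSimplex ℝ (Fin K)) (fun _ => 1 / (K : ℝ)) := by
  intro q hq
  have hKr : (0 : ℝ) < K := by exact_mod_cast hK
  have h1 := neg_sum_mul_log_le hq
  have h2 := sum_sqrt_le hq
  simp only [Set.mem_ofPred_eq, hybridObj, Pi.zero_apply, zero_mul, Finset.sum_const_zero, zero_add,
    Finset.sum_const, card_univ, Fintype.card_fin, nsmul_eq_mul, one_div, Real.log_inv]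
  have e1 : (K : ℝ) * ((K : ℝ)⁻¹ * -Real.log K) = -Real.log K := by field_simp
  have e2 : (K : ℝ) * √((K : ℝ)⁻¹) = √K := by
    rw [Real.sqrt_inv]
    nth_rewrite 1 [← Real.mul_self_sqrt hKr.le]
    have : √(K : ℝ) ≠ 0 := (Real.sqrt_pos.mpr hKr).ne'
    field_simp
  rw [e1, e2]
  nlinarith

/-! ### Accelerated gossip -/

/-- If the top right singular vector `v` has singular value `1` and the next singular value is
smaller, then the map contracts the orthogonal complement of `v`. -/
theorem norm_apply_le_of_inner_eq_zero {E : Type*} [NormedAddCommGroup E] [InnerProductSpace ℝ E]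
    [FiniteDimensional ℝ E] (A : E →ₗ[ℝ] E) {v y : E} (hv : v ≠ 0)
    (hAv : (LinearMap.adjoint A ∘ₗ A) v = v) (hσ : A.singularValues 1 < 1)
    (hy : inner ℝ y v = 0) : ‖A y‖ ≤ A.singularValues 1 * ‖y‖ := by
  set S := LinearMap.adjoint A ∘ₗ A with hSdef
  have hS : S.IsSymmetric := A.isSymmetric_adjoint_comp_self
  set n := Module.finrank ℝ E with hn
  set b := hS.eigenvectorBasis (n := n) rfl with hb
  have hσ0 := A.singularValues_nonneg 1
  have hev : ∀ i : Fin n, 1 ≤ (i : ℕ) →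
      hS.eigenvalues (n := n) rfl i ≤ A.singularValues 1 ^ 2 := by
    intro i hi
    rw [← A.sq_singularValues_fin rfl i]
    exact pow_le_pow_left₀ (A.singularValues_nonneg _) (A.singularValues_antitone hi) 2
  have hrepr : ∀ (w : E) (i : Fin n), b.repr (S w) i = hS.eigenvalues rfl i * b.repr w i :=
    fun w i => hS.eigenvectorBasis_apply_self_apply rfl w i
  -- `v` is fixed by A*A, so it has no component along eigenvalues smaller than 1. It is thus a
  -- multiple of the eigenvector of index 0, and a vector orthogonal to `v` has no component there.
  have hv0 : ∀ i : Fin n, 1 ≤ (i : ℕ) → b.repr v i = 0 := by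
    intro i hi
    have h1 := hrepr v i
    rw [hAv] at h1
    have h2 : hS.eigenvalues rfl i < 1 := (hev i hi).trans_lt (by nlinarith)
    have h3 : (1 - hS.eigenvalues rfl i) * b.repr v i = 0 := by linarith
    rcases mul_eq_zero.mp h3 with h | h
    · linarith
    · exact h
  have hy0 : ∀ i : Fin n, (i : ℕ) = 0 → b.repr y i = 0 := by
    intro i hi
    have h1 : inner ℝ y v = ∑ j, b.repr y j * b.repr v j := by
      rw [← b.repr.inner_map_map y v, PiLp.inner_apply]
      exact Finset.sum_congr rfl fun j _ => by simp [mul_comm]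
    rw [hy, Finset.sum_eq_single i] at h1
    · rcases mul_eq_zero.mp h1.symm with h | h
      · exact h
      · exfalso
        apply hv
        have : b.repr v = 0 := by
          ext j
          by_cases hj : (j : ℕ) = 0
          · have : j = i := Fin.ext (by omega)
            simpa [this] using h
          · simpa using hv0 j (by omega)
        simpa using this
    · intro j _ hj
      rw [hv0 j, mul_zero]
      have : (j : ℕ) ≠ i := fun h => hj (Fin.ext h)
      omega
    · simp
  have h1 : ‖A y‖ ^ 2 = ∑ i, hS.eigenvalues rfl i * (b.repr y i) ^ 2 := by
    rw [← real_inner_self_eq_norm_sq, ← LinearMap.adjoint_inner_left]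
    have : inner ℝ (S y) y = ∑ i, b.repr (S y) i * b.repr y i := by
      rw [← b.repr.inner_map_map (S y) y, PiLp.inner_apply]
      exact Finset.sum_congr rfl fun j _ => by simp [mul_comm]
    refine this.trans (Finset.sum_congr rfl fun i _ => ?_)
    rw [hrepr]
    ring
  have h2 : ‖y‖ ^ 2 = ∑ i, (b.repr y i) ^ 2 := by
    rw [← b.repr.norm_map y, EuclideanSpace.norm_sq_eq]
    simp
  have h3 : ‖A y‖ ^ 2 ≤ (A.singularValues 1 * ‖y‖) ^ 2 := by
    rw [h1, mul_pow, h2, Finset.mul_sum]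
    refine Finset.sum_le_sum fun i _ => ?_
    by_cases hi : (i : ℕ) = 0
    · simp [hy0 i hi]
    · exact mul_le_mul_of_nonneg_right (hev i (by omega)) (sq_nonneg _)
  exact le_of_sq_le_sq h3 (by positivity)

/-- Solutions of `v_{n+2} = 2 A v_{n+1} - v_n` with `A` a symmetric contraction grow at most
linearly. -/
theorem norm_le_of_two_step_recurrence {E : Type*} [NormedAddCommGroup E] [InnerProductSpace ℝ E]
    (A : E →ₗ[ℝ] E) (hA : A.IsSymmetric) (v : ℕ → E)
    (hv : ∀ n, v (n + 2) = (2 : ℝ) • A (v (n + 1)) - v n) (hle : ∀ n, ‖A (v n)‖ ≤ ‖v n‖) (n : ℕ) :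
    ‖v n‖ ≤ ‖v 0‖ + n * (‖v 1‖ + ‖v 0‖) := by
  -- A conserved energy of the two step recurrence; symmetry of `A` gives its invariance.
  set En : ℕ → ℝ := fun n => ‖v (n + 1)‖ ^ 2 + ‖v n‖ ^ 2 - 2 * inner ℝ (A (v (n + 1))) (v n)
    with hEn
  have hcons : ∀ n, En (n + 1) = En n := by
    intro n
    simp only [hEn]
    rw [show n + 1 + 1 = n + 2 from rfl, hv n]
    have e1 : ‖(2 : ℝ) • A (v (n + 1)) - v n‖ ^ 2
        = 4 * ‖A (v (n + 1))‖ ^ 2 - 4 * inner ℝ (A (v (n + 1))) (v n) + ‖v n‖ ^ 2 := by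
      rw [norm_sub_sq_real, norm_smul, inner_smul_left]
      norm_num
      ring
    have e2 : inner ℝ (A ((2 : ℝ) • A (v (n + 1)) - v n)) (v (n + 1))
        = 2 * ‖A (v (n + 1))‖ ^ 2 - inner ℝ (A (v (n + 1))) (v n) := by
      rw [hA, inner_sub_left, inner_smul_left, real_inner_self_eq_norm_sq,
        real_inner_comm (v n)]
      simp
    rw [e1, e2]
    ring
  have hE : ∀ n, En n = En 0 := by
    intro n
    induction n with
    | zero => rfl
    | succ n ih => rw [hcons, ih]
  have hE0 : En 0 ≤ (‖v 1‖ + ‖v 0‖) ^ 2 := by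
    simp only [hEn]
    have h1 := abs_real_inner_le_norm (A (v (0 + 1))) (v 0)
    have h2 := hle 1
    have h3 := neg_abs_le (inner ℝ (A (v (0 + 1))) (v 0))
    have h4 : ‖A (v (0 + 1))‖ * ‖v 0‖ ≤ ‖v 1‖ * ‖v 0‖ :=
      mul_le_mul_of_nonneg_right h2 (norm_nonneg _)
    simp only [zero_add] at *
    nlinarith
  -- The contraction property gives ‖v (n+1) - A (v n)‖² ≤ En n = En 0, so norms grow by at most a
  -- fixed amount per step.
  have hstep : ∀ n, ‖v (n + 1)‖ ≤ ‖v n‖ + (‖v 1‖ + ‖v 0‖) := by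
    intro n
    have h1 : ‖v (n + 1) - A (v n)‖ ^ 2 ≤ (‖v 1‖ + ‖v 0‖) ^ 2 := by
      refine le_trans ?_ ((hE n).le.trans hE0)
      simp only [hEn]
      rw [norm_sub_sq_real, hA]
      have := pow_le_pow_left₀ (norm_nonneg _) (hle n) 2
      linarith
    have h2 := le_of_sq_le_sq h1 (by positivity)
    have h3 : ‖v (n + 1)‖ ≤ ‖v (n + 1) - A (v n)‖ + ‖A (v n)‖ := by
      simpa using norm_add_le (v (n + 1) - A (v n)) (A (v n))
    linarith [hle n]
  induction n with
  | zero => simp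
  | succ n ih =>
    push_cast
    linarith [hstep n]

section Gossip

variable {N : ℕ} {G : SimpleGraph (Fin N)} {W : Matrix (Fin N) (Fin N) ℝ}

theorem sigma2_nonneg (W : Matrix (Fin N) (Fin N) ℝ) : 0 ≤ sigma2 W :=
  LinearMap.singularValues_nonneg _ _

theorem IsGossipMatrix.nonneg (hW : IsGossipMatrix G W) (i j : Fin N) : 0 ≤ W i j :=
  nonneg_of_mem_doublyStochastic hW.doublyStochastic

theorem IsGossipMatrix.row_sum (hW : IsGossipMatrix G W) (i : Fin N) : ∑ j, W i j = 1 :=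
  sum_row_of_mem_doublyStochastic hW.doublyStochastic i

theorem IsGossipMatrix.col_sum (hW : IsGossipMatrix G W) (j : Fin N) : ∑ i, W i j = 1 :=
  sum_col_of_mem_doublyStochastic hW.doublyStochastic j

theorem IsGossipMatrix.neighborAverage_eq (hW : IsGossipMatrix G W) {K : ℕ}
    (x : Fin N → Fin K → ℝ) (i : Fin N) (k : Fin K) :
    neighborAverage G W x i k = ∑ j, W i j * x j k := by
  classical
  unfold neighborAverage
  refine Finset.sum_subset (Finset.filter_subset _ _) fun j _ hj => ?_
  have h0 : W i j = 0 := by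
    refine le_antisymm (not_lt.mp fun h => hj ?_) (hW.nonneg i j)
    rcases hW.support i j h with h | h
    · exact Finset.mem_filter.mpr ⟨mem_univ _, Or.inl h⟩
    · exact Finset.mem_filter.mpr ⟨mem_univ _, Or.inr h.symm⟩
  rw [h0, zero_mul]

theorem IsGossipMatrix.isSymmetric (hW : IsGossipMatrix G W) :
    (Matrix.toEuclideanLin W).IsSymmetric := by
  rw [Matrix.isSymmetric_toEuclideanLin_iff]
  unfold Matrix.IsHermitian
  rw [Matrix.conjTranspose_eq_transpose_of_trivial]
  exact hW.symm

/-- The all-ones vector is fixed by `W` and, by symmetry, by the adjoint. The vectors orthogonal to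
it are those of mean zero, so the second singular value governs them. -/
theorem IsGossipMatrix.norm_apply_le (hW : IsGossipMatrix G W) (hN : 0 < N) (hσ : sigma2 W < 1)
    {y : EuclideanSpace ℝ (Fin N)} (hy : ∑ i, y i = 0) :
    ‖Matrix.toEuclideanLin W y‖ ≤ sigma2 W * ‖y‖ := by
  set v : EuclideanSpace ℝ (Fin N) := WithLp.toLp 2 fun _ => 1 with hv
  have hAv : Matrix.toEuclideanLin W v = v := by
    ext i
    simp [hv, Matrix.toLpLin_apply, Matrix.mulVec, dotProduct, hW.row_sum]
  refine norm_apply_le_of_inner_eq_zero (Matrix.toEuclideanLin W) (v := v) ?_ ?_ hσ ?_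
  · intro h
    have := congrArg (fun w : EuclideanSpace ℝ (Fin N) => w ⟨0, hN⟩) h
    simp [hv] at this
  · have h : LinearMap.adjoint (Matrix.toEuclideanLin W) = Matrix.toEuclideanLin W :=
      (LinearMap.isSymmetric_iff_isSelfAdjoint _).mp hW.isSymmetric
    rw [h, LinearMap.comp_apply, hAv, hAv]
  · rw [PiLp.inner_apply]
    simpa [hv] using hy

theorem kappa_pos (W : Matrix (Fin N) (Fin N) ℝ) : 0 < kappa W := by
  unfold kappa
  positivity

theorem half_le_kappa (W : Matrix (Fin N) (Fin N) ℝ) : 1 / 2 ≤ kappa W := by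
  unfold kappa
  refine one_div_le_one_div_of_le (by positivity) ?_
  have : √(1 - sigma2 W ^ 2) ≤ 1 := Real.sqrt_le_one.mpr (by nlinarith [sq_nonneg (sigma2 W)])
  linarith

theorem kappa_le_one (W : Matrix (Fin N) (Fin N) ℝ) : kappa W ≤ 1 := by
  unfold kappa
  rw [div_le_one (by positivity)]
  linarith [Real.sqrt_nonneg (1 - sigma2 W ^ 2)]

/-- This is what the choice of κ achieves. With s = √(1 - σ₂²) and κ = 1/(1 + s), the squared
inequality becomes (2 + s)²(1 - s) = 4 - 3s² - s³ ≤ 4. -/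
theorem momentum_le (hσ : sigma2 W < 1) : (1 + kappa W) / (2 * √(kappa W)) * sigma2 W ≤ 1 := by
  have hσ0 := sigma2_nonneg W
  have hk := kappa_pos W
  have hks : 0 < √(kappa W) := Real.sqrt_pos.mpr hk
  rw [div_mul_eq_mul_div, div_le_one (by positivity)]
  refine le_of_sq_le_sq ?_ (by positivity)
  rw [mul_pow, mul_pow, Real.sq_sqrt hk.le]
  set s := √(1 - sigma2 W ^ 2) with hs
  have hs0 : 0 ≤ s := Real.sqrt_nonneg _
  have hs2 : s ^ 2 = 1 - sigma2 W ^ 2 := Real.sq_sqrt (by nlinarith)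
  have hke : kappa W = 1 / (1 + s) := rfl
  rw [hke, show sigma2 W ^ 2 = 1 - s ^ 2 by linarith]
  have : (1 + 1 / (1 + s)) ^ 2 * (1 - s ^ 2) = (2 + s) ^ 2 * (1 - s) / (1 + s) := by
    field_simp
    ring
  rw [this, show (2 : ℝ) ^ 2 * (1 / (1 + s)) = 4 / (1 + s) by ring]
  refine div_le_div_of_nonneg_right ?_ (by positivity)
  nlinarith [pow_nonneg hs0 3, sq_nonneg s]

/-- Gossip converges to the average at the rate `√κ`, up to a linear factor. -/
theorem IsGossipMatrix.gossipSeq_error (hW : IsGossipMatrix G W) (hN : 0 < N)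
    (hσ : sigma2 W < 1) {K : ℕ} (x : Fin N → Fin K → ℝ) (k : Fin K) {X : ℝ}
    (hX : ∀ j, |x j k| ≤ X) (n : ℕ) (i : Fin N) :
    |gossipSeq G W x n i k - 1 / N * ∑ j, x j k| ≤
      √(kappa W) ^ n * ((1 + 5 / 2 * n) * (√N * X)) := by
  set A := Matrix.toEuclideanLin W with hA
  set m := 1 / (N : ℝ) * ∑ j, x j k with hm
  have hNr : (N : ℝ) ≠ 0 := by positivity
  set y : ℕ → EuclideanSpace ℝ (Fin N) :=
    fun n => WithLp.toLp 2 fun i => gossipSeq G W x n i k - m with hy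
  -- Constants satisfy the gossip recurrence, because rows sum to 1 and (1 + κ) - κ = 1; so the
  -- deviations from the mean satisfy it too.
  have hrec : ∀ n, y (n + 2) = (1 + kappa W) • A (y (n + 1)) - kappa W • y n := by
    intro n
    ext i
    simp only [hy, hA, gossipSeq, hW.neighborAverage_eq, Matrix.toLpLin_apply, PiLp.sub_apply,
      PiLp.smul_apply, smul_eq_mul, Matrix.mulVec, dotProduct, mul_sub, Finset.sum_sub_distrib,
      ← Finset.sum_mul, hW.row_sum]
    ring
  have hAsum : ∀ w : EuclideanSpace ℝ (Fin N), ∑ i, (A w) i = ∑ i, w i := by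
    intro w
    simp only [hA, Matrix.toLpLin_apply, Matrix.mulVec, dotProduct]
    rw [Finset.sum_comm]
    simp only [← Finset.sum_mul, hW.col_sum, one_mul]
  have hsum0 : ∑ i, y 0 i = 0 := by
    simp only [hy, gossipSeq, Finset.sum_sub_distrib, Finset.sum_const, card_univ,
      Fintype.card_fin, nsmul_eq_mul, hm]
    field_simp
    ring
  have hsum : ∀ n, ∑ i, y n i = 0 ∧ ∑ i, y (n + 1) i = 0 := by
    intro n
    induction n with
    | zero => exact ⟨hsum0, hsum0⟩
    | succ n ih =>
      refine ⟨ih.2, ?_⟩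
      rw [show n + 1 + 1 = n + 2 from rfl, hrec]
      simp only [PiLp.sub_apply, PiLp.smul_apply, smul_eq_mul, Finset.sum_sub_distrib,
        ← Finset.mul_sum, hAsum, ih.1, ih.2]
      ring
  have hκ := kappa_pos W
  have hks : 0 < √(kappa W) := Real.sqrt_pos.mpr hκ
  set r := (√(kappa W))⁻¹ with hr
  have hr0 : 0 < r := inv_pos.mpr hks
  have hrκ : r ^ 2 * kappa W = 1 := by
    rw [hr, inv_pow, Real.sq_sqrt hκ.le, inv_mul_cancel₀ hκ.ne']
  have hr32 : r ≤ 3 / 2 := by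
    have := half_le_kappa W
    refine le_of_sq_le_sq ?_ (by norm_num)
    nlinarith [sq_nonneg r]
  -- Scaling by κ^(-n/2) normalizes the coefficient of the older iterate to 1, which gives the two
  -- step recurrence for `c • A`, a contraction on mean zero vectors by `momentum_le`.
  set v : ℕ → EuclideanSpace ℝ (Fin N) := fun n => r ^ n • y n with hv
  set c := (1 + kappa W) / (2 * √(kappa W)) with hc
  have hc0 : 0 ≤ c := by positivity
  have hcr : 2 * c = (1 + kappa W) * r := by
    rw [hc, hr]
    field_simp
  have hbound := norm_le_of_two_step_recurrence (c • A)
    (fun a b => by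
      simp only [LinearMap.smul_apply, inner_smul_left, inner_smul_right]
      rw [hW.isSymmetric a b]
      simp [hA])
    v (by
      intro n
      simp only [hv, hrec, LinearMap.smul_apply, map_smul, smul_sub, smul_smul]
      congr 1
      · congr 1
        linear_combination (-r ^ (n + 1)) * hcr
      · congr 1
        rw [pow_add]
        linear_combination r ^ n * hrκ)
    (by
      intro n
      have h1 := hW.norm_apply_le hN hσ (y := v n) (by
        simp only [hv, PiLp.smul_apply, smul_eq_mul, ← Finset.mul_sum, (hsum n).1, mul_zero])
      rw [LinearMap.smul_apply, norm_smul, Real.norm_of_nonneg hc0]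
      calc c * ‖A (v n)‖ ≤ c * (sigma2 W * ‖v n‖) := mul_le_mul_of_nonneg_left h1 hc0
        _ = (c * sigma2 W) * ‖v n‖ := by ring
        _ ≤ 1 * ‖v n‖ := mul_le_mul_of_nonneg_right (momentum_le hσ) (norm_nonneg _)
        _ = _ := one_mul _) n
  have hX0 : 0 ≤ X := (abs_nonneg _).trans (hX i)
  -- Centering does not increase the Euclidean norm, and each of the N entries is at most X.
  have hy0 : ‖y 0‖ ≤ √N * X := by
    refine le_of_sq_le_sq ?_ (by positivity)
    rw [EuclideanSpace.norm_sq_eq, mul_pow, Real.sq_sqrt (by positivity)]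
    simp only [hy, gossipSeq, Real.norm_eq_abs, sq_abs]
    have hxm : ∑ j, x j k = N * m := by
      rw [hm]
      field_simp
    have e1 : ∑ j, (x j k - m) ^ 2 = ∑ j, x j k ^ 2 - N * m ^ 2 := by
      simp only [sub_sq, Finset.sum_add_distrib, Finset.sum_sub_distrib, ← Finset.sum_mul,
        ← Finset.mul_sum, hxm, Finset.sum_const, card_univ, Fintype.card_fin, nsmul_eq_mul]
      ring
    rw [e1]
    have e2 : ∑ j, x j k ^ 2 ≤ ∑ _j : Fin N, X ^ 2 :=
      Finset.sum_le_sum fun j _ => sq_le_sq' (by linarith [neg_abs_le (x j k), hX j])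
        ((le_abs_self _).trans (hX j))
    simp only [Finset.sum_const, card_univ, Fintype.card_fin, nsmul_eq_mul] at e2
    nlinarith [mul_nonneg (Nat.cast_nonneg (α := ℝ) N) (sq_nonneg m)]
  have hv0 : ‖v 0‖ = ‖y 0‖ := by simp [hv]
  have hv1 : ‖v 1‖ = r * ‖y 0‖ := by
    simp only [hv, pow_one, norm_smul, Real.norm_of_nonneg hr0.le]
    rfl
  have hyv : ‖y n‖ = √(kappa W) ^ n * ‖v n‖ := by
    simp only [hv, norm_smul, norm_pow, Real.norm_of_nonneg hr0.le]
    rw [hr, ← mul_assoc, ← mul_pow, mul_inv_cancel₀ hks.ne', one_pow, one_mul]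
  have h1 : |gossipSeq G W x n i k - m| ≤ ‖y n‖ := by
    simpa [hy] using PiLp.norm_apply_le (y n) i
  refine h1.trans ?_
  rw [hyv]
  refine mul_le_mul_of_nonneg_left ?_ (by positivity)
  rw [hv0, hv1] at hbound
  refine hbound.trans ?_
  have hn0 : (0 : ℝ) ≤ n := Nat.cast_nonneg n
  -- The two initial iterates coincide, so v 1 has norm r‖y 0‖; with r ≤ 3/2 the growth per step is
  -- at most 5/2 ‖y 0‖.
  have h2 : r * ‖y 0‖ ≤ 3 / 2 * ‖y 0‖ := mul_le_mul_of_nonneg_right hr32 (norm_nonneg _)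
  have h3 : (n : ℝ) * (r * ‖y 0‖ + ‖y 0‖) ≤ n * (5 / 2 * ‖y 0‖) :=
    mul_le_mul_of_nonneg_left (by linarith) hn0
  have h4 : (1 + 5 / 2 * (n : ℝ)) * ‖y 0‖ ≤ (1 + 5 / 2 * n) * (√N * X) :=
    mul_le_mul_of_nonneg_left hy0 (by positivity)
  linarith

/-! ### The block length and the gossip error of one block -/

theorem gossip_rate_pos (hσ : sigma2 W < 1) : 0 < (1 - 1 / √2) * √(1 - sigma2 W) := by
  have h2 : 1 < √(2 : ℝ) := Real.lt_sqrt_of_sq_lt (by norm_num)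
  have : 1 / √(2 : ℝ) < 1 := by rw [div_lt_one (by linarith)]; exact h2
  exact mul_pos (by linarith) (Real.sqrt_pos.mpr (by linarith))

theorem one_sub_inv_sqrt_two_le : 1 - 1 / √(2 : ℝ) ≤ 1 / 3 := by
  have h2 : √(2 : ℝ) ≤ 3 / 2 := Real.sqrt_le_iff.mpr ⟨by norm_num, by norm_num⟩
  have h1 : 0 < √(2 : ℝ) := by positivity
  have : 2 / 3 ≤ 1 / √(2 : ℝ) := by
    rw [div_le_div_iff₀ (by norm_num) h1]
    linarith
  linarith

/-- With r = √(1 - σ₂) ≤ s = √(1 - σ₂²), log(1 + s) ≥ log(1 + r) ≥ 2r/(r + 2) ≥ 2r/3. The constant 1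
- 1/√2 in the block length is at most 1/3, so its doubled rate is met. -/
theorem kappa_le_exp (hσ : sigma2 W < 1) :
    kappa W ≤ Real.exp (-(2 * ((1 - 1 / √2) * √(1 - sigma2 W)))) := by
  have hσ0 := sigma2_nonneg W
  set r := √(1 - sigma2 W) with hr
  set s := √(1 - sigma2 W ^ 2) with hs
  have hr0 : 0 ≤ r := Real.sqrt_nonneg _
  have hr1 : r ≤ 1 := Real.sqrt_le_one.mpr (by linarith)
  have hrs : r ≤ s := Real.sqrt_le_sqrt (by nlinarith)
  have h1 := Real.le_log_one_add_of_nonneg hr0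
  have h2 : Real.log (1 + r) ≤ Real.log (1 + s) := Real.log_le_log (by linarith) (by linarith)
  have h3 : 2 / 3 * r ≤ 2 * r / (r + 2) := by
    rw [le_div_iff₀ (by linarith)]
    nlinarith
  have h4 := mul_le_mul_of_nonneg_right one_sub_inv_sqrt_two_le hr0
  have h5 : kappa W = Real.exp (-Real.log (1 + s)) := by
    rw [Real.exp_neg, Real.exp_log (by linarith)]
    simp [kappa, hs]
  rw [h5]
  exact Real.exp_le_exp.mpr (by linarith)

theorem log_pos_of_blockLength {K T : ℕ} (hN : 0 < N) (hK : 2 ≤ K) (hT : 1 ≤ T) :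
    6 * Real.log ((K : ℝ) * T) ≤ Real.log (((K : ℝ) * T) ^ 6 * √(14 * N)) := by
  have hKr : (2 : ℝ) ≤ K := by exact_mod_cast hK
  have hTr : (1 : ℝ) ≤ T := by exact_mod_cast hT
  have hNr : (1 : ℝ) ≤ N := by exact_mod_cast hN
  have h14 : 1 ≤ √(14 * (N : ℝ)) := Real.one_le_sqrt.mpr (by linarith)
  rw [Real.log_mul (x := ((K : ℝ) * T) ^ 6) (by positivity) (by positivity), Real.log_pow]
  push_cast
  linarith [Real.log_nonneg h14]

theorem log_le_blockLength {K T : ℕ} (hN : 0 < N) (hK : 2 ≤ K) (hT : 1 ≤ T)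
    (hσ : sigma2 W < 1) : 6 * Real.log ((K : ℝ) * T) ≤ blockLength W K T := by
  have hσ0 := sigma2_nonneg W
  have hKr : (2 : ℝ) ≤ K := by exact_mod_cast hK
  have hTr : (1 : ℝ) ≤ T := by exact_mod_cast hT
  have h1 := log_pos_of_blockLength hN hK hT
  have hc := gossip_rate_pos hσ
  have h0 : 0 ≤ Real.log ((K : ℝ) * T) := Real.log_nonneg (by nlinarith)
  refine le_trans ?_ (Nat.le_ceil _)
  rw [le_div_iff₀ hc]
  have hc1 : (1 - 1 / √2) * √(1 - sigma2 W) ≤ 1 := by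
    have h2 : √(1 - sigma2 W) ≤ 1 := Real.sqrt_le_one.mpr (by linarith)
    have h3 := one_sub_inv_sqrt_two_le
    have h4 := Real.sqrt_nonneg (1 - sigma2 W)
    nlinarith
  nlinarith

theorem blockLength_pos {K T : ℕ} (hN : 0 < N) (hK : 2 ≤ K) (hT : 1 ≤ T)
    (hσ : sigma2 W < 1) : 0 < blockLength W K T := by
  have h1 := log_le_blockLength hN hK hT hσ
  have hKr : (2 : ℝ) ≤ K := by exact_mod_cast hK
  have hTr : (1 : ℝ) ≤ T := by exact_mod_cast hT
  have h0 : 0 < Real.log ((K : ℝ) * T) := Real.log_pos (by nlinarith)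
  have : (0 : ℝ) < blockLength W K T := by linarith
  exact_mod_cast this

/-- B is at least the logarithm of the right hand denominator divided by the exponential rate of √κ.
-/
theorem sqrt_kappa_pow_blockLength_le {K T : ℕ} (hN : 0 < N) (hK : 2 ≤ K) (hT : 1 ≤ T)
    (hσ : sigma2 W < 1) :
    √(kappa W) ^ blockLength W K T ≤ 1 / (((K : ℝ) * T) ^ 6 * √(14 * N)) := by
  set c := (1 - 1 / √2) * √(1 - sigma2 W) with hc
  have hc0 : 0 < c := gossip_rate_pos hσ
  have hKr : (2 : ℝ) ≤ K := by exact_mod_cast hK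
  have hTr : (1 : ℝ) ≤ T := by exact_mod_cast hT
  have hNr : (1 : ℝ) ≤ N := by exact_mod_cast hN
  have h1 : √(kappa W) ≤ Real.exp (-c) := by
    refine Real.sqrt_le_iff.mpr ⟨(Real.exp_pos _).le, ?_⟩
    rw [← Real.exp_nat_mul]
    refine (kappa_le_exp hσ).trans (Real.exp_le_exp.mpr ?_)
    push_cast
    linarith
  have h2 : Real.log (((K : ℝ) * T) ^ 6 * √(14 * N)) ≤ blockLength W K T * c := by
    rw [← div_le_iff₀ hc0]
    exact Nat.le_ceil _
  have hpos : 0 < ((K : ℝ) * T) ^ 6 * √(14 * N) := by positivity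
  calc √(kappa W) ^ blockLength W K T ≤ Real.exp (-c) ^ blockLength W K T :=
        pow_le_pow_left₀ (Real.sqrt_nonneg _) h1 _
    _ = Real.exp (-(blockLength W K T * c)) := by rw [← Real.exp_nat_mul]; ring_nf
    _ ≤ Real.exp (-Real.log (((K : ℝ) * T) ^ 6 * √(14 * N))) :=
        Real.exp_le_exp.mpr (by linarith)
    _ = _ := by rw [Real.exp_neg, Real.exp_log hpos, one_div]

/-- Error of the gossip approximation after one block. -/
theorem IsGossipMatrix.gossip_error (hW : IsGossipMatrix G W) (hN : 0 < N) {K T : ℕ}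
    (hK : 2 ≤ K) (hT : 1 ≤ T) (hσ : sigma2 W < 1) (x : Fin N → Fin K → ℝ) (k : Fin K) {X : ℝ}
    (hX : ∀ j, |x j k| ≤ X) (i : Fin N) :
    |gossip G W (blockLength W K T) x i k - 1 / N * ∑ j, x j k| ≤
      2 * blockLength W K T * X / ((K : ℝ) * T) ^ 6 := by
  have h1 := hW.gossipSeq_error hN hσ x k hX (blockLength W K T + 1) i
  refine h1.trans ?_
  have hB : (1 : ℝ) ≤ blockLength W K T := by exact_mod_cast blockLength_pos hN hK hT hσ
  have hX0 : 0 ≤ X := (abs_nonneg _).trans (hX i)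
  have hNr : (1 : ℝ) ≤ N := by exact_mod_cast hN
  have h2 := sqrt_kappa_pow_blockLength_le hN hK hT hσ
  have hs1 : √(kappa W) ≤ 1 := Real.sqrt_le_one.mpr (kappa_le_one W)
  -- The sequence index is shifted by one against the number of steps; the surplus factor √κ ≤ 1 is
  -- dropped.
  have h3 : √(kappa W) ^ (blockLength W K T + 1) ≤ 1 / (((K : ℝ) * T) ^ 6 * √(14 * N)) := by
    rw [pow_succ]
    exact (mul_le_of_le_one_right (by positivity) hs1).trans h2
  have h14 : 3 ≤ √(14 : ℝ) := Real.le_sqrt_of_sq_le (by norm_num)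
  have hKr : (2 : ℝ) ≤ K := by exact_mod_cast hK
  have hTr : (1 : ℝ) ≤ T := by exact_mod_cast hT
  have hN0 : 0 < √(N : ℝ) := Real.sqrt_pos.mpr (by linarith)
  push_cast
  calc _ ≤ 1 / (((K : ℝ) * T) ^ 6 * √(14 * N)) *
        ((1 + 5 / 2 * (blockLength W K T + 1)) * (√N * X)) :=
        mul_le_mul_of_nonneg_right h3 (by positivity)
    _ = (1 + 5 / 2 * (blockLength W K T + 1)) / √14 * X / ((K : ℝ) * T) ^ 6 := by
        rw [Real.sqrt_mul (by norm_num)]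
        field_simp
    _ ≤ _ := by
        -- The √N of the norm bound has cancelled against √(14N). Since √14 ≥ 3 and B ≥ 1, (1 + 5/2
        -- (B + 1))/√14 ≤ 2B.
        refine div_le_div_of_nonneg_right (mul_le_mul_of_nonneg_right ?_ hX0) (by positivity)
        rw [div_le_iff₀ (by linarith)]
        nlinarith

end Gossip

/-! ### Sequential sampling -/

theorem dependsOn_update_eq {C A β : Type*} [DecidableEq C] {f : (C → A) → β} {S : Set C}
    (hf : DependsOn f S) {c : C} (hc : c ∉ S) (a : C → A) (x : A) : f (Function.update a c x) = f a :=
  hf fun c' hc' => Function.update_of_ne (fun h => hc (by rwa [← h])) x a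

section Staged

variable {C A : Type*} [DecidableEq C] [Fintype A]

/-- Sampling rule in stages: `w a c x` is the probability of drawing `x` at the coordinate `c`, and
may depend on the values of `a` at coordinates of earlier stages. -/
structure IsStaged (stage : C → ℕ) (w : (C → A) → C → A → ℝ) : Prop where
  dependsOn : ∀ c, DependsOn (fun a => w a c) {c' | stage c' < stage c}
  nonneg : ∀ a c x, 0 ≤ w a c x
  sum_eq_one : ∀ a c, ∑ x, w a c x = 1

variable {stage : C → ℕ} {w : (C → A) → C → A → ℝ}

theorem IsStaged.update_eq (hw : IsStaged stage w) {c c' : C} (h : stage c ≤ stage c')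
    (a : C → A) (x : A) : w (Function.update a c' x) c = w a c :=
  dependsOn_update_eq (hw.dependsOn c) (by simpa using h) a x

variable [Fintype C]

/-- Expectation when all coordinates are sampled from `w`. -/
def stagedExp (w : (C → A) → C → A → ℝ) (f : (C → A) → ℝ) : ℝ :=
  ∑ a, (∏ c, w a c (a c)) * f a

/-- Expectation when the coordinates in `S` are sampled from `w`, the others uniformly. -/
def partialExp (w : (C → A) → C → A → ℝ) (S : Finset C) (f : (C → A) → ℝ) : ℝ :=
  ∑ a, (∏ c ∈ S, w a c (a c)) * ((Fintype.card A : ℝ)⁻¹) ^ (#Sᶜ) * f a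

theorem partialExp_univ (w : (C → A) → C → A → ℝ) (f : (C → A) → ℝ) :
    partialExp w univ f = stagedExp w f := by
  simp [partialExp, stagedExp]

/-- Exchanging the value at `c` with the free value is an involution of the index set. -/
theorem sum_sum_update (c : C) (h : (C → A) → A → ℝ) :
    ∑ a, ∑ x, h a x = ∑ a, ∑ x, h (Function.update a c x) (a c) := by
  rw [← Fintype.sum_prod_type', ← Fintype.sum_prod_type']
  refine Fintype.sum_equiv
    (Function.Involutive.toPerm (fun p : (C → A) × A => (Function.update p.1 c p.2, p.1 c)) ?_)
    _ _ ?_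
  · rintro ⟨a, x⟩
    simp
  · rintro ⟨a, x⟩
    simp [Function.Involutive.toPerm]

/-- No rule of a coordinate in `S` looks at `c₀`, so its draw can be integrated first. The uniform
weight of the unused coordinate is exactly what the sum over its values removes. -/
theorem IsStaged.partialExp_insert [Nonempty A] (hw : IsStaged stage w) {S : Finset C} {c₀ : C}
    (hc₀ : c₀ ∉ S) (hS : ∀ c ∈ S, stage c ≤ stage c₀) (f : (C → A) → ℝ) :
    partialExp w (insert c₀ S) f
      = partialExp w S fun a => ∑ x, w a c₀ x * f (Function.update a c₀ x) := by
  have hcard : (Fintype.card A : ℝ) ≠ 0 := by positivity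
  have hprod : ∀ (a : C → A) (x : A), ∏ c ∈ S, w (Function.update a c₀ x) c
      (Function.update a c₀ x c) = ∏ c ∈ S, w a c (a c) := by
    intro a x
    refine Finset.prod_congr rfl fun c hc => ?_
    rw [hw.update_eq (hS c hc), Function.update_of_ne (fun h => hc₀ (by rwa [← h]))]
  unfold partialExp
  simp only [Finset.mul_sum]
  rw [sum_sum_update c₀]
  refine Finset.sum_congr rfl fun a _ => ?_
  simp only [hprod, hw.update_eq (le_refl (stage c₀)), Function.update_idem,
    Function.update_eq_self, Finset.sum_const, card_univ, nsmul_eq_mul]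
  rw [Finset.prod_insert hc₀]
  have : #Sᶜ = #(insert c₀ S)ᶜ + 1 := by
    rw [Finset.card_compl, Finset.card_compl, Finset.card_insert_of_notMem hc₀]
    have : #S < Fintype.card C := Finset.card_lt_univ_of_notMem hc₀
    omega
  rw [this, pow_succ]
  field_simp

/-- Coordinates are added to `S` in order of stage. Each new rule integrates to 1 against a function
that does not see it, so unseen later rules may be replaced by uniform sampling. -/
theorem IsStaged.partialExp_eq [Nonempty A] (hw : IsStaged stage w) :
    ∀ (S : Finset C), (∀ c ∈ S, ∀ c' ∉ S, stage c ≤ stage c') → ∀ f : (C → A) → ℝ,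
      DependsOn f (S : Set C) → partialExp w S f = stagedExp w f := by
  intro S
  induction h : #Sᶜ using Nat.strong_induction_on generalizing S with
  | _ m ih =>
    intro hS f hf
    by_cases hne : Sᶜ.Nonempty
    · obtain ⟨c₀, hc₀, hmin⟩ := Finset.exists_min_image Sᶜ stage hne
      have hc₀' : c₀ ∉ S := by simpa using hc₀
      have h1 := hw.partialExp_insert hc₀' (fun c hc => hS c hc c₀ hc₀') f
      have h2 : (fun a => ∑ x, w a c₀ x * f (Function.update a c₀ x)) = f := by
        funext a
        have : ∀ x, f (Function.update a c₀ x) = f a := fun x =>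
          dependsOn_update_eq hf (by simpa using hc₀') a x
        simp only [this, ← Finset.sum_mul, hw.sum_eq_one, one_mul]
      rw [h2] at h1
      rw [← h1]
      refine ih _ ?_ (insert c₀ S) rfl ?_ f ?_
      · rw [← h, Finset.card_compl, Finset.card_compl, Finset.card_insert_of_notMem hc₀']
        have : #S < Fintype.card C := Finset.card_lt_univ_of_notMem hc₀'
        omega
      · intro c hc c' hc'
        rw [Finset.mem_insert, not_or] at hc'
        rcases Finset.mem_insert.mp hc with rfl | hc
        · exact hmin c' (by simpa using hc'.2)
        · exact hS c hc c' hc'.2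
      · exact hf.mono (by simp)
    · have : S = univ := by
        rw [Finset.not_nonempty_iff_eq_empty, Finset.compl_eq_empty_iff] at hne
        exact hne
      rw [this, partialExp_univ]

/-- A function of the first `n` stages only sees the sampling rules of these stages. -/
theorem IsStaged.stagedExp_eq_partialExp [Nonempty A] (hw : IsStaged stage w) {n : ℕ}
    {f : (C → A) → ℝ} (hf : DependsOn f {c | stage c < n}) :
    stagedExp w f = partialExp w (univ.filter fun c => stage c < n) f := by
  refine (hw.partialExp_eq _ (fun c hc c' hc' => ?_) f (hf.mono ?_)).symm
  · simp only [mem_filter, mem_univ, true_and] at hc hc'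
    omega
  · intro c hc
    simpa using hc

theorem IsStaged.stagedExp_const [Nonempty A] (hw : IsStaged stage w) (r : ℝ) :
    stagedExp w (fun _ => r) = r := by
  rw [← hw.partialExp_eq ∅ (by simp) _ (fun _ _ _ => rfl)]
  simp [partialExp]

/-- Conditional expectation over one coordinate of the last stage that `f` sees: `c₀` may be drawn
last, after the other coordinates of its own stage, since rules within a stage ignore each other. -/
theorem IsStaged.stagedExp_resample [Nonempty A] (hw : IsStaged stage w) (c₀ : C)
    {f : (C → A) → ℝ} (hf : DependsOn f {c | stage c < stage c₀ + 1}) :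
    stagedExp w f = stagedExp w fun a => ∑ x, w a c₀ x * f (Function.update a c₀ x) := by
  set S := univ.filter fun c => stage c < stage c₀ + 1 with hSdef
  have hmem : ∀ c, c ∈ S ↔ stage c < stage c₀ + 1 := by simp [hSdef]
  have hc₀ : c₀ ∈ S := (hmem c₀).mpr (by omega)
  have hcoe : {c | stage c < stage c₀ + 1} = (S : Set C) := by
    ext c
    simp [hmem]
  have hS : ∀ c ∈ S, ∀ c' ∉ S, stage c ≤ stage c' := by
    intro c hc c' hc'
    rw [hmem] at hc hc'
    omega
  have hins : insert c₀ (S.erase c₀) = S := Finset.insert_erase hc₀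
  rw [hcoe] at hf
  have hupd : ∀ (a a' : C → A) x, (∀ c ∈ S.erase c₀, a c = a' c) →
      f (Function.update a c₀ x) = f (Function.update a' c₀ x) := by
    intro a a' x h
    refine hf fun c hc => ?_
    by_cases hcc : c = c₀
    · subst hcc
      simp
    · rw [Function.update_of_ne hcc, Function.update_of_ne hcc]
      exact h c (Finset.mem_erase.mpr ⟨hcc, hc⟩)
  rw [← hw.partialExp_eq S hS f hf, ← hins, hw.partialExp_insert (Finset.notMem_erase _ _)]
  · refine hw.partialExp_eq _ ?_ _ ?_
    · intro c hc c' hc'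
      rw [Finset.mem_erase] at hc
      have h1 := (hmem c).mp hc.2
      by_cases h2 : c' = c₀
      · rw [h2]
        omega
      · exact hS c hc.2 c' fun h => hc' (Finset.mem_erase.mpr ⟨h2, h⟩)
    · intro a a' h
      refine Finset.sum_congr rfl fun x _ => ?_
      rw [hupd a a' x h]
      congr 1
      have : w a c₀ = w a' c₀ := hw.dependsOn c₀ fun c hc => h c (by
        simp only [Set.mem_ofPred_eq] at hc
        simp only [coe_erase, Set.mem_sdiff, Finset.mem_coe, hmem, Set.mem_singleton_iff]
        refine ⟨by omega, fun h => ?_⟩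
        rw [h] at hc
        omega)
      rw [this]
  · intro c hc
    have := (hmem c).mp (Finset.mem_of_mem_erase hc)
    omega

/-- Tower property: condition on everything before the stage of `c`. -/
theorem IsStaged.stagedExp_apply [Nonempty A] (hw : IsStaged stage w) (c : C)
    {h : (C → A) → A → ℝ} (hh : DependsOn h {c' | stage c' < stage c}) :
    stagedExp w (fun a => h a (a c)) = stagedExp w fun a => ∑ x, w a c x * h a x := by
  rw [hw.stagedExp_resample c]
  · congr 1
    funext a
    refine Finset.sum_congr rfl fun x _ => ?_
    rw [dependsOn_update_eq hh (by simp), Function.update_self]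
  · intro a a' haa
    have h1 : h a = h a' := hh fun c' hc' => haa c' (by
      simp only [Set.mem_ofPred_eq] at hc' ⊢
      omega)
    have h2 : a c = a' c := haa c (by simp)
    simp only [h1, h2]

/-- Draws of the same stage are conditionally independent, so a centered one is orthogonal to any
function of another one and the past. -/
theorem IsStaged.stagedExp_mul_eq_zero [Nonempty A] (hw : IsStaged stage w) {c c' : C}
    (hne : c ≠ c') (hcc : stage c = stage c') {h h' : (C → A) → A → ℝ}
    (hh : DependsOn h {b | stage b < stage c}) (hh' : DependsOn h' {b | stage b < stage c})
    (hmean : ∀ a, ∑ x, w a c' x * h' a x = 0) :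
    stagedExp w (fun a => h a (a c) * h' a (a c')) = 0 := by
  rw [hw.stagedExp_resample c']
  · have : ∀ a, ∑ x, w a c' x * (h (Function.update a c' x) (Function.update a c' x c) *
        h' (Function.update a c' x) (Function.update a c' x c')) = 0 := by
      intro a
      have : ∀ x, w a c' x * (h (Function.update a c' x) (Function.update a c' x c) *
          h' (Function.update a c' x) (Function.update a c' x c'))
          = h a (a c) * (w a c' x * h' a x) := by
        intro x
        rw [dependsOn_update_eq hh (by simp [hcc]), dependsOn_update_eq hh' (by simp [hcc]),
          Function.update_self, Function.update_of_ne hne]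
        ring
      simp only [this, ← Finset.mul_sum, hmean, mul_zero]
    simp only [this]
    simp [stagedExp]
  · intro a a' haa
    have h1 : h a = h a' := hh fun b hb => haa b (by
      simp only [Set.mem_ofPred_eq] at hb ⊢
      omega)
    have h1' : h' a = h' a' := hh' fun b hb => haa b (by
      simp only [Set.mem_ofPred_eq] at hb ⊢
      omega)
    have h2 : a c = a' c := haa c (by simp [hcc])
    have h3 : a c' = a' c' := haa c' (by simp)
    simp only [h1, h1', h2, h3]

theorem stagedExp_sum {ι : Type*} (s : Finset ι) (f : ι → (C → A) → ℝ) :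
    stagedExp w (fun a => ∑ j ∈ s, f j a) = ∑ j ∈ s, stagedExp w (f j) := by
  simp only [stagedExp, Finset.mul_sum]
  exact Finset.sum_comm

theorem IsStaged.stagedExp_mono (hw : IsStaged stage w) {f g : (C → A) → ℝ}
    (h : ∀ a, f a ≤ g a) : stagedExp w f ≤ stagedExp w g :=
  Finset.sum_le_sum fun a _ => mul_le_mul_of_nonneg_left (h a)
    (Finset.prod_nonneg fun c _ => hw.nonneg a c _)

/-- Second moment of a weighted sum of centered observations of one stage. -/
theorem IsStaged.stagedExp_sq_sum [Nonempty A] (hw : IsStaged stage w) {τ : ℕ} {S : Finset C}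
    (hS : ∀ c ∈ S, stage c = τ) {F : (C → A) → ℝ} (hF : DependsOn F {c | stage c < τ})
    {ξ : C → (C → A) → A → ℝ} (hξ : ∀ c, DependsOn (ξ c) {c' | stage c' < τ})
    (hmean : ∀ c ∈ S, ∀ a, ∑ x, w a c x * ξ c a x = 0) :
    stagedExp w (fun a => F a * (∑ c ∈ S, ξ c a (a c)) ^ 2)
      = ∑ c ∈ S, stagedExp w fun a => F a * ∑ x, w a c x * ξ c a x ^ 2 := by
  have e : (fun a => F a * (∑ c ∈ S, ξ c a (a c)) ^ 2)
      = fun a => ∑ c ∈ S, ∑ c' ∈ S, (F a * ξ c a (a c)) * ξ c' a (a c') := by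
    funext a
    rw [sq, Finset.sum_mul_sum, Finset.mul_sum]
    refine Finset.sum_congr rfl fun c _ => ?_
    rw [Finset.mul_sum]
    exact Finset.sum_congr rfl fun c' _ => by ring
  rw [e, stagedExp_sum]
  refine Finset.sum_congr rfl fun c hc => ?_
  -- Only the diagonal of the expanded square survives.
  rw [stagedExp_sum, Finset.sum_eq_single c]
  · have hdep : DependsOn (fun a x => (F a * ξ c a x) * ξ c a x) {c' | stage c' < stage c} := by
      rw [hS c hc]
      intro a a' h
      funext x
      simp only [hF h, hξ c h]
    have := hw.stagedExp_apply c hdep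
    rw [this]
    congr 1
    funext a
    rw [Finset.mul_sum]
    exact Finset.sum_congr rfl fun x _ => by ring
  · intro c' hc' hne
    refine hw.stagedExp_mul_eq_zero (h := fun a x => F a * ξ c a x) (h' := ξ c') hne.symm
      ((hS c hc).trans (hS c' hc').symm) ?_ ?_ (hmean c' hc')
    · rw [hS c hc]
      intro a a' h
      funext x
      simp only [hF h, hξ c h]
    · rw [hS c hc]
      exact hξ c'
  · exact fun h => absurd hc h

end Staged

/-! ### The base learner -/

/-- The inverse of `η_s`, extended to `s = 0` by its value at `s = 1`. -/
def invEta (K B s : ℕ) : ℝ := max (B : ℝ) (B * √((max s 1 : ℕ) / Real.log K))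

/-- The inverse of `γ_s`, extended to `s = 0` by its value at `s = 1`. -/
def invGamma (N B s : ℕ) : ℝ := √((max s 1 : ℕ) * (B : ℝ) / N)

theorem log_natCast_pos {K : ℕ} (hK : 2 ≤ K) : 0 < Real.log K :=
  Real.log_pos (by exact_mod_cast hK)

/-- Inversion turns the minimum into a maximum. The index is kept at least 1 because at 0 division
by zero makes the learning rate vanish. -/
theorem one_div_eta {K B s : ℕ} (hK : 2 ≤ K) (hB : 0 < B) :
    1 / eta K B (max s 1) = invEta K B s := by
  have hBr : (0 : ℝ) < B := by exact_mod_cast hB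
  have e : 1 / √(Real.log K / ((max s 1 : ℕ) * (B : ℝ) ^ 2))
      = B * √((max s 1 : ℕ) / Real.log K) := by
    rw [mul_comm ((max s 1 : ℕ) : ℝ), ← div_div, div_right_comm, Real.sqrt_div' _ (by positivity),
      Real.sqrt_sq hBr.le, one_div_div, ← inv_div (Real.log (K : ℝ)), Real.sqrt_inv]
    rfl
  unfold eta invEta
  rw [← e]
  have hL0 : 0 < Real.log K := log_natCast_pos hK
  have h1 : 0 < 1 / (B : ℝ) := by positivity
  have hm : (0 : ℝ) < (max s 1 : ℕ) := by
    have : 0 < max s 1 := by omega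
    exact_mod_cast this
  have h2 : 0 < √(Real.log K / ((max s 1 : ℕ) * (B : ℝ) ^ 2)) := by positivity
  rcases le_total (1 / (B : ℝ)) (√(Real.log K / ((max s 1 : ℕ) * (B : ℝ) ^ 2))) with h | h
  · rw [min_eq_left h, one_div_one_div, max_eq_left]
    rw [div_le_iff₀ h2]
    rwa [div_le_iff₀ hBr, mul_comm] at h
  · rw [min_eq_right h, max_eq_right (a := (B : ℝ))]
    rw [le_div_iff₀ h2]
    rwa [le_div_iff₀ hBr, mul_comm] at h

theorem one_div_gammaRate {N B s : ℕ} :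
    1 / gammaRate N B (max s 1) = invGamma N B s := by
  unfold gammaRate invGamma
  rw [one_div, ← Real.sqrt_inv, inv_div]

theorem le_invEta (K B s : ℕ) : (B : ℝ) ≤ invEta K B s := le_max_left _ _

theorem invGamma_nonneg (N B s : ℕ) : 0 ≤ invGamma N B s := Real.sqrt_nonneg _

theorem invGamma_pos {N B : ℕ} (hN : 0 < N) (hB : 0 < B) (s : ℕ) : 0 < invGamma N B s := by
  have : 0 < max s 1 := by omega
  unfold invGamma
  positivity

/-- This makes all outputs, the initial one included, minimizers of one family of objectives. At
index 0 the feedback must vanish for this to be true. -/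
theorem ftrl_isMinOn (N : ℕ) {K B : ℕ} (hK : 2 ≤ K) (hB : 0 < B) (s : ℕ) {Z : Fin K → ℝ}
    (hZ : s = 0 → Z = 0) :
    ftrl N K B s Z ∈ stdSimplex ℝ (Fin K) ∧
      IsMinOn (hybridObj (invEta K B s) (invGamma N B s) Z) (stdSimplex ℝ (Fin K))
        (ftrl N K B s Z) := by
  have hK0 : 0 < K := by omega
  cases s with
  | zero =>
    rw [hZ rfl]
    exact ⟨uniform_mem_stdSimplex hK0, hybridObj_uniform_isMinOn hK0
      ((Nat.cast_nonneg B).trans (le_invEta _ _ _)) (invGamma_nonneg _ _ _)⟩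
  | succ s =>
    have h := Classical.epsilon_spec (ftrlObjective_minimizer N B (s + 1) hK0 Z)
    rw [← one_div_eta hK hB, ← one_div_gammaRate, show max (s + 1) 1 = s + 1 by omega,
      ← ftrlObjective_eq_hybridObj]
    exact h

theorem ftrl_mem_stdSimplex (N : ℕ) {K : ℕ} (B : ℕ) (hK : 0 < K) (s : ℕ) (Z : Fin K → ℝ) :
    ftrl N K B s Z ∈ stdSimplex ℝ (Fin K) := by
  cases s with
  | zero => exact uniform_mem_stdSimplex hK
  | succ s => exact (Classical.epsilon_spec (ftrlObjective_minimizer N B (s + 1) hK Z)).1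

/-- Since 1/η is never below B, the strong convexity, and hence the Lipschitz constant, is uniform
over time. -/
theorem ftrl_lipschitz (N : ℕ) {K B : ℕ} (hK : 2 ≤ K) (hB : 0 < B) (s : ℕ) {Z Z' : Fin K → ℝ}
    {ε : ℝ} (hε : ∀ k, |Z k - Z' k| ≤ ε) (k : Fin K) :
    |ftrl N K B s Z k - ftrl N K B s Z' k| ≤ 2 * K * ε / B := by
  have hBr : (0 : ℝ) < B := by exact_mod_cast hB
  have hε0 : 0 ≤ ε := (abs_nonneg _).trans (hε k)
  cases s with
  | zero =>
    simp only [ftrl, sub_self, abs_zero]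
    positivity
  | succ s =>
    have h1 := ftrl_isMinOn N hK hB (s + 1) (Z := Z) (by omega)
    have h2 := ftrl_isMinOn N hK hB (s + 1) (Z := Z') (by omega)
    refine (hybridObj_minimizer_lipschitz (hBr.trans_le (le_invEta _ _ _))
      (invGamma_nonneg _ _ _) h1.1 h2.1 h1.2 h2.2 hε k).trans ?_
    exact div_le_div_of_nonneg_left (by positivity) hBr (le_invEta _ _ _)

/-! ### Standing assumptions and elementary properties of the algorithm -/

/-- The assumptions on the network and the numbers of agents, arms and rounds. -/
structure Setting {N : ℕ} (G : SimpleGraph (Fin N)) (W : Matrix (Fin N) (Fin N) ℝ) (K T : ℕ) :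
    Prop where
  N_pos : 0 < N
  two_le_K : 2 ≤ K
  three_le_T : 3 ≤ T
  gossip : IsGossipMatrix G W
  sigma2_lt : sigma2 W < 1

section Algorithm

variable {T N K : ℕ} {G : SimpleGraph (Fin N)} {W : Matrix (Fin N) (Fin N) ℝ}

theorem Setting.B_pos (hs : Setting G W K T) : 0 < blockLength W K T :=
  blockLength_pos hs.N_pos hs.two_le_K (by linarith [hs.three_le_T]) hs.sigma2_lt

theorem Setting.K_pos (hs : Setting G W K T) : 0 < K := by linarith [hs.two_le_K]

theorem Setting.T_pos (hs : Setting G W K T) : 0 < T := by linarith [hs.three_le_T]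

theorem Setting.six_le (hs : Setting G W K T) : (6 : ℝ) ≤ K * T := by
  have h1 : (2 : ℝ) ≤ K := by exact_mod_cast hs.two_le_K
  have h2 : (3 : ℝ) ≤ T := by exact_mod_cast hs.three_le_T
  nlinarith

theorem mixUniform_ge (hT : 0 < T) {q : Fin K → ℝ} (hq : q ∈ stdSimplex ℝ (Fin K)) (k : Fin K) :
    1 / ((K : ℝ) * T) ≤ mixUniform T q k := by
  have hT' : (1 : ℝ) ≤ T := by exact_mod_cast hT
  have h1 : 0 ≤ (1 - 1 / (T : ℝ)) * q k :=
    mul_nonneg (by rw [sub_nonneg, div_le_one (by linarith)]; exact hT') (hq.1 k)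
  unfold mixUniform
  rw [div_div, mul_comm (T : ℝ)]
  linarith

theorem mixUniform_ge_mul (T : ℕ) (q : Fin K → ℝ) (k : Fin K) :
    (1 - 1 / (T : ℝ)) * q k ≤ mixUniform T q k := by
  unfold mixUniform
  have : 0 ≤ 1 / (T : ℝ) / K := by positivity
  linarith

theorem mixUniform_sum (hK : 0 < K) {q : Fin K → ℝ} (hq : q ∈ stdSimplex ℝ (Fin K)) :
    ∑ k, mixUniform T q k = 1 := by
  have : (K : ℝ) ≠ 0 := by positivity
  simp only [mixUniform, Finset.sum_add_distrib, ← Finset.mul_sum, hq.2, Finset.sum_const,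
    card_univ, Fintype.card_fin, nsmul_eq_mul]
  field_simp
  ring

theorem policy_ge (hs : Setting G W K T) (ℓ : Losses T N K) (a : Actions T N K) (τ : ℕ) (i : Fin N)
    (k : Fin K) : 1 / ((K : ℝ) * T) ≤ policy G W ℓ a τ i k :=
  mixUniform_ge hs.T_pos (ftrl_mem_stdSimplex _ _ hs.K_pos _ _) k

theorem policy_pos (hs : Setting G W K T) (ℓ : Losses T N K) (a : Actions T N K) (τ : ℕ)
    (i : Fin N) (k : Fin K) : 0 < policy G W ℓ a τ i k := by
  have h1 := policy_ge hs ℓ a τ i k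
  have h2 := hs.six_le
  have : 0 < 1 / ((K : ℝ) * T) := by positivity
  linarith

theorem policy_sum (hs : Setting G W K T) (ℓ : Losses T N K) (a : Actions T N K) (τ : ℕ)
    (i : Fin N) : ∑ k, policy G W ℓ a τ i k = 1 :=
  mixUniform_sum hs.K_pos (ftrl_mem_stdSimplex _ _ hs.K_pos _ _)

theorem blockEstimate_congr {B τ : ℕ} {p : Fin N → Fin K → ℝ} {ℓ ℓ' : Losses T N K}
    {a a' : Actions T N K} (hℓ : ∀ t : Fin T, (t : ℕ) / B = τ → ℓ t = ℓ' t)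
    (ha : ∀ t : Fin T, (t : ℕ) / B = τ → a t = a' t) :
    blockEstimate B τ p ℓ a = blockEstimate B τ p ℓ' a' := by
  funext i k
  unfold blockEstimate
  refine Finset.sum_congr rfl fun t ht => ?_
  have := (Finset.mem_filter.mp ht).2
  rw [hℓ t this, ha t this]

/-- The accumulated feedback depends on the past only. -/
theorem feedbackSum_congr {ℓ ℓ' : Losses T N K} {a a' : Actions T N K} :
    ∀ τ : ℕ, (∀ t : Fin T, (t : ℕ) / blockLength W K T < τ → ℓ t = ℓ' t) →
      (∀ t : Fin T, (t : ℕ) / blockLength W K T < τ → a t = a' t) →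
      feedbackSum G W ℓ a τ = feedbackSum G W ℓ' a' τ
  | 0, _, _ => by funext i k; simp only [feedbackSum]
  | 1, _, _ => by funext i k; simp only [feedbackSum]
  | τ + 2, hℓ, ha => by
    have ih := feedbackSum_congr τ (fun t ht => hℓ t (by omega)) (fun t ht => ha t (by omega))
    funext i k
    simp only [feedbackSum]
    rw [ih, blockEstimate_congr (a := a) (ℓ := ℓ) (fun t ht => hℓ t (by omega))
      (fun t ht => ha t (by omega))]

theorem policy_congr {ℓ ℓ' : Losses T N K} {a a' : Actions T N K} {τ : ℕ}
    (hℓ : ∀ t : Fin T, (t : ℕ) / blockLength W K T < τ → ℓ t = ℓ' t)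
    (ha : ∀ t : Fin T, (t : ℕ) / blockLength W K T < τ → a t = a' t) :
    policy G W ℓ a τ = policy G W ℓ' a' τ := by
  funext i
  unfold policy
  rw [feedbackSum_congr τ hℓ ha]

/-! ### The centralized reference process -/

/-- Network average of the loss estimates of block `τ`. -/
def refEst (G : SimpleGraph (Fin N)) (W : Matrix (Fin N) (Fin N) ℝ) (ℓ : Losses T N K)
    (a : Actions T N K) (τ : ℕ) (k : Fin K) : ℝ :=
  1 / (N : ℝ) * ∑ j, blockEstimate (blockLength W K T) τ (policy G W ℓ a τ) ℓ a j k

/-- The accumulated feedback if the gossip were exact. -/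
def refSum (G : SimpleGraph (Fin N)) (W : Matrix (Fin N) (Fin N) ℝ) (ℓ : Losses T N K)
    (a : Actions T N K) : ℕ → Fin K → ℝ
  | 0 => fun _ => 0
  | 1 => fun _ => 0
  | τ + 2 => fun k => refSum G W ℓ a τ k + refEst G W ℓ a τ k

/-- The output of the base learner if the gossip were exact. -/
def refDist (G : SimpleGraph (Fin N)) (W : Matrix (Fin N) (Fin N) ℝ) (ℓ : Losses T N K)
    (a : Actions T N K) (τ : ℕ) : Fin K → ℝ :=
  ftrl N K (blockLength W K T) (τ / 2) (refSum G W ℓ a τ)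

theorem refSum_congr {ℓ ℓ' : Losses T N K} {a a' : Actions T N K} :
    ∀ τ : ℕ, (∀ t : Fin T, (t : ℕ) / blockLength W K T < τ → ℓ t = ℓ' t) →
      (∀ t : Fin T, (t : ℕ) / blockLength W K T < τ → a t = a' t) →
      refSum G W ℓ a τ = refSum G W ℓ' a' τ
  | 0, _, _ => by funext k; simp only [refSum]
  | 1, _, _ => by funext k; simp only [refSum]
  | τ + 2, hℓ, ha => by
    have ih := refSum_congr τ (fun t ht => hℓ t (by omega)) (fun t ht => ha t (by omega))
    funext k
    simp only [refSum, refEst]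
    rw [ih, blockEstimate_congr (a := a) (ℓ := ℓ) (fun t ht => hℓ t (by omega))
      (fun t ht => ha t (by omega)), policy_congr (a := a) (ℓ := ℓ) (fun t ht => hℓ t (by omega))
      (fun t ht => ha t (by omega))]

theorem refDist_congr {ℓ ℓ' : Losses T N K} {a a' : Actions T N K} {τ : ℕ}
    (hℓ : ∀ t : Fin T, (t : ℕ) / blockLength W K T < τ → ℓ t = ℓ' t)
    (ha : ∀ t : Fin T, (t : ℕ) / blockLength W K T < τ → a t = a' t) :
    refDist G W ℓ a τ = refDist G W ℓ' a' τ := by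
  unfold refDist
  rw [refSum_congr τ hℓ ha]

theorem refDist_mem (hs : Setting G W K T) (ℓ : Losses T N K) (a : Actions T N K) (τ : ℕ) :
    refDist G W ℓ a τ ∈ stdSimplex ℝ (Fin K) := ftrl_mem_stdSimplex _ _ hs.K_pos _ _

theorem card_block_le {B : ℕ} (hB : 0 < B) (τ : ℕ) :
    #(univ.filter fun t : Fin T => (t : ℕ) / B = τ) ≤ B := by
  have : #(univ.filter fun t : Fin T => (t : ℕ) / B = τ) ≤ #(Finset.Ico (τ * B) (τ * B + B)) := by
    refine Finset.card_le_card_of_injOn (fun t : Fin T => (t : ℕ)) (fun t ht => ?_)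
      (fun t _ t' _ h => Fin.ext h)
    have h := (Finset.mem_filter.mp ht).2
    rw [Nat.div_eq_iff hB] at h
    simp only [coe_Ico, Set.mem_Ico]
    omega
  simpa using this

/-- The lower bound `P` is left free: it will be the exploration floor 1/(KT), the probability
itself, or 1/6 for an arm that dominates. -/
theorem blockEstimate_mem_Icc (hs : Setting G W K T) {ℓ : Losses T N K}
    (hℓ : ∀ t i k, ℓ t i k ∈ Set.Icc (0 : ℝ) 1) {τ : ℕ} {p : Fin N → Fin K → ℝ}
    (a : Actions T N K) (i : Fin N) (k : Fin K) {P : ℝ} (hP : 0 < P) (hp : P ≤ p i k) :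
    blockEstimate (blockLength W K T) τ p ℓ a i k ∈ Set.Icc (0 : ℝ) (blockLength W K T * (1 / P)) := by
  unfold blockEstimate
  have hppos : 0 < p i k := hP.trans_le hp
  constructor
  · refine Finset.sum_nonneg fun t _ => ?_
    split_ifs
    · exact div_nonneg (hℓ t i k).1 hppos.le
    · exact le_rfl
  · refine (Finset.sum_le_card_nsmul _ _ (1 / P) fun t _ => ?_).trans ?_
    · split_ifs
      · exact div_le_div₀ zero_le_one (hℓ t i k).2 hP hp
      · positivity
    · rw [nsmul_eq_mul]
      refine mul_le_mul_of_nonneg_right ?_ (by positivity)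
      exact_mod_cast card_block_le hs.B_pos τ

/-- Exploration bounds a block estimate by B·KT, so each gossip delivery adds an error of at most
2B²/(KT)^5, and there is one delivery for every two blocks. Both sums use estimates sampled from the
same actual policies, so errors only add up. -/
theorem feedbackSum_sub_refSum_le (hs : Setting G W K T) {ℓ : Losses T N K}
    (hℓ : ∀ t i k, ℓ t i k ∈ Set.Icc (0 : ℝ) 1) (a : Actions T N K) (i : Fin N) (k : Fin K) :
    ∀ τ : ℕ, |feedbackSum G W ℓ a τ i k - refSum G W ℓ a τ k| ≤
      τ * ((blockLength W K T : ℝ) ^ 2 / ((K : ℝ) * T) ^ 5)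
  | 0 => by simp [feedbackSum, refSum]
  | 1 => by
    simp only [feedbackSum, refSum, sub_self, abs_zero]
    positivity
  | τ + 2 => by
    have ih := feedbackSum_sub_refSum_le hs hℓ a i k τ
    have h6 := hs.six_le
    have hx : ∀ j, |blockEstimate (blockLength W K T) τ (policy G W ℓ a τ) ℓ a j k| ≤
        blockLength W K T * (1 / (1 / ((K : ℝ) * T))) := by
      intro j
      have := blockEstimate_mem_Icc hs hℓ (τ := τ) a j k (P := 1 / ((K : ℝ) * T)) (by positivity)
        (policy_ge hs ℓ a τ j k)
      rw [abs_of_nonneg this.1]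
      exact this.2
    have h1 := hs.gossip.gossip_error hs.N_pos hs.two_le_K (by linarith [hs.three_le_T])
      hs.sigma2_lt _ k hx i
    have e : feedbackSum G W ℓ a (τ + 2) i k - refSum G W ℓ a (τ + 2) k
        = (feedbackSum G W ℓ a τ i k - refSum G W ℓ a τ k)
          + (gossip G W (blockLength W K T) (blockEstimate (blockLength W K T) τ
              (policy G W ℓ a τ) ℓ a) i k
            - 1 / (N : ℝ) * ∑ j, blockEstimate (blockLength W K T) τ (policy G W ℓ a τ) ℓ a j k) := by
      simp only [feedbackSum, refSum, refEst]
      have : (fun j => mixUniform T (ftrl N K (blockLength W K T) (τ / 2)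
          (feedbackSum G W ℓ a τ j))) = policy G W ℓ a τ := rfl
      rw [this]
      ring
    have e2 : 2 * (blockLength W K T : ℝ) * (blockLength W K T * (1 / (1 / ((K : ℝ) * T))))
        / ((K : ℝ) * T) ^ 6 = 2 * ((blockLength W K T : ℝ) ^ 2 / ((K : ℝ) * T) ^ 5) := by
      field_simp
    rw [e]
    rw [e2] at h1
    refine (abs_add_le _ _).trans ?_
    push_cast
    linarith

/-- The policy of the reference process. -/
def refPolicy (G : SimpleGraph (Fin N)) (W : Matrix (Fin N) (Fin N) ℝ) (ℓ : Losses T N K)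
    (a : Actions T N K) (τ : ℕ) : Fin K → ℝ := mixUniform T (refDist G W ℓ a τ)

/-- Lipschitz continuity with constant 2K/B turns the feedback error into 2KτB/(KT)^5, and τB ≤ T.
-/
theorem policy_sub_refPolicy_le (hs : Setting G W K T) {ℓ : Losses T N K}
    (hℓ : ∀ t i k, ℓ t i k ∈ Set.Icc (0 : ℝ) 1) (a : Actions T N K) {τ : ℕ}
    (hτ : τ * blockLength W K T ≤ T) (i : Fin N) (k : Fin K) :
    |policy G W ℓ a τ i k - refPolicy G W ℓ a τ k| ≤ 2 / ((K : ℝ) * T) ^ 4 := by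
  have h6 := hs.six_le
  have hB : (0 : ℝ) < blockLength W K T := by exact_mod_cast hs.B_pos
  have hT : (1 : ℝ) ≤ T := by exact_mod_cast hs.T_pos
  have h1 := ftrl_lipschitz N hs.two_le_K hs.B_pos (τ / 2)
    (fun k => feedbackSum_sub_refSum_le hs hℓ a i k τ) k
  have e : policy G W ℓ a τ i k - refPolicy G W ℓ a τ k
      = (1 - 1 / (T : ℝ)) * (ftrl N K (blockLength W K T) (τ / 2) (feedbackSum G W ℓ a τ i) k
          - ftrl N K (blockLength W K T) (τ / 2) (refSum G W ℓ a τ) k) := by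
    simp only [policy, refPolicy, refDist, mixUniform]
    ring
  rw [e, abs_mul]
  have h2 : |1 - 1 / (T : ℝ)| ≤ 1 := by
    have : 0 ≤ 1 / (T : ℝ) := by positivity
    have : 1 / (T : ℝ) ≤ 1 := by rw [div_le_one (by linarith)]; exact hT
    rw [abs_of_nonneg (by linarith)]
    linarith
  refine (mul_le_of_le_one_left (abs_nonneg _) h2).trans (h1.trans ?_)
  have hτ' : (τ : ℝ) * blockLength W K T ≤ T := by exact_mod_cast hτ
  have e2 : 2 * (K : ℝ) * (τ * ((blockLength W K T : ℝ) ^ 2 / ((K : ℝ) * T) ^ 5))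
      / blockLength W K T = 2 * K * (τ * blockLength W K T) / ((K : ℝ) * T) ^ 5 := by
    field_simp
  have hK : (0 : ℝ) < K := by exact_mod_cast hs.K_pos
  have hT0 : (0 : ℝ) < T := by linarith
  have e3 : 2 / ((K : ℝ) * T) ^ 4 = 2 * K * T / ((K : ℝ) * T) ^ 5 := by field_simp
  rw [e2, e3]
  gcongr

theorem refPolicy_ge (hs : Setting G W K T) (ℓ : Losses T N K) (a : Actions T N K) (τ : ℕ)
    (k : Fin K) : 1 / ((K : ℝ) * T) ≤ refPolicy G W ℓ a τ k :=
  mixUniform_ge hs.T_pos (refDist_mem hs ℓ a τ) k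

/-- The mixture keeps the fraction 1 - 1/T ≥ 2/3 of the learner's output, as T ≥ 3. -/
theorem refDist_le_refPolicy (hs : Setting G W K T) (ℓ : Losses T N K) (a : Actions T N K) (τ : ℕ)
    (k : Fin K) : refDist G W ℓ a τ k ≤ 3 / 2 * refPolicy G W ℓ a τ k := by
  have h1 := mixUniform_ge_mul T (refDist G W ℓ a τ) k
  have hT : (3 : ℝ) ≤ T := by exact_mod_cast hs.three_le_T
  have h2 : 1 / (T : ℝ) ≤ 1 / 3 := one_div_le_one_div_of_le (by norm_num) hT
  have h3 := (refDist_mem hs ℓ a τ).1 k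
  unfold refPolicy
  nlinarith

/-- The additive error is below half the exploration floor, hence below half of the reference
probability. This lets the variance be written in terms of the reference process. -/
theorem refPolicy_le_policy (hs : Setting G W K T) {ℓ : Losses T N K}
    (hℓ : ∀ t i k, ℓ t i k ∈ Set.Icc (0 : ℝ) 1) (a : Actions T N K) {τ : ℕ}
    (hτ : τ * blockLength W K T ≤ T) (i : Fin N) (k : Fin K) :
    refPolicy G W ℓ a τ k ≤ 2 * policy G W ℓ a τ i k := by
  have h1 := policy_sub_refPolicy_le hs hℓ a hτ i k
  have h2 := refPolicy_ge hs ℓ a τ k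
  have h6 := hs.six_le
  have h3 : 2 / ((K : ℝ) * T) ^ 4 ≤ 1 / 2 * (1 / ((K : ℝ) * T)) := by
    rw [show 1 / 2 * (1 / ((K : ℝ) * T)) = 1 / (2 * (K * T)) by field_simp,
      div_le_div_iff₀ (by positivity) (by positivity)]
    nlinarith [pow_le_pow_left₀ (by norm_num : (0 : ℝ) ≤ 6) h6 3,
      pow_succ ((K : ℝ) * T) 3]
  have := (abs_le.mp h1).1
  linarith

/-- One 1/T pays for the gossip error, the other two for mixing with the uniform distribution. -/
theorem sum_abs_policy_sub_refDist_le (hs : Setting G W K T) {ℓ : Losses T N K}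
    (hℓ : ∀ t i k, ℓ t i k ∈ Set.Icc (0 : ℝ) 1) (a : Actions T N K) {τ : ℕ}
    (hτ : τ * blockLength W K T ≤ T) (i : Fin N) :
    ∑ k, |policy G W ℓ a τ i k - refDist G W ℓ a τ k| ≤ 3 / T := by
  have h6 := hs.six_le
  have hT : (0 : ℝ) < T := by exact_mod_cast hs.T_pos
  have hK : (0 : ℝ) < K := by exact_mod_cast hs.K_pos
  have hq := refDist_mem hs ℓ a τ
  have h1 : ∀ k, |policy G W ℓ a τ i k - refDist G W ℓ a τ k| ≤
      2 / ((K : ℝ) * T) ^ 4 + (1 / T * refDist G W ℓ a τ k + 1 / T / K) := by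
    intro k
    have h2 := policy_sub_refPolicy_le hs hℓ a hτ i k
    have h3 : |refPolicy G W ℓ a τ k - refDist G W ℓ a τ k| ≤
        1 / T * refDist G W ℓ a τ k + 1 / T / K := by
      have := hq.1 k
      have h5 : 0 ≤ 1 / (T : ℝ) * refDist G W ℓ a τ k := by positivity
      have h6 : 0 ≤ 1 / (T : ℝ) / K := by positivity
      simp only [refPolicy, mixUniform]
      rw [abs_le]
      constructor <;> linarith
    exact (abs_sub_le _ (refPolicy G W ℓ a τ k) _).trans (add_le_add h2 h3)
  refine (Finset.sum_le_sum fun k _ => h1 k).trans ?_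
  simp only [Finset.sum_add_distrib, ← Finset.mul_sum, hq.2, Finset.sum_const, card_univ,
    Fintype.card_fin, nsmul_eq_mul]
  have e : (K : ℝ) * (1 / T / K) = 1 / T := by field_simp
  have h3 : (K : ℝ) * (2 / ((K : ℝ) * T) ^ 4) ≤ 1 / T := by
    rw [show (K : ℝ) * (2 / ((K : ℝ) * T) ^ 4) = 2 / (K * T) ^ 3 * (1 / T) by field_simp]
    refine mul_le_of_le_one_left (by positivity) ?_
    rw [div_le_one (by positivity)]
    nlinarith [pow_le_pow_left₀ (by norm_num : (0 : ℝ) ≤ 6) h6 3]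
  rw [e]
  have : 3 / (T : ℝ) = 1 / T + (1 / T * 1 + 1 / T) := by ring
  linarith

end Algorithm

/-! ### Expectations over the actions -/

section Expectation

variable {T N K : ℕ} {G : SimpleGraph (Fin N)} {W : Matrix (Fin N) (Fin N) ℝ}

/-- Expectation over the internal randomization of the agents, for fixed losses. -/
def actionExp (G : SimpleGraph (Fin N)) (W : Matrix (Fin N) (Fin N) ℝ) (ℓ : Losses T N K)
    (f : Actions T N K → ℝ) : ℝ := ∑ a, actionProb G W ℓ a * f a

/-- The sampling rule of the agents as a staged sampling rule over pairs of a round and an agent. -/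
def sampler (G : SimpleGraph (Fin N)) (W : Matrix (Fin N) (Fin N) ℝ) (ℓ : Losses T N K)
    (b : Fin T × Fin N → Fin K) (c : Fin T × Fin N) : Fin K → ℝ :=
  policy G W ℓ (Function.curry b) ((c.1 : ℕ) / blockLength W K T) c.2

theorem actionExp_eq_stagedExp (ℓ : Losses T N K) (f : Actions T N K → ℝ) :
    actionExp G W ℓ f = stagedExp (sampler G W ℓ) fun b => f (Function.curry b) := by
  unfold actionExp stagedExp
  refine (Fintype.sum_equiv (Equiv.curry (Fin T) (Fin N) (Fin K)) _ _ fun b => ?_).symm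
  rw [Fintype.prod_prod_type]
  rfl

/-- The stage of a round is its block: within a block the sampling distributions are frozen, so all
its draws are independent given earlier blocks. -/
theorem sampler_isStaged (hs : Setting G W K T) (ℓ : Losses T N K) :
    IsStaged (fun c : Fin T × Fin N => (c.1 : ℕ) / blockLength W K T) (sampler G W ℓ) where
  dependsOn c b b' h := by
    unfold sampler
    have : policy G W ℓ (Function.curry b) ((c.1 : ℕ) / blockLength W K T)
        = policy G W ℓ (Function.curry b') ((c.1 : ℕ) / blockLength W K T) :=
      policy_congr (fun _ _ => rfl) fun t ht => funext fun i => h (t, i) ht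
    simp only [this]
  nonneg b c x := (policy_pos hs ℓ _ _ _ _).le
  sum_eq_one b c := policy_sum hs ℓ _ _ _

theorem actionExp_add (ℓ : Losses T N K) (f g : Actions T N K → ℝ) :
    actionExp G W ℓ (fun a => f a + g a) = actionExp G W ℓ f + actionExp G W ℓ g := by
  simp only [actionExp, mul_add, Finset.sum_add_distrib]

theorem actionExp_const_mul (ℓ : Losses T N K) (r : ℝ) (f : Actions T N K → ℝ) :
    actionExp G W ℓ (fun a => r * f a) = r * actionExp G W ℓ f := by
  simp only [actionExp, Finset.mul_sum]
  exact Finset.sum_congr rfl fun a _ => by ring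

theorem actionExp_mul_const (ℓ : Losses T N K) (r : ℝ) (f : Actions T N K → ℝ) :
    actionExp G W ℓ (fun a => f a * r) = actionExp G W ℓ f * r := by
  simp only [actionExp, Finset.sum_mul]
  exact Finset.sum_congr rfl fun a _ => by ring

theorem actionExp_sub (ℓ : Losses T N K) (f g : Actions T N K → ℝ) :
    actionExp G W ℓ (fun a => f a - g a) = actionExp G W ℓ f - actionExp G W ℓ g := by
  simp only [actionExp, mul_sub, Finset.sum_sub_distrib]

theorem actionExp_sum {ι : Type*} (ℓ : Losses T N K) (s : Finset ι) (f : ι → Actions T N K → ℝ) :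
    actionExp G W ℓ (fun a => ∑ j ∈ s, f j a) = ∑ j ∈ s, actionExp G W ℓ (f j) := by
  simp only [actionExp, Finset.mul_sum]
  exact Finset.sum_comm

theorem actionProb_nonneg (hs : Setting G W K T) (ℓ : Losses T N K) (a : Actions T N K) :
    0 ≤ actionProb G W ℓ a :=
  Finset.prod_nonneg fun _ _ => Finset.prod_nonneg fun _ _ => (policy_pos hs ℓ _ _ _ _).le

theorem actionExp_mono (hs : Setting G W K T) (ℓ : Losses T N K) {f g : Actions T N K → ℝ}
    (h : ∀ a, f a ≤ g a) : actionExp G W ℓ f ≤ actionExp G W ℓ g :=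
  Finset.sum_le_sum fun a _ => mul_le_mul_of_nonneg_left (h a) (actionProb_nonneg hs ℓ a)

theorem actionExp_const (hs : Setting G W K T) (ℓ : Losses T N K) (r : ℝ) :
    actionExp G W ℓ (fun _ => r) = r := by
  have : Nonempty (Fin K) := ⟨⟨0, hs.K_pos⟩⟩
  rw [actionExp_eq_stagedExp]
  exact (sampler_isStaged hs ℓ).stagedExp_const r

/-- A function of the actions that only depends on the blocks before `τ`. -/
def IsPast (W : Matrix (Fin N) (Fin N) ℝ) {β : Type*} (τ : ℕ) (f : Actions T N K → β) : Prop :=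
  ∀ a a' : Actions T N K, (∀ t : Fin T, (t : ℕ) / blockLength W K T < τ → a t = a' t) → f a = f a'

theorem IsPast.dependsOn {β : Type*} {τ : ℕ} {f : Actions T N K → β} (hf : IsPast W τ f) :
    DependsOn (fun b : Fin T × Fin N → Fin K => f (Function.curry b))
      {c | (c.1 : ℕ) / blockLength W K T < τ} :=
  fun _ _ h => hf _ _ fun t ht => funext fun i => h (t, i) ht

theorem isPast_refDist (ℓ : Losses T N K) (τ : ℕ) :
    IsPast W τ fun a => refDist G W ℓ a τ :=
  fun _ _ h => refDist_congr (fun _ _ => rfl) h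

/-- The total network average loss of arm `k` in block `τ`. -/
def blockLoss (W : Matrix (Fin N) (Fin N) ℝ) (ℓ : Losses T N K) (τ : ℕ) (k : Fin K) : ℝ :=
  ∑ t ∈ univ.filter (fun t : Fin T => (t : ℕ) / blockLength W K T = τ), avgLoss ℓ t k

theorem avgLoss_mem_Icc (hN : 0 < N) {ℓ : Losses T N K}
    (hℓ : ∀ t i k, ℓ t i k ∈ Set.Icc (0 : ℝ) 1) (t : Fin T) (k : Fin K) :
    avgLoss ℓ t k ∈ Set.Icc (0 : ℝ) 1 := by
  have hNr : (0 : ℝ) < N := by exact_mod_cast hN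
  unfold avgLoss
  constructor
  · exact mul_nonneg (by positivity) (Finset.sum_nonneg fun i _ => (hℓ t i k).1)
  · have : ∑ i, ℓ t i k ≤ ∑ _i : Fin N, (1 : ℝ) := Finset.sum_le_sum fun i _ => (hℓ t i k).2
    simp only [Finset.sum_const, card_univ, Fintype.card_fin, nsmul_eq_mul, mul_one] at this
    rw [one_div_mul_eq_div, div_le_one hNr]
    exact this

theorem blockLoss_mem_Icc (hs : Setting G W K T) {ℓ : Losses T N K}
    (hℓ : ∀ t i k, ℓ t i k ∈ Set.Icc (0 : ℝ) 1) (τ : ℕ) (k : Fin K) :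
    blockLoss W ℓ τ k ∈ Set.Icc (0 : ℝ) (blockLength W K T) := by
  unfold blockLoss
  constructor
  · exact Finset.sum_nonneg fun t _ => (avgLoss_mem_Icc hs.N_pos hℓ t k).1
  · refine (Finset.sum_le_card_nsmul _ _ 1
      fun t _ => (avgLoss_mem_Icc hs.N_pos hℓ t k).2).trans ?_
    rw [nsmul_eq_mul, mul_one]
    exact_mod_cast card_block_le hs.B_pos τ

/-- The centered contribution of the observation at `c` to the average loss estimate of arm `k`. -/
def obsNoise (G : SimpleGraph (Fin N)) (W : Matrix (Fin N) (Fin N) ℝ) (ℓ : Losses T N K) (τ : ℕ)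
    (k : Fin K) (c : Fin T × Fin N) (b : Fin T × Fin N → Fin K) (x : Fin K) : ℝ :=
  1 / (N : ℝ) * ((if x = k then ℓ c.1 c.2 k / policy G W ℓ (Function.curry b) τ c.2 k else 0)
    - ℓ c.1 c.2 k)

theorem obsNoise_dependsOn (ℓ : Losses T N K) (τ : ℕ) (k : Fin K) (c : Fin T × Fin N) :
    DependsOn (obsNoise G W ℓ τ k c) {c | (c.1 : ℕ) / blockLength W K T < τ} := by
  intro b b' h
  funext x
  have : policy G W ℓ (Function.curry b) τ = policy G W ℓ (Function.curry b') τ :=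
    policy_congr (fun _ _ => rfl) fun t ht => funext fun i => h (t, i) ht
  simp only [obsNoise, this]

theorem refEst_sub_blockLoss (ℓ : Losses T N K) (τ : ℕ) (k : Fin K)
    (b : Fin T × Fin N → Fin K) :
    refEst G W ℓ (Function.curry b) τ k - blockLoss W ℓ τ k
      = ∑ c ∈ (univ.filter fun t : Fin T => (t : ℕ) / blockLength W K T = τ) ×ˢ univ,
          obsNoise G W ℓ τ k c b (b c) := by
  simp only [refEst, blockLoss, blockEstimate, avgLoss, obsNoise, Finset.sum_product,
    ← Finset.mul_sum, Finset.sum_sub_distrib, mul_sub]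
  rw [Finset.sum_comm]
  rfl

theorem obsNoise_mean (hs : Setting G W K T) (ℓ : Losses T N K) {τ : ℕ} (k : Fin K)
    {c : Fin T × Fin N} (hc : (c.1 : ℕ) / blockLength W K T = τ) (b : Fin T × Fin N → Fin K) :
    ∑ x, sampler G W ℓ b c x * obsNoise G W ℓ τ k c b x = 0 := by
  have hp := (policy_pos hs ℓ (Function.curry b) τ c.2 k).ne'
  have hsum := policy_sum hs ℓ (Function.curry b) τ c.2
  simp only [sampler, hc, obsNoise]
  have e : ∀ x, policy G W ℓ (Function.curry b) τ c.2 x * (1 / (N : ℝ) *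
      ((if x = k then ℓ c.1 c.2 k / policy G W ℓ (Function.curry b) τ c.2 k else 0)
        - ℓ c.1 c.2 k))
      = 1 / (N : ℝ) * ((if x = k then ℓ c.1 c.2 k else 0)
        - policy G W ℓ (Function.curry b) τ c.2 x * ℓ c.1 c.2 k) := by
    intro x
    split_ifs with h
    · subst h
      field_simp
    · ring
  simp only [e, ← Finset.mul_sum, Finset.sum_sub_distrib, ← Finset.sum_mul, hsum]
  simp

/-- Importance weighting: a squared weight 1/p² occurs with probability p. -/
theorem obsNoise_second_moment (hs : Setting G W K T) {ℓ : Losses T N K}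
    (hℓ : ∀ t i k, ℓ t i k ∈ Set.Icc (0 : ℝ) 1) {τ : ℕ} (k : Fin K)
    {c : Fin T × Fin N} (hc : (c.1 : ℕ) / blockLength W K T = τ) (b : Fin T × Fin N → Fin K) :
    ∑ x, sampler G W ℓ b c x * obsNoise G W ℓ τ k c b x ^ 2 ≤
      (1 / (N : ℝ)) ^ 2 * (1 / policy G W ℓ (Function.curry b) τ c.2 k) := by
  have hp := policy_pos hs ℓ (Function.curry b) τ c.2 k
  have hsum := policy_sum hs ℓ (Function.curry b) τ c.2
  simp only [sampler, hc, obsNoise]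
  set l := ℓ c.1 c.2 k with hl
  have hl' : l ∈ Set.Icc (0 : ℝ) 1 := hℓ _ _ _
  set p := policy G W ℓ (Function.curry b) τ c.2 with hpdef
  have e : ∀ x, p x * (1 / (N : ℝ) * ((if x = k then l / p k else 0) - l)) ^ 2
      = (1 / (N : ℝ)) ^ 2 * ((if x = k then l ^ 2 / p k - 2 * l ^ 2 else 0) + p x * l ^ 2) := by
    intro x
    split_ifs with h
    · subst h
      have := hp.ne'
      field_simp
      ring
    · ring
  simp only [e, ← Finset.mul_sum, Finset.sum_add_distrib, ← Finset.sum_mul, hsum]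
  refine mul_le_mul_of_nonneg_left ?_ (by positivity)
  rw [Finset.sum_ite_eq' univ k, if_pos (mem_univ k)]
  have h1 : l ^ 2 ≤ 1 := pow_le_one₀ hl'.1 hl'.2
  have h2 : l ^ 2 / p k ≤ 1 / p k := div_le_div_of_nonneg_right h1 hp.le
  nlinarith [sq_nonneg l]

/-- Conditional unbiasedness: each single observation is centered given the past, and `F` is
determined by the past. -/
theorem actionExp_mul_refEst (hs : Setting G W K T) (ℓ : Losses T N K) {τ : ℕ}
    {F : Actions T N K → ℝ} (hF : IsPast W τ F) (k : Fin K) :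
    actionExp G W ℓ (fun a => F a * refEst G W ℓ a τ k)
      = actionExp G W ℓ F * blockLoss W ℓ τ k := by
  have : Nonempty (Fin K) := ⟨⟨0, hs.K_pos⟩⟩
  have hw := sampler_isStaged hs ℓ
  have h0 : actionExp G W ℓ (fun a => F a * (refEst G W ℓ a τ k - blockLoss W ℓ τ k)) = 0 := by
    rw [actionExp_eq_stagedExp]
    simp only [refEst_sub_blockLoss, Finset.mul_sum]
    rw [stagedExp_sum]
    refine Finset.sum_eq_zero fun c hc => ?_
    have hcτ : (c.1 : ℕ) / blockLength W K T = τ :=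
      (Finset.mem_filter.mp (Finset.mem_product.mp hc).1).2
    have hdep : DependsOn (fun b x => F (Function.curry b) * obsNoise G W ℓ τ k c b x)
        {c' : Fin T × Fin N | (c'.1 : ℕ) / blockLength W K T < (c.1 : ℕ) / blockLength W K T} := by
      rw [hcτ]
      intro b b' h
      funext x
      have h1 := hF.dependsOn h
      have h2 := obsNoise_dependsOn (G := G) ℓ τ k c h
      simp only at h1
      simp only [h1, h2]
    rw [hw.stagedExp_apply c hdep]
    have e : ∀ b, ∑ x, sampler G W ℓ b c x * (F (Function.curry b) * obsNoise G W ℓ τ k c b x)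
        = 0 := by
      intro b
      have := congrArg (fun r => F (Function.curry b) * r) (obsNoise_mean hs ℓ k hcτ b)
      simp only [mul_zero, Finset.mul_sum] at this
      rw [← this]
      exact Finset.sum_congr rfl fun x _ => by ring
    simp only [e]
    exact hw.stagedExp_const 0
  simp only [mul_sub] at h0
  rw [actionExp_sub, actionExp_mul_const] at h0
  linarith

/-- At most BN conditionally independent observations, each of variance at most (1/N)²·2/p, where
the 2 comes from replacing policies by the reference one. This is where cooperation gains the factor
1/N. -/
theorem actionExp_mul_noise_sq_le (hs : Setting G W K T) {ℓ : Losses T N K}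
    (hℓ : ∀ t i k, ℓ t i k ∈ Set.Icc (0 : ℝ) 1) {τ : ℕ} (hτ : τ * blockLength W K T ≤ T)
    {F : Actions T N K → ℝ} (hF : IsPast W τ F) (hF0 : ∀ a, 0 ≤ F a) (k : Fin K) :
    actionExp G W ℓ (fun a => F a * (refEst G W ℓ a τ k - blockLoss W ℓ τ k) ^ 2) ≤
      actionExp G W ℓ fun a =>
        F a * (2 * blockLength W K T / N * (1 / refPolicy G W ℓ a τ k)) := by
  have : Nonempty (Fin K) := ⟨⟨0, hs.K_pos⟩⟩
  have hw := sampler_isStaged hs ℓ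
  have hNr : (0 : ℝ) < N := by exact_mod_cast hs.N_pos
  set S := (univ.filter fun t : Fin T => (t : ℕ) / blockLength W K T = τ) ×ˢ
    (univ : Finset (Fin N)) with hS
  have hSτ : ∀ c ∈ S, (c.1 : ℕ) / blockLength W K T = τ := fun c hc =>
    (Finset.mem_filter.mp (Finset.mem_product.mp hc).1).2
  rw [actionExp_eq_stagedExp, actionExp_eq_stagedExp]
  simp only [refEst_sub_blockLoss]
  rw [hw.stagedExp_sq_sum hSτ hF.dependsOn (fun c => obsNoise_dependsOn ℓ τ k c)
    (fun c hc b => obsNoise_mean hs ℓ k (hSτ c hc) b), ← stagedExp_sum]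
  refine hw.stagedExp_mono fun b => ?_
  rw [← Finset.mul_sum]
  refine mul_le_mul_of_nonneg_left ?_ (hF0 _)
  have hrp : 0 < refPolicy G W ℓ (Function.curry b) τ k := by
    have h6 := hs.six_le
    have : 0 < 1 / ((K : ℝ) * T) := by positivity
    exact this.trans_le (refPolicy_ge hs ℓ _ τ k)
  have h1 : ∀ c ∈ S, ∑ x, sampler G W ℓ b c x * obsNoise G W ℓ τ k c b x ^ 2 ≤
      (1 / (N : ℝ)) ^ 2 * (2 / refPolicy G W ℓ (Function.curry b) τ k) := by
    intro c hc
    refine (obsNoise_second_moment hs hℓ k (hSτ c hc) b).trans ?_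
    refine mul_le_mul_of_nonneg_left ?_ (by positivity)
    rw [div_le_div_iff₀ (policy_pos hs ℓ _ _ _ _) hrp, one_mul]
    exact refPolicy_le_policy hs hℓ _ hτ _ _
  refine (Finset.sum_le_card_nsmul _ _ _ h1).trans ?_
  have h2 : (#S : ℝ) ≤ blockLength W K T * N := by
    rw [hS, Finset.card_product, card_univ, Fintype.card_fin]
    push_cast
    refine mul_le_mul_of_nonneg_right ?_ hNr.le
    exact_mod_cast card_block_le hs.B_pos τ
  rw [nsmul_eq_mul]
  refine (mul_le_mul_of_nonneg_right h2 (by positivity)).trans (le_of_eq ?_)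
  field_simp

/-- The expected loss in terms of the sampling distributions. -/
theorem expectedLoss_eq (hs : Setting G W K T) (ℓ : Losses T N K) (i : Fin N) :
    expectedLoss G W ℓ i = actionExp G W ℓ fun a =>
      ∑ t : Fin T, ∑ k, policy G W ℓ a ((t : ℕ) / blockLength W K T) i k * avgLoss ℓ t k := by
  have : Nonempty (Fin K) := ⟨⟨0, hs.K_pos⟩⟩
  have hw := sampler_isStaged hs ℓ
  change actionExp G W ℓ (fun a => ∑ t, avgLoss ℓ t (a t i)) = _
  rw [actionExp_sum, actionExp_sum]
  refine Finset.sum_congr rfl fun t _ => ?_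
  rw [actionExp_eq_stagedExp, actionExp_eq_stagedExp]
  exact hw.stagedExp_apply (t, i) (h := fun _ x => avgLoss ℓ t x) (fun _ _ _ => rfl)

/-- Regret in terms of the reference process, for one realization of the actions. -/
theorem sum_policy_sub_le (hs : Setting G W K T) {ℓ : Losses T N K}
    (hℓ : ∀ t i k, ℓ t i k ∈ Set.Icc (0 : ℝ) 1) (a : Actions T N K) (i : Fin N) (kstar : Fin K) :
    ∑ t : Fin T, (∑ k, policy G W ℓ a ((t : ℕ) / blockLength W K T) i k * avgLoss ℓ t k
        - avgLoss ℓ t kstar) ≤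
      ∑ τ ∈ range (T / blockLength W K T),
        ∑ k, blockLoss W ℓ τ k * (refDist G W ℓ a τ k - (Pi.single kstar 1 : Fin K → ℝ) k)
      + (3 + blockLength W K T) := by
  set B := blockLength W K T with hB
  have hB0 : 0 < B := hs.B_pos
  have hBr : (0 : ℝ) < B := by exact_mod_cast hB0
  have hT : (0 : ℝ) < T := by exact_mod_cast hs.T_pos
  -- There are `M` complete blocks; the remaining rounds, possibly none, form block `M` and are
  -- bounded trivially by B.
  set M := T / B with hM
  have hMB : M * B ≤ T := Nat.div_mul_le_self T B
  have hmaps : ∀ t ∈ (univ : Finset (Fin T)), (t : ℕ) / B ∈ range (M + 1) := by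
    intro t _
    rw [Finset.mem_range, Nat.lt_succ_iff]
    exact Nat.div_le_div_right t.2.le
  rw [← Finset.sum_fiberwise_of_maps_to hmaps, Finset.sum_range_succ]
  have hlast : ∑ t ∈ univ.filter (fun t : Fin T => (t : ℕ) / B = M),
      (∑ k, policy G W ℓ a ((t : ℕ) / B) i k * avgLoss ℓ t k - avgLoss ℓ t kstar) ≤ B := by
    refine (Finset.sum_le_card_nsmul _ _ 1 fun t _ => ?_).trans ?_
    · have h1 := (avgLoss_mem_Icc hs.N_pos hℓ t kstar).1
      have h2 : ∑ k, policy G W ℓ a ((t : ℕ) / B) i k * avgLoss ℓ t k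
          ≤ ∑ k, policy G W ℓ a ((t : ℕ) / B) i k := by
        refine Finset.sum_le_sum fun k _ => ?_
        exact mul_le_of_le_one_right (policy_pos hs ℓ _ _ _ _).le
          (avgLoss_mem_Icc hs.N_pos hℓ t k).2
      rw [policy_sum hs] at h2
      linarith
    · rw [nsmul_eq_mul, mul_one]
      exact_mod_cast card_block_le hB0 M
  have hfull : ∀ τ ∈ range M, ∑ t ∈ univ.filter (fun t : Fin T => (t : ℕ) / B = τ),
      (∑ k, policy G W ℓ a ((t : ℕ) / B) i k * avgLoss ℓ t k - avgLoss ℓ t kstar) ≤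
      ∑ k, blockLoss W ℓ τ k * (refDist G W ℓ a τ k - (Pi.single kstar 1 : Fin K → ℝ) k) + 3 / T * B := by
    intro τ hτ
    have hτM : τ < M := Finset.mem_range.mp hτ
    have hτB : τ * B ≤ T := (Nat.mul_le_mul_right B hτM.le).trans hMB
    have e1 : ∑ t ∈ univ.filter (fun t : Fin T => (t : ℕ) / B = τ),
        (∑ k, policy G W ℓ a ((t : ℕ) / B) i k * avgLoss ℓ t k - avgLoss ℓ t kstar)
        = ∑ k, blockLoss W ℓ τ k * (policy G W ℓ a τ i k - (Pi.single kstar 1 : Fin K → ℝ) k) := by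
      have : ∀ t ∈ univ.filter (fun t : Fin T => (t : ℕ) / B = τ),
          (∑ k, policy G W ℓ a ((t : ℕ) / B) i k * avgLoss ℓ t k - avgLoss ℓ t kstar)
          = ∑ k, avgLoss ℓ t k * (policy G W ℓ a τ i k - (Pi.single kstar 1 : Fin K → ℝ) k) := by
        intro t ht
        rw [(Finset.mem_filter.mp ht).2]
        simp only [mul_sub, Finset.sum_sub_distrib]
        congr 1
        · exact Finset.sum_congr rfl fun k _ => mul_comm _ _
        · simp [Pi.single_apply]
      rw [Finset.sum_congr rfl this, Finset.sum_comm]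
      simp only [blockLoss, Finset.sum_mul]
      rfl
    rw [e1]
    have h1 := sum_abs_policy_sub_refDist_le hs hℓ a hτB i
    have h2 : ∑ k, blockLoss W ℓ τ k * (policy G W ℓ a τ i k - (Pi.single kstar 1 : Fin K → ℝ) k)
        - ∑ k, blockLoss W ℓ τ k * (refDist G W ℓ a τ k - (Pi.single kstar 1 : Fin K → ℝ) k)
        ≤ ∑ k, |policy G W ℓ a τ i k - refDist G W ℓ a τ k| * B := by
      rw [← Finset.sum_sub_distrib]
      refine Finset.sum_le_sum fun k _ => ?_
      have h3 := blockLoss_mem_Icc hs hℓ τ k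
      have h4 : blockLoss W ℓ τ k * (policy G W ℓ a τ i k - refDist G W ℓ a τ k)
          ≤ blockLoss W ℓ τ k * |policy G W ℓ a τ i k - refDist G W ℓ a τ k| :=
        mul_le_mul_of_nonneg_left (le_abs_self _) h3.1
      have h5 := mul_le_mul_of_nonneg_left h3.2
        (abs_nonneg (policy G W ℓ a τ i k - refDist G W ℓ a τ k))
      rw [← hB] at h5
      nlinarith
    rw [← Finset.sum_mul] at h2
    have h3 := mul_le_mul_of_nonneg_right h1 hBr.le
    linarith
  have hsum := Finset.sum_le_sum hfull
  rw [Finset.sum_add_distrib, Finset.sum_const, card_range, nsmul_eq_mul] at hsum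
  have h3 : (M : ℝ) * (3 / T * B) ≤ 3 := by
    have : (M : ℝ) * B ≤ T := by exact_mod_cast hMB
    rw [show (M : ℝ) * (3 / T * B) = 3 * (M * B) / T by ring, div_le_iff₀ hT]
    linarith
  linarith

/-- The regret of agent `i` in terms of the reference process. -/
theorem expectedLoss_sub_le (hs : Setting G W K T) {ℓ : Losses T N K}
    (hℓ : ∀ t i k, ℓ t i k ∈ Set.Icc (0 : ℝ) 1) (i : Fin N) (kstar : Fin K) :
    expectedLoss G W ℓ i - ∑ t, avgLoss ℓ t kstar ≤
      ∑ τ ∈ range (T / blockLength W K T), actionExp G W ℓ (fun a =>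
        ∑ k, blockLoss W ℓ τ k * (refDist G W ℓ a τ k - (Pi.single kstar 1 : Fin K → ℝ) k))
      + (3 + blockLength W K T) := by
  have h := actionExp_mono hs ℓ fun a => sum_policy_sub_le hs hℓ a i kstar
  simp only [Finset.sum_sub_distrib] at h
  rw [actionExp_sub, ← expectedLoss_eq hs, actionExp_const hs, actionExp_add, actionExp_const hs,
    actionExp_sum] at h
  exact h

/-- The reference loss estimates may replace the losses in expectation. -/
theorem actionExp_sum_refEst (hs : Setting G W K T) (ℓ : Losses T N K) (τ : ℕ)
    (u : Fin K → ℝ) :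
    actionExp G W ℓ (fun a => ∑ k, refEst G W ℓ a τ k * (refDist G W ℓ a τ k - u k))
      = actionExp G W ℓ fun a => ∑ k, blockLoss W ℓ τ k * (refDist G W ℓ a τ k - u k) := by
  rw [actionExp_sum, actionExp_sum]
  refine Finset.sum_congr rfl fun k _ => ?_
  have hF : IsPast W τ fun a => refDist G W ℓ a τ k - u k := fun a a' h => by
    have := isPast_refDist (G := G) ℓ τ a a' h
    simp only at this
    simp only [this]
  have := actionExp_mul_refEst hs ℓ hF k
  simp only [mul_comm (refEst _ _ _ _ _ _), mul_comm (blockLoss _ _ _ _)]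
  rw [this, actionExp_mul_const]

end Expectation

/-! ### Expected regret of the reference process for fixed losses -/

/-- The Shannon entropy of `q`. -/
def entropy {K : ℕ} (q : Fin K → ℝ) : ℝ := -∑ k, q k * Real.log (q k)

theorem hybridObj_zero_eq {K : ℕ} (β g : ℝ) (q : Fin K → ℝ) :
    hybridObj β g 0 q = -(β * entropy q + 2 * g * ∑ k, √(q k)) := by
  simp only [hybridObj, entropy, Pi.zero_apply, zero_mul, Finset.sum_const_zero]
  ring

/-- At a vertex the Shannon entropy vanishes but the square roots sum to 1. This is the origin of
the -1 in the penalty terms, which the stochastic bound needs. -/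
theorem hybridObj_zero_single {K : ℕ} (β g : ℝ) (k : Fin K) :
    hybridObj β g 0 (Pi.single k 1) = -(2 * g) := by
  have h1 : ∀ j, (Pi.single k 1 : Fin K → ℝ) j * Real.log ((Pi.single k 1 : Fin K → ℝ) j) = 0 := by
    intro j
    by_cases h : j = k
    · subst h
      simp
    · simp [h]
  have h2 : ∑ j, √((Pi.single k 1 : Fin K → ℝ) j) = 1 := by
    rw [Finset.sum_eq_single k]
    · simp
    · intro j _ h
      simp [h]
    · simp
  rw [hybridObj_zero_eq, h2]
  simp only [entropy, h1]
  simp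

/-- Of the two curvatures, this keeps the entropy; it is used for the mean part of the feedback. Its
companion below keeps the Tsallis part and is used for the noise. -/
theorem div_hybrid_le_div {β g q : ℝ} (hβ : 0 < β) (hg : 0 ≤ g) (hq : 0 ≤ q) :
    q / (β + g / √q) ≤ q / β :=
  div_le_div_of_nonneg_left hq hβ (by have : 0 ≤ g / √q := by positivity
                                      linarith)

theorem div_hybrid_le_mul_sqrt_div {β g q : ℝ} (hβ : 0 < β) (hg : 0 < g) (hq : 0 ≤ q) :
    q / (β + g / √q) ≤ q * √q / g := by
  rcases hq.eq_or_lt with rfl | hq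
  · simp
  · have hs : 0 < √q := Real.sqrt_pos.mpr hq
    have h1 : 0 < g / √q := by positivity
    refine (div_le_div_of_nonneg_left hq.le h1 (by linarith)).trans (le_of_eq ?_)
    field_simp

section Reference

variable {T N K : ℕ} {G : SimpleGraph (Fin N)} {W : Matrix (Fin N) (Fin N) ℝ}

/-- Separates the recursion into its two interleaved runs, with `s` blocks of the same parity before
the current one. -/
theorem refSum_eq_sum (ℓ : Losses T N K) (a : Actions T N K) {π : ℕ} (hπ : π < 2) (s : ℕ) :
    refSum G W ℓ a (2 * s + π) = fun k => ∑ r ∈ range s, refEst G W ℓ a (2 * r + π) k := by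
  induction s with
  | zero =>
    funext k
    interval_cases π <;> simp [refSum]
  | succ s ih =>
    funext k
    rw [show 2 * (s + 1) + π = (2 * s + π) + 2 by ring]
    simp only [refSum]
    rw [ih, Finset.sum_range_succ]

theorem refDist_isMinOn (hs : Setting G W K T) (ℓ : Losses T N K) (a : Actions T N K) {π : ℕ}
    (hπ : π < 2) (s : ℕ) :
    IsMinOn (hybridObj (invEta K (blockLength W K T) s) (invGamma N (blockLength W K T) s)
      (fun k => ∑ r ∈ range s, refEst G W ℓ a (2 * r + π) k)) (stdSimplex ℝ (Fin K))
      (refDist G W ℓ a (2 * s + π)) := by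
  unfold refDist
  rw [show (2 * s + π) / 2 = s by omega, ← refSum_eq_sum ℓ a hπ s]
  refine (ftrl_isMinOn N hs.two_le_K hs.B_pos s fun h => ?_).2
  rw [refSum_eq_sum ℓ a hπ s, h]
  funext k
  simp

theorem invEta_pos (hs : Setting G W K T) (s : ℕ) : 0 < invEta K (blockLength W K T) s := by
  have : (0 : ℝ) < blockLength W K T := by exact_mod_cast hs.B_pos
  exact this.trans_le (le_invEta _ _ _)

/-- Pathwise regret inequality of the reference process. -/
theorem refDist_regret (hs : Setting G W K T) (ℓ : Losses T N K) (a : Actions T N K) {π : ℕ}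
    (hπ : π < 2) (n : ℕ) (c : ℕ → ℝ)
    (hc : ∀ s ≤ n, ∀ k, -(invEta K (blockLength W K T) s / 2) ≤
      refEst G W ℓ a (2 * s + π) k - c s) (kstar : Fin K) :
    ∑ s ∈ range (n + 1), ∑ k, refEst G W ℓ a (2 * s + π) k *
        (refDist G W ℓ a (2 * s + π) k - (Pi.single kstar 1 : Fin K → ℝ) k) ≤
      ∑ s ∈ range (n + 1), ∑ k, 2 * (refEst G W ℓ a (2 * s + π) k - c s) ^ 2 *
          (refDist G W ℓ a (2 * s + π) k / (invEta K (blockLength W K T) s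
            + invGamma N (blockLength W K T) s / √(refDist G W ℓ a (2 * s + π) k)))
      + (invEta K (blockLength W K T) 0 * Real.log K
          + 2 * invGamma N (blockLength W K T) 0 * √K)
      + ∑ s ∈ range n,
          ((invEta K (blockLength W K T) (s + 1) - invEta K (blockLength W K T) s)
              * entropy (refDist G W ℓ a (2 * (s + 1) + π))
            + 2 * (invGamma N (blockLength W K T) (s + 1) - invGamma N (blockLength W K T) s)
              * (∑ k, √(refDist G W ℓ a (2 * (s + 1) + π) k) - 1)) := by
  set β := invEta K (blockLength W K T) with hβ
  set g := invGamma N (blockLength W K T) with hg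
  have h := ftrl_regret β g (invEta_pos hs) (invGamma_nonneg _ _)
    (fun s => refEst G W ℓ a (2 * s + π)) (fun s => refDist G W ℓ a (2 * s + π)) c n
    (fun s _ => refDist_mem hs ℓ a _) (fun s _ => refDist_isMinOn hs ℓ a hπ s) hc
    (single_mem_stdSimplex ℝ kstar)
  refine h.trans ?_
  simp only [hybridObj_zero_eq _ _ (refDist _ _ _ _ _), hybridObj_zero_single]
  have h1 := neg_sum_mul_log_le (refDist_mem hs ℓ a (2 * 0 + π))
  have h2 := sum_sqrt_le (refDist_mem hs ℓ a (2 * 0 + π))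
  have h3 : β 0 * entropy (refDist G W ℓ a (2 * 0 + π)) ≤ β 0 * Real.log K :=
    mul_le_mul_of_nonneg_left h1 (invEta_pos hs 0).le
  have h4 : 2 * g 0 * ∑ k, √(refDist G W ℓ a (2 * 0 + π) k) ≤ 2 * g 0 * √K :=
    mul_le_mul_of_nonneg_left h2 (mul_nonneg zero_le_two (invGamma_nonneg _ _ _))
  -- The comparator contributes -2 g n. Written as a telescoping sum, it turns each sum of square
  -- roots into its excess over 1.
  have h5 : ∑ s ∈ range n, (-(β s * entropy (refDist G W ℓ a (2 * (s + 1) + π))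
        + 2 * g s * ∑ k, √(refDist G W ℓ a (2 * (s + 1) + π) k))
      - -(β (s + 1) * entropy (refDist G W ℓ a (2 * (s + 1) + π))
        + 2 * g (s + 1) * ∑ k, √(refDist G W ℓ a (2 * (s + 1) + π) k)))
      = ∑ s ∈ range n, ((β (s + 1) - β s) * entropy (refDist G W ℓ a (2 * (s + 1) + π))
            + 2 * (g (s + 1) - g s) * (∑ k, √(refDist G W ℓ a (2 * (s + 1) + π) k) - 1))
        + 2 * (g n - g 0) := by
    have : 2 * (g n - g 0) = ∑ s ∈ range n, 2 * (g (s + 1) - g s) := by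
      rw [← Finset.mul_sum, Finset.sum_range_sub]
    rw [this, ← Finset.sum_add_distrib]
    exact Finset.sum_congr rfl fun s _ => by ring
  rw [h5]
  have h6 : 0 ≤ g 0 := invGamma_nonneg _ _ _
  linarith

theorem refEst_nonneg (hs : Setting G W K T) {ℓ : Losses T N K}
    (hℓ : ∀ t i k, ℓ t i k ∈ Set.Icc (0 : ℝ) 1) (a : Actions T N K) (τ : ℕ) (k : Fin K) :
    0 ≤ refEst G W ℓ a τ k :=
  mul_nonneg (by positivity) (Finset.sum_nonneg fun j _ =>
    (blockEstimate_mem_Icc hs hℓ a j k (policy_pos hs ℓ a τ j k) le_rfl).1)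

/-- Mass 1/2 of the learner's output gives at least 1/3 for the reference policy and 1/6 for every
agent, so importance weights are at most 6. -/
theorem refEst_le_of_half_le (hs : Setting G W K T) {ℓ : Losses T N K}
    (hℓ : ∀ t i k, ℓ t i k ∈ Set.Icc (0 : ℝ) 1) (a : Actions T N K) {τ : ℕ}
    (hτ : τ * blockLength W K T ≤ T) {k : Fin K} (hk : 1 / 2 ≤ refDist G W ℓ a τ k) :
    refEst G W ℓ a τ k ≤ 6 * blockLength W K T := by
  have hNr : (0 : ℝ) < N := by exact_mod_cast hs.N_pos
  have h1 := refDist_le_refPolicy hs ℓ a τ k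
  have h2 : ∀ j ∈ (univ : Finset (Fin N)),
      blockEstimate (blockLength W K T) τ (policy G W ℓ a τ) ℓ a j k
        ≤ blockLength W K T * (1 / (1 / 6)) := by
    intro j _
    have h3 := refPolicy_le_policy hs hℓ a hτ j k
    exact (blockEstimate_mem_Icc hs hℓ a j k (P := 1 / 6) (by norm_num) (by linarith)).2
  have h3 := Finset.sum_le_card_nsmul _ _ _ h2
  rw [card_univ, Fintype.card_fin, nsmul_eq_mul] at h3
  unfold refEst
  rw [one_div_mul_eq_div, div_le_iff₀ hNr]
  linarith

theorem isPast_comp_refDist {β : Type*} (ℓ : Losses T N K) (τ : ℕ) (φ : (Fin K → ℝ) → β) :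
    IsPast W τ fun a => φ (refDist G W ℓ a τ) := fun a a' h => by
  have := isPast_refDist (G := G) ℓ τ a a' h
  simp only at this
  simp only [this]

theorem refPolicy_pos (hs : Setting G W K T) (ℓ : Losses T N K) (a : Actions T N K) (τ : ℕ)
    (k : Fin K) : 0 < refPolicy G W ℓ a τ k := by
  have h6 := hs.six_le
  have : 0 < 1 / ((K : ℝ) * T) := by positivity
  exact this.trans_le (refPolicy_ge hs ℓ _ τ k)

/-- The factor q of the weight cancels the 1/p of the variance, because q ≤ (3/2)p; only √q is left.
-/
theorem noise_same_arm_le (hs : Setting G W K T) {ℓ : Losses T N K}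
    (hℓ : ∀ t i k, ℓ t i k ∈ Set.Icc (0 : ℝ) 1) {τ : ℕ} (hτ : τ * blockLength W K T ≤ T)
    (k : Fin K) :
    actionExp G W ℓ (fun a => (refDist G W ℓ a τ k * √(refDist G W ℓ a τ k)) *
        (refEst G W ℓ a τ k - blockLoss W ℓ τ k) ^ 2) ≤
      3 * blockLength W K T / N * actionExp G W ℓ fun a => √(refDist G W ℓ a τ k) := by
  have h := actionExp_mul_noise_sq_le hs hℓ hτ
    (isPast_comp_refDist (G := G) ℓ τ fun q => q k * √(q k))
    (fun a => mul_nonneg ((refDist_mem hs ℓ a τ).1 k) (Real.sqrt_nonneg _)) k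
  refine h.trans ?_
  rw [← actionExp_const_mul]
  refine actionExp_mono hs ℓ fun a => ?_
  have h1 := refDist_le_refPolicy hs ℓ a τ k
  have h2 := refPolicy_pos hs ℓ a τ k
  have h3 : refDist G W ℓ a τ k * (1 / refPolicy G W ℓ a τ k) ≤ 3 / 2 := by
    rw [mul_one_div, div_le_iff₀ h2]
    exact h1
  calc _ = (2 * blockLength W K T / N * √(refDist G W ℓ a τ k)) *
        (refDist G W ℓ a τ k * (1 / refPolicy G W ℓ a τ k)) := by ring
    _ ≤ (2 * blockLength W K T / N * √(refDist G W ℓ a τ k)) * (3 / 2) :=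
        mul_le_mul_of_nonneg_left h3 (by positivity)
    _ = _ := by ring

/-- When arm `kstar` has mass at least 1/2, its variance carries no large factor, and its noise can
be charged to √q of another arm. -/
theorem noise_best_arm_le (hs : Setting G W K T) {ℓ : Losses T N K}
    (hℓ : ∀ t i k, ℓ t i k ∈ Set.Icc (0 : ℝ) 1) {τ : ℕ} (hτ : τ * blockLength W K T ≤ T)
    (kstar k : Fin K) :
    actionExp G W ℓ (fun a => (if 1 / 2 ≤ refDist G W ℓ a τ kstar then
        refDist G W ℓ a τ k * √(refDist G W ℓ a τ k) else 0) *
        (refEst G W ℓ a τ kstar - blockLoss W ℓ τ kstar) ^ 2) ≤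
      6 * blockLength W K T / N * actionExp G W ℓ fun a => √(refDist G W ℓ a τ k) := by
  have h := actionExp_mul_noise_sq_le hs hℓ hτ
    (isPast_comp_refDist (G := G) ℓ τ fun q => if 1 / 2 ≤ q kstar then q k * √(q k) else 0)
    (fun a => by
      split_ifs
      · exact mul_nonneg ((refDist_mem hs ℓ a τ).1 k) (Real.sqrt_nonneg _)
      · exact le_rfl) kstar
  refine h.trans ?_
  rw [← actionExp_const_mul]
  refine actionExp_mono hs ℓ fun a => ?_
  split_ifs with hk
  · have h1 := refDist_le_refPolicy hs ℓ a τ kstar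
    have h2 := refPolicy_pos hs ℓ a τ kstar
    have h3 : 1 / refPolicy G W ℓ a τ kstar ≤ 3 := by
      rw [div_le_iff₀ h2]
      linarith
    have hq1 := le_one_of_mem_stdSimplex (refDist_mem hs ℓ a τ) k
    have hq0 := (refDist_mem hs ℓ a τ).1 k
    have h4 : refDist G W ℓ a τ k * (1 / refPolicy G W ℓ a τ kstar) ≤ 1 * 3 :=
      mul_le_mul hq1 h3 (by positivity) zero_le_one
    calc _ = (2 * blockLength W K T / N * √(refDist G W ℓ a τ k)) *
          (refDist G W ℓ a τ k * (1 / refPolicy G W ℓ a τ kstar)) := by ring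
      _ ≤ (2 * blockLength W K T / N * √(refDist G W ℓ a τ k)) * (1 * 3) :=
          mul_le_mul_of_nonneg_left h4 (by positivity)
      _ = _ := by ring
  · rw [zero_mul]
    positivity

/-- The other arms then carry more than half of the mass, and square roots dominate probabilities.
-/
theorem sqrt_le_two_mul_sum_sqrt {q : Fin K → ℝ} (hq : q ∈ stdSimplex ℝ (Fin K)) {kstar : Fin K}
    (h : q kstar < 1 / 2) : √(q kstar) ≤ 2 * ∑ k ∈ univ.erase kstar, √(q k) := by
  have h1 : ∑ k ∈ univ.erase kstar, q k ≤ ∑ k ∈ univ.erase kstar, √(q k) := by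
    refine Finset.sum_le_sum fun k _ => Real.le_sqrt_of_sq_le ?_
    have := le_one_of_mem_stdSimplex hq k
    have := hq.1 k
    nlinarith
  have h2 := Finset.add_sum_erase univ q (mem_univ kstar)
  rw [hq.2] at h2
  have h3 : √(q kstar) ≤ 1 := Real.sqrt_le_one.mpr (by linarith)
  linarith

theorem noise_best_arm_le_of_lt (hs : Setting G W K T) {ℓ : Losses T N K}
    (hℓ : ∀ t i k, ℓ t i k ∈ Set.Icc (0 : ℝ) 1) {τ : ℕ} (hτ : τ * blockLength W K T ≤ T)
    (kstar : Fin K) :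
    actionExp G W ℓ (fun a => (if 1 / 2 ≤ refDist G W ℓ a τ kstar then 0 else
        refDist G W ℓ a τ kstar * √(refDist G W ℓ a τ kstar)) *
        (refEst G W ℓ a τ kstar - blockLoss W ℓ τ kstar) ^ 2) ≤
      6 * blockLength W K T / N *
        ∑ k ∈ univ.erase kstar, actionExp G W ℓ fun a => √(refDist G W ℓ a τ k) := by
  have h := actionExp_mul_noise_sq_le hs hℓ hτ
    (isPast_comp_refDist (G := G) ℓ τ fun q =>
      if 1 / 2 ≤ q kstar then 0 else q kstar * √(q kstar))
    (fun a => by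
      split_ifs
      · exact le_rfl
      · exact mul_nonneg ((refDist_mem hs ℓ a τ).1 _) (Real.sqrt_nonneg _)) kstar
  refine h.trans ?_
  rw [← actionExp_sum, ← actionExp_const_mul]
  refine actionExp_mono hs ℓ fun a => ?_
  split_ifs with hk
  · rw [zero_mul]
    positivity
  · have h1 := refDist_le_refPolicy hs ℓ a τ kstar
    have h2 := refPolicy_pos hs ℓ a τ kstar
    have h3 : refDist G W ℓ a τ kstar * (1 / refPolicy G W ℓ a τ kstar) ≤ 3 / 2 := by
      rw [mul_one_div, div_le_iff₀ h2]
      exact h1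
    have h4 := sqrt_le_two_mul_sum_sqrt (refDist_mem hs ℓ a τ) (not_le.mp hk)
    calc _ = (2 * blockLength W K T / N * √(refDist G W ℓ a τ kstar)) *
          (refDist G W ℓ a τ kstar * (1 / refPolicy G W ℓ a τ kstar)) := by ring
      _ ≤ (2 * blockLength W K T / N * √(refDist G W ℓ a τ kstar)) * (3 / 2) :=
          mul_le_mul_of_nonneg_left h3 (by positivity)
      _ = 3 * blockLength W K T / N * √(refDist G W ℓ a τ kstar) := by ring
      _ ≤ 3 * blockLength W K T / N *
            (2 * ∑ k ∈ univ.erase kstar, √(refDist G W ℓ a τ k)) :=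
          mul_le_mul_of_nonneg_left h4 (by positivity)
      _ = _ := by ring

/-- Stability without shift. -/
theorem stability_le (hs : Setting G W K T) {ℓ : Losses T N K}
    (hℓ : ∀ t i k, ℓ t i k ∈ Set.Icc (0 : ℝ) 1) {τ : ℕ} (hτ : τ * blockLength W K T ≤ T)
    {β g : ℝ} (hβ : 0 < β) (hg : 0 < g) :
    actionExp G W ℓ (fun a => ∑ k, 2 * refEst G W ℓ a τ k ^ 2 *
        (refDist G W ℓ a τ k / (β + g / √(refDist G W ℓ a τ k)))) ≤
      4 * (blockLength W K T : ℝ) ^ 2 / β + 12 * blockLength W K T / (N * g) *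
        actionExp G W ℓ fun a => ∑ k, √(refDist G W ℓ a τ k) := by
  -- Split the estimate into mean and noise; the mean is weighted by q/β and the noise by q√q/g.
  have h1 : ∀ a, ∑ k, 2 * refEst G W ℓ a τ k ^ 2 *
        (refDist G W ℓ a τ k / (β + g / √(refDist G W ℓ a τ k))) ≤
      4 * (blockLength W K T : ℝ) ^ 2 / β + ∑ k, 4 / g *
        ((refDist G W ℓ a τ k * √(refDist G W ℓ a τ k)) *
          (refEst G W ℓ a τ k - blockLoss W ℓ τ k) ^ 2) := by
    intro a
    have hq := refDist_mem hs ℓ a τ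
    have e : 4 * (blockLength W K T : ℝ) ^ 2 / β
        = ∑ k, 4 * (blockLength W K T : ℝ) ^ 2 / β * refDist G W ℓ a τ k := by
      rw [← Finset.mul_sum, hq.2, mul_one]
    rw [e, ← Finset.sum_add_distrib]
    refine Finset.sum_le_sum fun k _ => ?_
    have hqk := hq.1 k
    set q := refDist G W ℓ a τ k with hqdef
    set m := blockLoss W ℓ τ k with hm
    set d := refEst G W ℓ a τ k - m with hd
    have hz : refEst G W ℓ a τ k = m + d := by simp [hd]
    have hmB : m ^ 2 ≤ (blockLength W K T : ℝ) ^ 2 :=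
      pow_le_pow_left₀ (blockLoss_mem_Icc hs hℓ τ k).1 (blockLoss_mem_Icc hs hℓ τ k).2 2
    have h2 := div_hybrid_le_div hβ hg.le hqk
    have h3 := div_hybrid_le_mul_sqrt_div hβ hg hqk
    have h4 : 0 ≤ q / (β + g / √q) := by positivity
    rw [hz]
    calc 2 * (m + d) ^ 2 * (q / (β + g / √q))
        ≤ (4 * m ^ 2 + 4 * d ^ 2) * (q / (β + g / √q)) :=
          mul_le_mul_of_nonneg_right (by nlinarith [sq_nonneg (m - d)]) h4
      _ = 4 * m ^ 2 * (q / (β + g / √q)) + 4 * d ^ 2 * (q / (β + g / √q)) := by ring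
      _ ≤ 4 * (blockLength W K T : ℝ) ^ 2 * (q / β) + 4 * d ^ 2 * (q * √q / g) := by
          refine add_le_add (mul_le_mul (by linarith) h2 h4 (by positivity)) ?_
          exact mul_le_mul_of_nonneg_left h3 (by positivity)
      _ = _ := by ring
  refine (actionExp_mono hs ℓ h1).trans ?_
  rw [actionExp_add, actionExp_const hs, actionExp_sum, actionExp_sum, Finset.mul_sum]
  refine add_le_add le_rfl (Finset.sum_le_sum fun k _ => ?_)
  rw [actionExp_const_mul]
  have h2 := mul_le_mul_of_nonneg_left (noise_same_arm_le hs hℓ hτ k)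
    (show 0 ≤ 4 / g by positivity)
  refine h2.trans (le_of_eq ?_)
  field_simp
  ring

/-- The shift used for the refined stability estimate. -/
def lateShift (G : SimpleGraph (Fin N)) (W : Matrix (Fin N) (Fin N) ℝ) (ℓ : Losses T N K)
    (a : Actions T N K) (τ : ℕ) (kstar : Fin K) : ℝ :=
  if 1 / 2 ≤ refDist G W ℓ a τ kstar then refEst G W ℓ a τ kstar else blockLoss W ℓ τ kstar

theorem lateShift_le (hs : Setting G W K T) {ℓ : Losses T N K}
    (hℓ : ∀ t i k, ℓ t i k ∈ Set.Icc (0 : ℝ) 1) (a : Actions T N K) {τ : ℕ}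
    (hτ : τ * blockLength W K T ≤ T) (kstar : Fin K) :
    lateShift G W ℓ a τ kstar ≤ 6 * blockLength W K T := by
  unfold lateShift
  split_ifs with h
  · exact refEst_le_of_half_le hs hℓ a hτ h
  · have := (blockLoss_mem_Icc hs hℓ τ kstar).2
    have h0 : (0 : ℝ) ≤ blockLength W K T := Nat.cast_nonneg _
    linarith

/-- Stability with a shift, in terms of the arms other than `kstar`. -/
theorem stability_late_le (hs : Setting G W K T) {ℓ : Losses T N K}
    (hℓ : ∀ t i k, ℓ t i k ∈ Set.Icc (0 : ℝ) 1) {τ : ℕ} (hτ : τ * blockLength W K T ≤ T)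
    {β g : ℝ} (hβ : 0 < β) (hg : 0 < g) (kstar : Fin K) :
    actionExp G W ℓ (fun a => ∑ k, 2 * (refEst G W ℓ a τ k - lateShift G W ℓ a τ kstar) ^ 2 *
        (refDist G W ℓ a τ k / (β + g / √(refDist G W ℓ a τ k)))) ≤
      4 / β * ∑ k ∈ univ.erase kstar, (actionExp G W ℓ fun a => refDist G W ℓ a τ k) *
          (blockLoss W ℓ τ k - blockLoss W ℓ τ kstar) ^ 2
      + 96 * blockLength W K T / (N * g) *
        ∑ k ∈ univ.erase kstar, actionExp G W ℓ fun a => √(refDist G W ℓ a τ k) := by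
  have h1 : ∀ a, ∑ k, 2 * (refEst G W ℓ a τ k - lateShift G W ℓ a τ kstar) ^ 2 *
        (refDist G W ℓ a τ k / (β + g / √(refDist G W ℓ a τ k))) ≤
      4 / g * ((if 1 / 2 ≤ refDist G W ℓ a τ kstar then 0 else
          refDist G W ℓ a τ kstar * √(refDist G W ℓ a τ kstar)) *
          (refEst G W ℓ a τ kstar - blockLoss W ℓ τ kstar) ^ 2)
      + ∑ k ∈ univ.erase kstar,
        (4 / β * (refDist G W ℓ a τ k * (blockLoss W ℓ τ k - blockLoss W ℓ τ kstar) ^ 2)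
        + (8 / g * ((refDist G W ℓ a τ k * √(refDist G W ℓ a τ k)) *
            (refEst G W ℓ a τ k - blockLoss W ℓ τ k) ^ 2)
          + 8 / g * ((if 1 / 2 ≤ refDist G W ℓ a τ kstar then
              refDist G W ℓ a τ k * √(refDist G W ℓ a τ k) else 0) *
              (refEst G W ℓ a τ kstar - blockLoss W ℓ τ kstar) ^ 2))) := by
    intro a
    have hq := refDist_mem hs ℓ a τ
    rw [← Finset.add_sum_erase univ _ (mem_univ kstar)]
    unfold lateShift
    set q := refDist G W ℓ a τ with hqdef
    set m := blockLoss W ℓ τ with hm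
    set z := refEst G W ℓ a τ with hz
    have ha : ∀ k, 0 ≤ q k / (β + g / √(q k)) := fun k => by
      have := hq.1 k
      positivity
    have hb : ∀ k, 4 / β * (q k * (m k - m kstar) ^ 2)
        = 4 * (m k - m kstar) ^ 2 * (q k / β) := fun k => by ring
    have h2 := fun k => div_hybrid_le_div hβ hg.le (hq.1 k)
    have h3 := fun k => div_hybrid_le_mul_sqrt_div hβ hg (hq.1 k)
    -- In the first case the shift is the estimate of `kstar` itself: that arm drops out and its
    -- noise spreads over the others. In the second case the shift is its mean loss: its noise stays
    -- in its own term, which `noise_best_arm_le_of_lt` charges to the other arms.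
    by_cases hk : 1 / 2 ≤ q kstar
    · simp only [if_pos hk, zero_mul, mul_zero, zero_add]
      rw [sub_self, zero_pow two_ne_zero, mul_zero, zero_mul, zero_add]
      refine Finset.sum_le_sum fun k _ => ?_
      calc 2 * (z k - z kstar) ^ 2 * (q k / (β + g / √(q k)))
          ≤ (4 * (m k - m kstar) ^ 2 + 8 * ((z k - m k) ^ 2 + (z kstar - m kstar) ^ 2))
              * (q k / (β + g / √(q k))) := by
            refine mul_le_mul_of_nonneg_right ?_ (ha k)
            nlinarith [sq_nonneg ((m k - m kstar) - ((z k - m k) - (z kstar - m kstar))),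
              sq_nonneg ((z k - m k) + (z kstar - m kstar))]
        _ = 4 * (m k - m kstar) ^ 2 * (q k / (β + g / √(q k)))
            + 8 * ((z k - m k) ^ 2 + (z kstar - m kstar) ^ 2) * (q k / (β + g / √(q k))) := by ring
        _ ≤ 4 * (m k - m kstar) ^ 2 * (q k / β)
            + 8 * ((z k - m k) ^ 2 + (z kstar - m kstar) ^ 2) * (q k * √(q k) / g) :=
            add_le_add (mul_le_mul_of_nonneg_left (h2 k) (by positivity))
              (mul_le_mul_of_nonneg_left (h3 k) (by positivity))
        _ = _ := by ring
    · simp only [if_neg hk, zero_mul, mul_zero, add_zero]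
      refine add_le_add ?_ (Finset.sum_le_sum fun k _ => ?_)
      · calc 2 * (z kstar - m kstar) ^ 2 * (q kstar / (β + g / √(q kstar)))
            ≤ 4 * (z kstar - m kstar) ^ 2 * (q kstar * √(q kstar) / g) := by
              refine mul_le_mul ?_ (h3 kstar) (ha kstar) (by positivity)
              nlinarith [sq_nonneg (z kstar - m kstar)]
          _ = _ := by ring
      · calc 2 * (z k - m kstar) ^ 2 * (q k / (β + g / √(q k)))
            ≤ (4 * (m k - m kstar) ^ 2 + 8 * (z k - m k) ^ 2) * (q k / (β + g / √(q k))) := by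
              refine mul_le_mul_of_nonneg_right ?_ (ha k)
              nlinarith [sq_nonneg ((m k - m kstar) - (z k - m k)), sq_nonneg (z k - m k)]
          _ = 4 * (m k - m kstar) ^ 2 * (q k / (β + g / √(q k)))
              + 8 * (z k - m k) ^ 2 * (q k / (β + g / √(q k))) := by ring
          _ ≤ 4 * (m k - m kstar) ^ 2 * (q k / β) + 8 * (z k - m k) ^ 2 * (q k * √(q k) / g) :=
              add_le_add (mul_le_mul_of_nonneg_left (h2 k) (by positivity))
                (mul_le_mul_of_nonneg_left (h3 k) (by positivity))
          _ = _ := by ring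
  refine (actionExp_mono hs ℓ h1).trans ?_
  rw [actionExp_add, actionExp_const_mul, actionExp_sum, Finset.mul_sum, Finset.mul_sum]
  have h2 := mul_le_mul_of_nonneg_left (noise_best_arm_le_of_lt hs hℓ hτ kstar)
    (show 0 ≤ 4 / g by positivity)
  refine (add_le_add h2 le_rfl).trans ?_
  rw [Finset.mul_sum, Finset.mul_sum, ← Finset.sum_add_distrib, ← Finset.sum_add_distrib]
  refine Finset.sum_le_sum fun k _ => ?_
  rw [actionExp_add, actionExp_add, actionExp_const_mul, actionExp_const_mul, actionExp_const_mul,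
    actionExp_mul_const]
  have h3 := mul_le_mul_of_nonneg_left (noise_same_arm_le hs hℓ hτ k)
    (show 0 ≤ 8 / g by positivity)
  have h4 := mul_le_mul_of_nonneg_left (noise_best_arm_le hs hℓ hτ kstar k)
    (show 0 ≤ 8 / g by positivity)
  -- 96 = 4·6 + 8·3 + 8·6: the noise of `kstar` when it is light, the noise of arm `k`, and the
  -- noise of `kstar` when it is heavy.
  have e : 96 * (blockLength W K T : ℝ) / (N * g) *
      (actionExp G W ℓ fun a => √(refDist G W ℓ a τ k))
      = 4 / g * (6 * blockLength W K T / N * actionExp G W ℓ fun a => √(refDist G W ℓ a τ k))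
      + 8 / g * (3 * blockLength W K T / N * actionExp G W ℓ fun a => √(refDist G W ℓ a τ k))
      + 8 / g * (6 * blockLength W K T / N * actionExp G W ℓ fun a => √(refDist G W ℓ a τ k)) := by
    field_simp
    ring
  rw [e]
  linarith

/-- Expected regret of the reference process along the blocks of one parity. -/
theorem actionExp_regret_le (hs : Setting G W K T) {ℓ : Losses T N K}
    (hℓ : ∀ t i k, ℓ t i k ∈ Set.Icc (0 : ℝ) 1) {π : ℕ} (hπ : π < 2) {n : ℕ}
    (hn : (2 * n + π) * blockLength W K T ≤ T) (late : ℕ → Prop) [DecidablePred late]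
    (hlate : ∀ s, late s → 12 * (blockLength W K T : ℝ) ≤ invEta K (blockLength W K T) s)
    (kstar : Fin K) :
    ∑ s ∈ range (n + 1), actionExp G W ℓ (fun a => ∑ k, blockLoss W ℓ (2 * s + π) k *
        (refDist G W ℓ a (2 * s + π) k - (Pi.single kstar 1 : Fin K → ℝ) k)) ≤
      ∑ s ∈ range (n + 1), (if late s then
          4 / invEta K (blockLength W K T) s * ∑ k ∈ univ.erase kstar,
            (actionExp G W ℓ fun a => refDist G W ℓ a (2 * s + π) k) *
            (blockLoss W ℓ (2 * s + π) k - blockLoss W ℓ (2 * s + π) kstar) ^ 2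
          + 96 * blockLength W K T / (N * invGamma N (blockLength W K T) s) *
            ∑ k ∈ univ.erase kstar, actionExp G W ℓ fun a => √(refDist G W ℓ a (2 * s + π) k)
        else 4 * (blockLength W K T : ℝ) ^ 2 / invEta K (blockLength W K T) s
          + 12 * blockLength W K T / (N * invGamma N (blockLength W K T) s) *
            actionExp G W ℓ fun a => ∑ k, √(refDist G W ℓ a (2 * s + π) k))
      + (invEta K (blockLength W K T) 0 * Real.log K
          + 2 * invGamma N (blockLength W K T) 0 * √K)
      + ∑ s ∈ range n, actionExp G W ℓ (fun a =>
          (invEta K (blockLength W K T) (s + 1) - invEta K (blockLength W K T) s)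
              * entropy (refDist G W ℓ a (2 * (s + 1) + π))
            + 2 * (invGamma N (blockLength W K T) (s + 1) - invGamma N (blockLength W K T) s)
              * (∑ k, √(refDist G W ℓ a (2 * (s + 1) + π) k) - 1)) := by
  have hτ : ∀ s ≤ n, (2 * s + π) * blockLength W K T ≤ T := fun s h =>
    (Nat.mul_le_mul_right _ (by omega)).trans hn
  have hB0 : (0 : ℝ) ≤ blockLength W K T := Nat.cast_nonneg _
  have h1 := actionExp_mono hs ℓ fun a => refDist_regret hs ℓ a hπ n
    (fun s => if late s then lateShift G W ℓ a (2 * s + π) kstar else 0) (by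
      intro s hsn k
      -- Estimates are nonnegative, so the shift, which is at most 6B, only has to stay below β/2;
      -- this is why 12B is required of late blocks.
      have hz := refEst_nonneg hs hℓ a (2 * s + π) k
      have hβ := invEta_pos hs s
      split_ifs with h
      · have := lateShift_le hs hℓ a (hτ s hsn) kstar
        have := hlate s h
        linarith
      · linarith) kstar
  rw [actionExp_sum, actionExp_add, actionExp_add, actionExp_sum, actionExp_const hs,
    actionExp_sum] at h1
  simp only [actionExp_sum_refEst hs] at h1
  refine h1.trans (add_le_add (add_le_add (Finset.sum_le_sum fun s hsn => ?_) le_rfl) le_rfl)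
  have hsn' : s ≤ n := Nat.lt_succ_iff.mp (Finset.mem_range.mp hsn)
  split_ifs with h
  · exact stability_late_le hs hℓ (hτ s hsn') (invEta_pos hs s)
      (invGamma_pos hs.N_pos hs.B_pos s) kstar
  · simp only [sub_zero]
    exact stability_le hs hℓ (hτ s hsn') (invEta_pos hs s) (invGamma_pos hs.N_pos hs.B_pos s)

end Reference

/-! ### Adversarial environment -/

theorem sum_range_parity (f : ℕ → ℝ) (M : ℕ) :
    ∑ τ ∈ range M, f τ
      = ∑ s ∈ range ((M + 1) / 2), f (2 * s + 0) + ∑ s ∈ range (M / 2), f (2 * s + 1) := by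
  induction M with
  | zero => simp
  | succ M ih =>
    rw [Finset.sum_range_succ, ih]
    rcases Nat.even_or_odd' M with ⟨m, rfl | rfl⟩
    · rw [show (2 * m + 1 + 1) / 2 = m + 1 by omega, show (2 * m + 1) / 2 = m by omega,
        show 2 * m / 2 = m by omega, Finset.sum_range_succ _ m]
      simp only [add_zero]
      ring
    · rw [show (2 * m + 1 + 1 + 1) / 2 = m + 1 by omega, show (2 * m + 1 + 1) / 2 = m + 1 by omega,
        show (2 * m + 1) / 2 = m by omega, Finset.sum_range_succ (fun s => f (2 * s + 1)) m]
      ring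

/-- A bound for the sums over the blocks of either parity gives a bound for the whole sum. -/
theorem sum_range_le_of_parity {f : ℕ → ℝ} {M : ℕ} {X : ℝ} (hX : 0 ≤ X)
    (h : ∀ π < 2, ∀ n, 2 * n + π < M → ∑ s ∈ range (n + 1), f (2 * s + π) ≤ X) :
    ∑ τ ∈ range M, f τ ≤ 2 * X := by
  have hp : ∀ π < 2, ∀ m, (m ≠ 0 → 2 * (m - 1) + π < M) →
      ∑ s ∈ range m, f (2 * s + π) ≤ X := by
    intro π hπ m hm
    cases m with
    | zero => simpa using hX
    | succ m => exact h π hπ m (by simpa using hm (by omega))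
  rw [sum_range_parity]
  have h0 := hp 0 (by norm_num) ((M + 1) / 2) (by omega)
  have h1 := hp 1 (by norm_num) (M / 2) (by omega)
  linarith

theorem sqrt_succ_sub_sqrt_le {x : ℝ} (hx : 0 ≤ x) : √(x + 1) - √x ≤ 1 / √(x + 1) := by
  have h1 : 0 < √(x + 1) := Real.sqrt_pos.mpr (by linarith)
  rw [le_div_iff₀ h1]
  have h2 := Real.sq_sqrt (show 0 ≤ x + 1 by linarith)
  have h3 := Real.sq_sqrt hx
  have h4 : √x ≤ √(x + 1) := Real.sqrt_le_sqrt (by linarith)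
  have h5 := Real.sqrt_nonneg x
  nlinarith

theorem inv_two_sqrt_succ_le {x : ℝ} (hx : 0 ≤ x) : 1 / (2 * √(x + 1)) ≤ √(x + 1) - √x := by
  have h1 : 0 < √(x + 1) := Real.sqrt_pos.mpr (by linarith)
  rw [div_le_iff₀ (by positivity)]
  have h2 := Real.sq_sqrt (show 0 ≤ x + 1 by linarith)
  have h3 := Real.sq_sqrt hx
  nlinarith [sq_nonneg (√(x + 1) - √x)]

theorem sum_inv_sqrt_le (n : ℕ) :
    ∑ s ∈ range (n + 1), 1 / √((max s 1 : ℕ) : ℝ) ≤ 3 * √((n : ℝ) + 1) := by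
  have h : ∀ n : ℕ, ∑ s ∈ range (n + 1), 1 / √((max s 1 : ℕ) : ℝ) ≤ 1 + 2 * √(n : ℝ) := by
    intro n
    induction n with
    | zero => simp
    | succ n ih =>
      rw [Finset.sum_range_succ]
      have h1 := inv_two_sqrt_succ_le (Nat.cast_nonneg (α := ℝ) n)
      rw [one_div, mul_inv] at h1
      rw [show max (n + 1) 1 = n + 1 by omega, Nat.cast_add_one, one_div]
      linarith
  refine (h n).trans ?_
  have h1 : 1 ≤ √((n : ℝ) + 1) := Real.one_le_sqrt.mpr (by linarith [Nat.cast_nonneg (α := ℝ) n])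
  have h2 : √(n : ℝ) ≤ √((n : ℝ) + 1) := Real.sqrt_le_sqrt (by linarith)
  linarith

theorem invEta_mono (K B : ℕ) : Monotone (invEta K B) := by
  intro s t h
  unfold invEta
  have h1 : ((max s 1 : ℕ) : ℝ) ≤ (max t 1 : ℕ) := by
    exact_mod_cast max_le_max h le_rfl
  have h2 := Real.log_natCast_nonneg K
  gcongr

theorem invGamma_mono (N B : ℕ) : Monotone (invGamma N B) := by
  intro s t h
  unfold invGamma
  have h1 : ((max s 1 : ℕ) : ℝ) ≤ (max t 1 : ℕ) := by
    exact_mod_cast max_le_max h le_rfl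
  gcongr

theorem sq_div_invEta_le {K B : ℕ} (hK : 2 ≤ K) (hB : 0 < B) (s : ℕ) :
    (B : ℝ) ^ 2 / invEta K B s ≤ B * √(Real.log K) * (1 / √((max s 1 : ℕ) : ℝ)) := by
  have hL := log_natCast_pos hK
  have hBr : (0 : ℝ) < B := by exact_mod_cast hB
  have hm : (0 : ℝ) < (max s 1 : ℕ) := by
    have : 0 < max s 1 := by omega
    exact_mod_cast this
  have h1 : (B : ℝ) * √((max s 1 : ℕ) / Real.log K) ≤ invEta K B s := le_max_right _ _
  have h2 : 0 < (B : ℝ) * √((max s 1 : ℕ) / Real.log K) := by positivity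
  refine (div_le_div_of_nonneg_left (by positivity) h2 h1).trans (le_of_eq ?_)
  rw [Real.sqrt_div hm.le]
  have := Real.sqrt_pos.mpr hm
  have := Real.sqrt_pos.mpr hL
  field_simp

theorem div_mul_invGamma {N B : ℕ} (hN : 0 < N) (hB : 0 < B) (s : ℕ) :
    (B : ℝ) / (N * invGamma N B s) = √(B / N) * (1 / √((max s 1 : ℕ) : ℝ)) := by
  have hBr : (0 : ℝ) < B := by exact_mod_cast hB
  have hNr : (0 : ℝ) < N := by exact_mod_cast hN
  have hm : (0 : ℝ) < (max s 1 : ℕ) := by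
    have : 0 < max s 1 := by omega
    exact_mod_cast this
  unfold invGamma
  rw [mul_div_assoc, Real.sqrt_mul hm.le]
  have h1 := Real.sqrt_pos.mpr hm
  have h2 : 0 < √((B : ℝ) / N) := Real.sqrt_pos.mpr (by positivity)
  have h3 : √((B : ℝ) / N) ^ 2 = B / N := Real.sq_sqrt (by positivity)
  field_simp
  rw [h3]
  field_simp

section Adversarial

variable {T N K : ℕ} {G : SimpleGraph (Fin N)} {W : Matrix (Fin N) (Fin N) ℝ}

theorem half_le_log {K : ℕ} (hK : 2 ≤ K) : 1 / 2 ≤ Real.log K := by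
  have h1 := Real.log_two_gt_d9
  have h2 : Real.log 2 ≤ Real.log K :=
    Real.log_le_log (by norm_num) (by exact_mod_cast hK)
  linarith

/-- Regret of the reference process along the blocks of one parity, adversarial losses. -/
theorem actionExp_regret_adversarial (hs : Setting G W K T) {ℓ : Losses T N K}
    (hℓ : ∀ t i k, ℓ t i k ∈ Set.Icc (0 : ℝ) 1) {π : ℕ} (hπ : π < 2) {n : ℕ}
    (hn : 2 * n + π < T / blockLength W K T) (kstar : Fin K) :
    ∑ s ∈ range (n + 1), actionExp G W ℓ (fun a => ∑ k, blockLoss W ℓ (2 * s + π) k *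
        (refDist G W ℓ a (2 * s + π) k - (Pi.single kstar 1 : Fin K → ℝ) k)) ≤
      13 * √((blockLength W K T : ℝ) * T * Real.log K) + 38 * √((K : ℝ) * T / N)
        + blockLength W K T * Real.log K := by
  set B := blockLength W K T with hB
  have hB0 : 0 < B := hs.B_pos
  have hBr : (0 : ℝ) < B := by exact_mod_cast hB0
  have hNr : (0 : ℝ) < N := by exact_mod_cast hs.N_pos
  have hL := log_natCast_pos hs.two_le_K
  set L := Real.log K with hLdef
  have hTB : T / B * B ≤ T := Nat.div_mul_le_self T B
  have hnB : (2 * n + π) * B ≤ T := (Nat.mul_le_mul_right B hn.le).trans hTB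
  have hnB' : ((n : ℝ) + 1) * B ≤ T := by
    have : (n + 1) * B ≤ T := (Nat.mul_le_mul_right B (by omega)).trans hTB
    exact_mod_cast this
  -- No block is declared late: against an adversary no shift is used.
  have h := actionExp_regret_le hs hℓ hπ hnB (fun _ => False) (by simp) kstar
  simp only [if_false, ← hB] at h
  refine h.trans ?_
  set g := invGamma N B with hg
  set β := invEta K B with hβ
  have hS : ∀ s, actionExp G W ℓ (fun a => ∑ k, √(refDist G W ℓ a (2 * s + π) k)) ≤ √K := by
    intro s
    have := actionExp_mono hs ℓ fun a => sum_sqrt_le (refDist_mem hs ℓ a (2 * s + π))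
    rwa [actionExp_const hs] at this
  have h1 : ∑ s ∈ range (n + 1), (4 * (B : ℝ) ^ 2 / β s + 12 * B / (N * g s) *
      actionExp G W ℓ fun a => ∑ k, √(refDist G W ℓ a (2 * s + π) k))
      ≤ (12 * (B * √L) + 36 * (√(B / N) * √K)) * √((n : ℝ) + 1) := by
    have : ∀ s ∈ range (n + 1), (4 * (B : ℝ) ^ 2 / β s + 12 * B / (N * g s) *
        actionExp G W ℓ fun a => ∑ k, √(refDist G W ℓ a (2 * s + π) k))
        ≤ (4 * (B * √L) + 12 * (√(B / N) * √K)) * (1 / √((max s 1 : ℕ) : ℝ)) := by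
      intro s _
      have e1 := sq_div_invEta_le hs.two_le_K hB0 s
      have e2 := div_mul_invGamma hs.N_pos hB0 s
      have e3 : 12 * (B : ℝ) / (N * g s) = 12 * (√(B / N) * (1 / √((max s 1 : ℕ) : ℝ))) := by
        rw [← e2]
        ring
      have e4 := mul_le_mul_of_nonneg_left (hS s)
        (show 0 ≤ 12 * (√((B : ℝ) / N) * (1 / √((max s 1 : ℕ) : ℝ))) by positivity)
      rw [e3, show 4 * (B : ℝ) ^ 2 / β s = 4 * ((B : ℝ) ^ 2 / β s) by ring]
      nlinarith
    refine (Finset.sum_le_sum this).trans ?_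
    rw [← Finset.mul_sum]
    have h3 := mul_le_mul_of_nonneg_left (sum_inv_sqrt_le n)
      (show 0 ≤ 4 * ((B : ℝ) * √L) + 12 * (√(B / N) * √K) by positivity)
    linarith
  -- Entropies are replaced by their maxima, after which the penalties telescope.
  have h2 : ∑ s ∈ range n, actionExp G W ℓ (fun a =>
      (β (s + 1) - β s) * entropy (refDist G W ℓ a (2 * (s + 1) + π))
        + 2 * (g (s + 1) - g s) * (∑ k, √(refDist G W ℓ a (2 * (s + 1) + π) k) - 1))
      ≤ (β n - β 0) * L + 2 * (g n - g 0) * √K := by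
    have : ∀ s ∈ range n, actionExp G W ℓ (fun a =>
        (β (s + 1) - β s) * entropy (refDist G W ℓ a (2 * (s + 1) + π))
          + 2 * (g (s + 1) - g s) * (∑ k, √(refDist G W ℓ a (2 * (s + 1) + π) k) - 1))
        ≤ (β (s + 1) - β s) * L + 2 * (g (s + 1) - g s) * √K := by
      intro s _
      have := actionExp_mono hs ℓ (f := fun a =>
        (β (s + 1) - β s) * entropy (refDist G W ℓ a (2 * (s + 1) + π))
          + 2 * (g (s + 1) - g s) * (∑ k, √(refDist G W ℓ a (2 * (s + 1) + π) k) - 1))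
        (g := fun _ => (β (s + 1) - β s) * L + 2 * (g (s + 1) - g s) * √K) fun a => by
          have i1 : 0 ≤ β (s + 1) - β s := sub_nonneg.mpr (invEta_mono K B (Nat.le_succ s))
          have i2 : 0 ≤ g (s + 1) - g s := sub_nonneg.mpr (invGamma_mono N B (Nat.le_succ s))
          have i3 := neg_sum_mul_log_le (refDist_mem hs ℓ a (2 * (s + 1) + π))
          have i4 := sum_sqrt_le (refDist_mem hs ℓ a (2 * (s + 1) + π))
          exact add_le_add (mul_le_mul_of_nonneg_left i3 i1)
            (mul_le_mul_of_nonneg_left (by linarith) (by positivity))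
      rwa [actionExp_const hs] at this
    refine (Finset.sum_le_sum this).trans (le_of_eq ?_)
    rw [Finset.sum_add_distrib, ← Finset.sum_mul, Finset.sum_range_sub, ← Finset.sum_mul,
      ← Finset.mul_sum, Finset.sum_range_sub]
  have hmax : ((max n 1 : ℕ) : ℝ) ≤ n + 1 := by
    have : max n 1 ≤ n + 1 := by omega
    exact_mod_cast this
  have h3 : β n * L ≤ B * L + B * √L * √((n : ℝ) + 1) := by
    have i1 : β n ≤ B + B * √(((n : ℝ) + 1) / L) := by
      refine max_le (by linarith [mul_nonneg hBr.le (Real.sqrt_nonneg (((n : ℝ) + 1) / L))]) ?_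
      have : (B : ℝ) * √((max n 1 : ℕ) / L) ≤ B * √(((n : ℝ) + 1) / L) := by gcongr
      linarith
    have i2 := mul_le_mul_of_nonneg_right i1 hL.le
    refine i2.trans (le_of_eq ?_)
    rw [Real.sqrt_div (by positivity)]
    rw [add_mul, show (B : ℝ) * (√((n : ℝ) + 1) / √L) * L = B * √((n : ℝ) + 1) * (L / √L) by ring,
      Real.div_sqrt]
    ring
  have h4 : g n ≤ √(B / N) * √((n : ℝ) + 1) := by
    rw [hg, invGamma, mul_comm, ← Real.sqrt_mul (by positivity)]
    refine Real.sqrt_le_sqrt ?_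
    rw [div_mul_eq_mul_div]
    gcongr
  have h4' := mul_le_mul_of_nonneg_right h4 (Real.sqrt_nonneg K)
  have h5 : B * √L * √((n : ℝ) + 1) ≤ √((B : ℝ) * T * L) := by
    refine Real.le_sqrt_of_sq_le ?_
    rw [mul_pow, mul_pow, Real.sq_sqrt hL.le, Real.sq_sqrt (by positivity)]
    have := mul_le_mul_of_nonneg_left hnB' (show 0 ≤ (B : ℝ) * L by positivity)
    nlinarith
  have h6 : √((B : ℝ) / N) * √K * √((n : ℝ) + 1) ≤ √((K : ℝ) * T / N) := by
    rw [← Real.sqrt_mul (by positivity), ← Real.sqrt_mul (by positivity)]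
    refine Real.sqrt_le_sqrt ?_
    rw [show (B : ℝ) / N * K * (n + 1) = K * ((n + 1) * B) / N by ring]
    gcongr
  have h7 : 0 ≤ g 0 * √K := mul_nonneg (invGamma_nonneg _ _ _) (Real.sqrt_nonneg _)
  nlinarith

/-- First regret bound in the adversarial environment. -/
theorem regret_adversarial (hs : Setting G W K T) {ℓ : Losses T N K}
    (hℓ : ∀ t i k, ℓ t i k ∈ Set.Icc (0 : ℝ) 1) :
    regret G W ℓ ≤ 76 * (√((blockLength W K T : ℝ) * T * Real.log K) + √((K : ℝ) * T / N)
        + blockLength W K T * Real.log K) := by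
  have : Nonempty (Fin N) := ⟨⟨0, hs.N_pos⟩⟩
  have : Nonempty (Fin K) := ⟨⟨0, hs.K_pos⟩⟩
  refine ciSup_le fun i => ?_
  obtain ⟨kstar, hk⟩ := exists_eq_ciInf_of_finite (f := fun k : Fin K => ∑ t, avgLoss ℓ t k)
  rw [← hk]
  refine (expectedLoss_sub_le hs hℓ i kstar).trans ?_
  have hB : (1 : ℝ) ≤ blockLength W K T := by exact_mod_cast hs.B_pos
  have hL := half_le_log hs.two_le_K
  have h0 := Real.sqrt_nonneg ((blockLength W K T : ℝ) * T * Real.log K)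
  have h1 := Real.sqrt_nonneg ((K : ℝ) * T / N)
  have h2 := sum_range_le_of_parity (M := T / blockLength W K T) (f := fun τ =>
    actionExp G W ℓ fun a => ∑ k, blockLoss W ℓ τ k *
        (refDist G W ℓ a τ k - (Pi.single kstar 1 : Fin K → ℝ) k))
    (show 0 ≤ 13 * √((blockLength W K T : ℝ) * T * Real.log K) + 38 * √((K : ℝ) * T / N)
        + blockLength W K T * Real.log K by positivity)
    (fun π hπ n hn => actionExp_regret_adversarial hs hℓ hπ hn kstar)
  -- The remainder 3 + B is at most 4B ≤ 8B log K. Doubling over the two parities gives 26, 76 and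
  -- 2, so 76 covers all terms.
  have h3 : (blockLength W K T : ℝ) * (1 / 2) ≤ blockLength W K T * Real.log K :=
    mul_le_mul_of_nonneg_left hL (by linarith)
  linarith

theorem one_le_log_six : (1 : ℝ) ≤ Real.log 6 := by
  have h1 := Real.log_two_gt_d9
  have h2 : Real.log 4 = 2 * Real.log 2 := by
    rw [show (4 : ℝ) = 2 ^ 2 by norm_num, Real.log_pow]
    norm_num
  have h3 : Real.log 4 ≤ Real.log 6 := Real.log_le_log (by norm_num) (by norm_num)
  linarith

theorem one_le_log_mul (hs : Setting G W K T) : 1 ≤ Real.log ((K : ℝ) * N * T) := by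
  refine one_le_log_six.trans (Real.log_le_log (by norm_num) ?_)
  have h1 := hs.six_le
  have h2 : (1 : ℝ) ≤ N := by exact_mod_cast hs.N_pos
  nlinarith

/-- The block length in terms of the spectral gap. -/
theorem blockLength_le (hs : Setting G W K T) :
    (blockLength W K T : ℝ) ≤ 31 * Real.log ((K : ℝ) * N * T) * (1 / √(spectralGap W)) := by
  have hKT := hs.six_le
  have hN : (1 : ℝ) ≤ N := by exact_mod_cast hs.N_pos
  have hΛ := one_le_log_mul hs
  set Λ := Real.log ((K : ℝ) * N * T) with hΛdef
  have hσ0 := sigma2_nonneg W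
  have hσ := hs.sigma2_lt
  have hr0 : 0 < √(spectralGap W) := Real.sqrt_pos.mpr (by unfold spectralGap; linarith)
  have hr1 : √(spectralGap W) ≤ 1 := Real.sqrt_le_one.mpr (by unfold spectralGap; linarith)
  -- 15/2 = 6 + (2 + 1)/2, where the fraction bounds the logarithm of √(14N).
  have h1 : Real.log (((K : ℝ) * T) ^ 6 * √(14 * N)) ≤ 15 / 2 * Λ := by
    rw [Real.log_mul (x := ((K : ℝ) * T) ^ 6) (by positivity) (by positivity), Real.log_pow,
      Real.log_sqrt (by positivity), Real.log_mul (x := 14) (by norm_num) (by positivity)]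
    have i1 : Real.log ((K : ℝ) * T) ≤ Λ := Real.log_le_log (by linarith) (by nlinarith)
    have i2 : Real.log N ≤ Λ := Real.log_le_log (by linarith) (by nlinarith)
    have i3 : Real.log 14 ≤ 2 * Λ := by
      have : 2 * Λ = Real.log (((K : ℝ) * N * T) ^ 2) := by
        rw [Real.log_pow]
        norm_num [hΛdef]
      rw [this]
      refine Real.log_le_log (by norm_num) ?_
      have : (6 : ℝ) ≤ K * N * T := by nlinarith
      nlinarith
    push_cast
    linarith
  have hc : 1 / 4 ≤ 1 - 1 / √(2 : ℝ) := by
    have h2 : 4 / 3 ≤ √(2 : ℝ) := Real.le_sqrt_of_sq_le (by norm_num)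
    have : 1 / √(2 : ℝ) ≤ 3 / 4 := by
      rw [div_le_iff₀ (by linarith)]
      linarith
    linarith
  have h2 : 0 ≤ Real.log (((K : ℝ) * T) ^ 6 * √(14 * N)) := by
    have i1 := log_pos_of_blockLength hs.N_pos hs.two_le_K (T := T) hs.T_pos
    have i2 : 0 ≤ Real.log ((K : ℝ) * T) := Real.log_nonneg (by linarith)
    linarith
  have h3 : (blockLength W K T : ℝ) ≤
      Real.log (((K : ℝ) * T) ^ 6 * √(14 * N)) / ((1 - 1 / √2) * √(1 - sigma2 W)) + 1 :=
    (Nat.ceil_lt_add_one (div_nonneg h2 (gossip_rate_pos hσ).le)).le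
  have h4 : Real.log (((K : ℝ) * T) ^ 6 * √(14 * N)) / ((1 - 1 / √2) * √(1 - sigma2 W))
      ≤ (15 / 2 * Λ) / (1 / 4 * √(spectralGap W)) := by
    refine div_le_div₀ (by linarith) h1 (by positivity) ?_
    exact mul_le_mul_of_nonneg_right hc (Real.sqrt_nonneg _)
  have h5 : (15 / 2 * Λ) / (1 / 4 * √(spectralGap W)) = 30 * Λ * (1 / √(spectralGap W)) := by
    field_simp
    norm_num
  -- The 1 lost in rounding up is absorbed, giving 31 = 30 + 1.
  have h6 : 1 ≤ Λ * (1 / √(spectralGap W)) := by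
    rw [mul_one_div, le_div_iff₀ hr0]
    linarith
  linarith

/-- Second regret bound in the adversarial environment. -/
theorem regret_adversarial_spectralGap (hs : Setting G W K T) {ℓ : Losses T N K}
    (hℓ : ∀ t i k, ℓ t i k ∈ Set.Icc (0 : ℝ) 1) :
    regret G W ℓ ≤ 2356 * Real.log ((K : ℝ) * N * T) ^ 2 *
      (√(1 / √(spectralGap W) * T) + √((K : ℝ) * T / N) + 1 / √(spectralGap W)) := by
  have h := regret_adversarial hs hℓ
  have hB := blockLength_le hs
  have hΛ := one_le_log_mul hs
  have hL : Real.log K ≤ Real.log ((K : ℝ) * N * T) := by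
    have hK : (0 : ℝ) < K := by exact_mod_cast hs.K_pos
    have hN : (1 : ℝ) ≤ N := by exact_mod_cast hs.N_pos
    have hT : (1 : ℝ) ≤ T := by exact_mod_cast hs.T_pos
    refine Real.log_le_log hK ?_
    have := mul_le_mul_of_nonneg_left (one_le_mul_of_one_le_of_one_le hN hT) hK.le
    linarith
  have hL0 := log_natCast_pos hs.two_le_K
  set Λ := Real.log ((K : ℝ) * N * T) with hΛdef
  set r := 1 / √(spectralGap W) with hr
  have hr0 : 0 ≤ r := by positivity
  have hBL : (blockLength W K T : ℝ) * Real.log K ≤ 31 * Λ ^ 2 * r := by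
    calc (blockLength W K T : ℝ) * Real.log K ≤ (31 * Λ * r) * Λ :=
          mul_le_mul hB hL hL0.le (by positivity)
      _ = _ := by ring
  have hΛ2 : Λ ≤ Λ ^ 2 := by nlinarith
  have h1 : √((blockLength W K T : ℝ) * T * Real.log K) ≤ 6 * Λ ^ 2 * √(r * T) := by
    have i1 : √((blockLength W K T : ℝ) * T * Real.log K) ≤ √((6 * Λ) ^ 2 * (r * T)) := by
      refine Real.sqrt_le_sqrt ?_
      have := mul_le_mul_of_nonneg_right hBL (Nat.cast_nonneg (α := ℝ) T)
      have i2 : 0 ≤ Λ ^ 2 * (r * T) := by positivity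
      nlinarith
    rw [Real.sqrt_mul (x := (6 * Λ) ^ 2) (by positivity), Real.sqrt_sq (by positivity)] at i1
    have i3 := mul_le_mul_of_nonneg_right hΛ2 (Real.sqrt_nonneg (r * T))
    linarith
  have h2 : √((K : ℝ) * T / N) ≤ Λ ^ 2 * √((K : ℝ) * T / N) :=
    le_mul_of_one_le_left (Real.sqrt_nonneg _) (by nlinarith)
  have i1 : 0 ≤ Λ ^ 2 * √(r * T) := by positivity
  have i2 : 0 ≤ Λ ^ 2 * √((K : ℝ) * T / N) := by positivity
  -- 2356 = 76·31; the factor 31 dominates 6 and 1 from the other two terms.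
  linarith

end Adversarial

/-! ### Self-bounding inequalities -/

/-- Fenchel-Young: the concave function a(-q log q + q) - bq is maximal at q = exp(-b/a), with value
a·exp(-b/a). -/
theorem entropy_term_le {a b q : ℝ} (ha : 0 < a) (hq : 0 ≤ q) :
    a * (-(q * Real.log q) + q) ≤ b * q + a * Real.exp (-(b / a)) := by
  rcases hq.eq_or_lt with rfl | hq
  · simp only [zero_mul, neg_zero, add_zero, mul_zero, zero_add]
    positivity
  · set y := Real.exp (-(b / a)) with hy
    have hy0 : 0 < y := Real.exp_pos _
    have h1 := Real.log_le_sub_one_of_pos (div_pos hy0 hq)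
    rw [Real.log_div hy0.ne' hq.ne', hy, Real.log_exp, ← hy] at h1
    have h2 := mul_le_mul_of_nonneg_left h1 hq.le
    have h3 : q * (y / q - 1) = y - q := by field_simp
    rw [h3] at h2
    have h4 := mul_le_mul_of_nonneg_left h2 ha.le
    have h5 : a * (q * (-(b / a) - Real.log q)) = -(b * q) - a * (q * Real.log q) := by
      field_simp
    rw [h5] at h4
    linarith

theorem sqrt_term_le {b c q : ℝ} (hb : 0 < b) (hq : 0 ≤ q) :
    c * √q ≤ b * q + c ^ 2 / (4 * b) := by
  have h1 := Real.sq_sqrt hq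
  have h2 : b * q + c ^ 2 / (4 * b) - c * √q = (2 * b * √q - c) ^ 2 / (4 * b) := by
    field_simp
    linear_combination (-4 * b ^ 2) * h1
  have h3 : 0 ≤ (2 * b * √q - c) ^ 2 / (4 * b) := by positivity
  linarith

/-- If x ≤ b nothing is needed; otherwise (x - b)α ≤ x - b ≤ x·exp(-b/x). The exponential form makes
the residue summable when x decays like 1/√s. -/
theorem linear_term_le {x b α : ℝ} (hx : 0 < x) (hα0 : 0 ≤ α) (hα1 : α ≤ 1) :
    x * α ≤ b * α + x * Real.exp (-(b / x)) := by
  have h1 := Real.add_one_le_exp (-(b / x))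
  have h2 := mul_le_mul_of_nonneg_left h1 hx.le
  have h3 : x * (-(b / x) + 1) = x - b := by field_simp; ring
  rw [h3] at h2
  have h4 : 0 ≤ x * Real.exp (-(b / x)) := by positivity
  nlinarith

/-- Discrete form of the integral of exp(-c√x)/√x, whose primitive is -(2/c)exp(-c√x). The bound
does not depend on `n`, so these residues produce no logarithm of the horizon. -/
theorem sum_inv_sqrt_mul_exp_le {c : ℝ} (hc : 0 < c) (n : ℕ) :
    ∑ s ∈ range n, 1 / √((s : ℝ) + 1) * Real.exp (-(c * √((s : ℝ) + 1))) ≤ 2 / c := by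
  have h : ∀ n : ℕ, ∑ s ∈ range n, 1 / √((s : ℝ) + 1) * Real.exp (-(c * √((s : ℝ) + 1))) ≤
      2 / c * (1 - Real.exp (-(c * √(n : ℝ)))) := by
    intro n
    induction n with
    | zero => simp
    | succ n ih =>
      rw [Finset.sum_range_succ, Nat.cast_add_one]
      have h1 := inv_two_sqrt_succ_le (Nat.cast_nonneg (α := ℝ) n)
      set u := √((n : ℝ) + 1) with hu
      set v := √(n : ℝ) with hv
      have hu0 : 0 < u := Real.sqrt_pos.mpr (by positivity)
      have h2 := Real.add_one_le_exp (c * (u - v))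
      have h3 : Real.exp (-(c * v)) = Real.exp (-(c * u)) * Real.exp (c * (u - v)) := by
        rw [← Real.exp_add]
        ring_nf
      have hE := Real.exp_pos (-(c * u))
      have h4 : Real.exp (-(c * u)) * (c * (1 / (2 * u)) + 1) ≤ Real.exp (-(c * v)) := by
        rw [h3]
        refine mul_le_mul_of_nonneg_left (le_trans ?_ h2) hE.le
        have := mul_le_mul_of_nonneg_left h1 hc.le
        linarith
      have h5 := mul_le_mul_of_nonneg_left h4 (show 0 ≤ 2 / c by positivity)
      have h6 : 2 / c * (Real.exp (-(c * u)) * (c * (1 / (2 * u)) + 1))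
          = 1 / u * Real.exp (-(c * u)) + 2 / c * Real.exp (-(c * u)) := by
        field_simp
      rw [h6] at h5
      rw [mul_sub] at ih ⊢
      linarith
  refine (h n).trans (mul_le_of_le_one_right (by positivity) ?_)
  linarith [Real.exp_pos (-(c * √(n : ℝ)))]

theorem sum_inv_le_one_add_log (n : ℕ) :
    ∑ s ∈ range n, 1 / ((s : ℝ) + 1) ≤ 1 + Real.log n := by
  have h := harmonic_le_one_add_log n
  simp only [harmonic, Rat.cast_sum, Rat.cast_inv, Rat.cast_add, Rat.cast_natCast,
    Nat.cast_add, Nat.cast_one, Rat.cast_one] at h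
  simpa only [one_div] using h

/-- The entropy term of `kstar` is at most 1 - q(kstar), which is the mass of the other arms; so the
entropy is controlled by these arms alone. -/
theorem entropy_le {K : ℕ} {q : Fin K → ℝ} (hq : q ∈ stdSimplex ℝ (Fin K)) (kstar : Fin K) :
    entropy q ≤ ∑ k ∈ univ.erase kstar, (-(q k * Real.log (q k)) + q k) := by
  have h1 := Finset.add_sum_erase univ q (mem_univ kstar)
  rw [hq.2] at h1
  unfold entropy
  rw [← Finset.add_sum_erase univ _ (mem_univ kstar), Finset.sum_add_distrib,
    Finset.sum_neg_distrib]
  have h2 : -(q kstar * Real.log (q kstar)) ≤ 1 - q kstar := by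
    rcases (hq.1 kstar).eq_or_lt with h | h
    · rw [← h]
      simp
    · have h3 := Real.one_sub_inv_le_log_of_pos h
      have h4 := mul_le_mul_of_nonneg_left h3 h.le
      rw [mul_sub, mul_inv_cancel₀ h.ne'] at h4
      linarith
  linarith

section SelfBound

variable {T N K : ℕ} {G : SimpleGraph (Fin N)} {W : Matrix (Fin N) (Fin N) ℝ}

/-- The mean of the reference process for fixed losses. -/
def meanDist (G : SimpleGraph (Fin N)) (W : Matrix (Fin N) (Fin N) ℝ) (ℓ : Losses T N K) (τ : ℕ)
    (k : Fin K) : ℝ := actionExp G W ℓ fun a => refDist G W ℓ a τ k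

/-- As the probabilities sum to 1, losses may be measured relative to `kstar`, whose own term then
vanishes. -/
theorem actionExp_blockLoss_mul (hs : Setting G W K T) (ℓ : Losses T N K) (τ : ℕ) (kstar : Fin K) :
    actionExp G W ℓ (fun a => ∑ k, blockLoss W ℓ τ k *
      (refDist G W ℓ a τ k - (Pi.single kstar 1 : Fin K → ℝ) k))
      = ∑ k ∈ univ.erase kstar, meanDist G W ℓ τ k *
          (blockLoss W ℓ τ k - blockLoss W ℓ τ kstar) := by
  have e : ∀ a, ∑ k, blockLoss W ℓ τ k *
      (refDist G W ℓ a τ k - (Pi.single kstar 1 : Fin K → ℝ) k)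
      = ∑ k ∈ univ.erase kstar, refDist G W ℓ a τ k *
          (blockLoss W ℓ τ k - blockLoss W ℓ τ kstar) := by
    intro a
    have h1 := Finset.add_sum_erase univ (refDist G W ℓ a τ) (mem_univ kstar)
    rw [(refDist_mem hs ℓ a τ).2] at h1
    have h2 : ∑ k, blockLoss W ℓ τ k * (Pi.single kstar 1 : Fin K → ℝ) k
        = blockLoss W ℓ τ kstar := by
      simp [Pi.single_apply]
    simp only [mul_sub, Finset.sum_sub_distrib, ← Finset.sum_mul]
    rw [h2, ← Finset.add_sum_erase univ _ (mem_univ kstar),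
      show ∑ k ∈ univ.erase kstar, refDist G W ℓ a τ k = 1 - refDist G W ℓ a τ kstar by linarith]
    simp only [mul_comm (refDist _ _ _ _ _ _)]
    ring
  simp only [e]
  rw [actionExp_sum]
  exact Finset.sum_congr rfl fun k _ => actionExp_mul_const _ _ _

theorem invEta_succ_sub_le {B : ℕ} (hK : 2 ≤ K) (s : ℕ) :
    invEta K B (s + 1) - invEta K B s ≤
      B / √(Real.log K) * (1 / √((s : ℝ) + 1)) := by
  have hL := log_natCast_pos hK
  set L := Real.log K with hLdef
  have hL' := Real.sqrt_pos.mpr hL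
  have h0 : 0 ≤ (B : ℝ) / √L * (1 / √((s : ℝ) + 1)) := by positivity
  have e : ∀ m : ℕ, (B : ℝ) * √((m : ℝ) / L) = B / √L * √(m : ℝ) := by
    intro m
    rw [Real.sqrt_div (Nat.cast_nonneg m)]
    ring
  unfold invEta
  rw [← hLdef, show max (s + 1) 1 = s + 1 by omega, sub_le_iff_le_add]
  refine max_le ?_ ?_
  · have := le_max_left (B : ℝ) (B * √((max s 1 : ℕ) / L))
    linarith
  · have h1 : (B : ℝ) / √L * √(s : ℝ) ≤ B / √L * √((max s 1 : ℕ) : ℝ) := by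
      have : ((s : ℕ) : ℝ) ≤ (max s 1 : ℕ) := by exact_mod_cast le_max_left s 1
      gcongr
    have h2 := le_max_right (B : ℝ) (B * √((max s 1 : ℕ) / L))
    rw [e] at h2
    rw [e, Nat.cast_add_one]
    have h3 := mul_le_mul_of_nonneg_left (sqrt_succ_sub_sqrt_le (Nat.cast_nonneg (α := ℝ) s))
      (show 0 ≤ (B : ℝ) / √L by positivity)
    rw [e]
    rw [mul_sub] at h3
    linarith

theorem invGamma_succ_sub_le (N B s : ℕ) :
    invGamma N B (s + 1) - invGamma N B s ≤ √((B : ℝ) / N) * (1 / √((s : ℝ) + 1)) := by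
  have e : ∀ m : ℕ, √((m : ℝ) * B / N) = √((B : ℝ) / N) * √(m : ℝ) := by
    intro m
    rw [← Real.sqrt_mul (by positivity)]
    congr 1
    ring
  unfold invGamma
  rw [e, e, show max (s + 1) 1 = s + 1 by omega, Nat.cast_add_one, ← mul_sub]
  refine mul_le_mul_of_nonneg_left ?_ (Real.sqrt_nonneg _)
  have h1 : √(s : ℝ) ≤ √((max s 1 : ℕ) : ℝ) := by
    have : ((s : ℕ) : ℝ) ≤ (max s 1 : ℕ) := by exact_mod_cast le_max_left s 1
    gcongr
  have h2 := sqrt_succ_sub_sqrt_le (Nat.cast_nonneg (α := ℝ) s)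
  linarith

/-- Determines when the rate has decreased enough for the shifted estimate; it is used with x = 32.
-/
theorem invEta_ge_of_le {K B s : ℕ} {x : ℝ} (hK : 2 ≤ K)
    (hs : x ^ 2 * Real.log K ≤ s) : x * B ≤ invEta K B s := by
  have hL := log_natCast_pos hK
  have h1 : x ≤ √((max s 1 : ℕ) / Real.log K) := by
    refine Real.le_sqrt_of_sq_le ?_
    rw [le_div_iff₀ hL]
    refine hs.trans ?_
    exact_mod_cast le_max_left s 1
  have h2 := le_max_right (B : ℝ) (B * √((max s 1 : ℕ) / Real.log K))
  have h3 := mul_le_mul_of_nonneg_left h1 (Nat.cast_nonneg (α := ℝ) B)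
  unfold invEta
  linarith

theorem log_le_blockLength' (hs : Setting G W K T) : Real.log K ≤ blockLength W K T := by
  have h1 := log_le_blockLength hs.N_pos hs.two_le_K (T := T) hs.T_pos hs.sigma2_lt
  have hK : (0 : ℝ) < K := by exact_mod_cast hs.K_pos
  have hT : (1 : ℝ) ≤ T := by exact_mod_cast hs.T_pos
  have h2 : Real.log K ≤ Real.log ((K : ℝ) * T) :=
    Real.log_le_log hK (le_mul_of_one_le_right hK.le hT)
  have h3 := log_natCast_pos hs.two_le_K
  linarith

open Classical in
/-- Regret of the reference process along the blocks of one parity for fixed losses, with the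
terms that do not come from fluctuations of the losses already absorbed. -/
theorem actionExp_regret_self_bound (hs : Setting G W K T) {ℓ : Losses T N K}
    (hℓ : ∀ t i k, ℓ t i k ∈ Set.Icc (0 : ℝ) 1) {π : ℕ} (hπ : π < 2) {n : ℕ}
    (hn : (2 * n + π) * blockLength W K T ≤ T) (kstar : Fin K) {δ : Fin K → ℝ}
    (hδ : ∀ k, k ≠ kstar → 0 < δ k) :
    ∑ s ∈ range (n + 1), ∑ k ∈ univ.erase kstar, meanDist G W ℓ (2 * s + π) k *
        (blockLoss W ℓ (2 * s + π) k - blockLoss W ℓ (2 * s + π) kstar) ≤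
      (2 * blockLength W K T * Real.log K + 4 * blockLength W K T + 14 * blockLength W K T * √K)
      + ∑ s ∈ range n, ((if 1024 * Real.log K ≤ ((s + 1 : ℕ) : ℝ) then
            4 / invEta K (blockLength W K T) (s + 1) * ∑ k ∈ univ.erase kstar,
              meanDist G W ℓ (2 * (s + 1) + π) k *
              (blockLoss W ℓ (2 * (s + 1) + π) k - blockLoss W ℓ (2 * (s + 1) + π) kstar) ^ 2
            else 16 * blockLength W K T)
          + ∑ k ∈ univ.erase kstar,
            (blockLength W K T * δ k / 4 * meanDist G W ℓ (2 * (s + 1) + π) k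
              + 19208 / (N * δ k) * (1 / ((s : ℝ) + 1))
              + blockLength W K T / √(Real.log K) * (1 / √((s : ℝ) + 1) *
                  Real.exp (-(δ k * √(Real.log K) / 8 * √((s : ℝ) + 1)))))) := by
  set B := blockLength W K T with hB
  have hB0 : 0 < B := hs.B_pos
  have hB1 : (1 : ℝ) ≤ B := by exact_mod_cast hB0
  have hN1 : (1 : ℝ) ≤ N := by exact_mod_cast hs.N_pos
  have hL := log_natCast_pos hs.two_le_K
  have hL2 := half_le_log hs.two_le_K
  set L := Real.log K with hLdef
  have hLs := Real.sqrt_pos.mpr hL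
  -- 1024 = 32², so late blocks satisfy β ≥ 32B. The shift needs only 12B; the larger value later
  -- absorbs the squared gap in `late_term_le`.
  set late : ℕ → Prop := fun s => 1024 * L ≤ (s : ℝ) with hlatedef
  have hlate : ∀ s, late s → 12 * (B : ℝ) ≤ invEta K B s := by
    intro s h
    have := invEta_ge_of_le (B := B) (x := 32) hs.two_le_K
      (s := s) (by norm_num; exact h)
    linarith
  have h := actionExp_regret_le hs hℓ hπ hn late hlate kstar
  simp only [actionExp_blockLoss_mul hs] at h
  refine h.trans ?_
  set g := invGamma N B with hg
  set β := invEta K B with hβ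
  have hBN : √((B : ℝ) / N) ≤ B := by
    refine Real.sqrt_le_iff.mpr ⟨by linarith, ?_⟩
    have : (B : ℝ) / N ≤ B := div_le_self (by linarith) hN1
    nlinarith
  have hB' : ∀ s, (B : ℝ) ^ 2 / β s ≤ B := by
    intro s
    have h1 : (B : ℝ) ≤ β s := le_invEta K B s
    rw [div_le_iff₀ (by linarith)]
    nlinarith
  have hw : ∀ (x : ℝ) (s : ℕ), x * (B : ℝ) / (N * g s)
      = x * (√(B / N) * (1 / √((max s 1 : ℕ) : ℝ))) := by
    intro x s
    rw [← div_mul_invGamma hs.N_pos hB0 s]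
    ring
  have hmean : ∀ s k, (actionExp G W ℓ fun a => refDist G W ℓ a (2 * s + π) k)
      = meanDist G W ℓ (2 * s + π) k := fun _ _ => rfl
  -- The penalty of index `s` is evaluated at the distribution of index `s + 1`, so it is paired
  -- with the stability term of that block and block 0 is split off.
  rw [Finset.sum_range_succ' _ n]
  -- the first block
  have hnl : ¬ late 0 := by
    simp only [hlatedef]
    push_cast
    linarith
  have h0 : 4 * (B : ℝ) ^ 2 / β 0 + 12 * B / (N * g 0) *
      actionExp G W ℓ (fun a => ∑ k, √(refDist G W ℓ a (2 * 0 + π) k)) ≤ 4 * B + 12 * B * √K := by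
    have h1 := actionExp_mono hs ℓ fun a => sum_sqrt_le (refDist_mem hs ℓ a (2 * 0 + π))
    rw [actionExp_const hs] at h1
    have h2 : 12 * (B : ℝ) / (N * g 0) ≤ 12 * B := by
      rw [hw]
      simp only [Nat.zero_le, sup_of_le_right, Nat.cast_one, Real.sqrt_one]
      linarith
    have h3 := hB' 0
    have h4 : 12 * (B : ℝ) / (N * g 0) *
        actionExp G W ℓ (fun a => ∑ k, √(refDist G W ℓ a (2 * 0 + π) k)) ≤ 12 * B * √K := by
      refine mul_le_mul h2 h1 ?_ (by positivity)
      have := actionExp_mono hs ℓ (f := fun _ => 0) fun a =>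
        Finset.sum_nonneg fun k (_ : k ∈ univ) => Real.sqrt_nonneg (refDist G W ℓ a (2 * 0 + π) k)
      rwa [actionExp_const hs] at this
    rw [mul_div_assoc]
    linarith
  have h0' : β 0 * L + 2 * g 0 * √K ≤ 2 * B * L + 2 * B * √K := by
    have i1 : β 0 ≤ 2 * B := by
      refine max_le (by linarith) ?_
      have : √((max 0 1 : ℕ) / L) ≤ 2 := by
        refine Real.sqrt_le_iff.mpr ⟨by norm_num, ?_⟩
        rw [div_le_iff₀ hL]
        push_cast
        simp only [zero_le_one, sup_of_le_right]
        linarith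
      nlinarith
    have i2 : g 0 ≤ B := by
      refine le_trans (le_of_eq ?_) hBN
      simp [hg, invGamma]
    have i3 := mul_le_mul_of_nonneg_right i1 hL.le
    have i4 := mul_le_mul_of_nonneg_right i2 (Real.sqrt_nonneg K)
    linarith
  simp only [if_neg hnl]
  -- the later blocks
  have hstep : ∀ s ∈ range n,
      (if late (s + 1) then
          4 / β (s + 1) * ∑ k ∈ univ.erase kstar,
            (actionExp G W ℓ fun a => refDist G W ℓ a (2 * (s + 1) + π) k) *
            (blockLoss W ℓ (2 * (s + 1) + π) k - blockLoss W ℓ (2 * (s + 1) + π) kstar) ^ 2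
          + 96 * B / (N * g (s + 1)) *
            ∑ k ∈ univ.erase kstar, actionExp G W ℓ fun a => √(refDist G W ℓ a (2 * (s + 1) + π) k)
        else 4 * (B : ℝ) ^ 2 / β (s + 1)
          + 12 * B / (N * g (s + 1)) *
            actionExp G W ℓ fun a => ∑ k, √(refDist G W ℓ a (2 * (s + 1) + π) k))
      + actionExp G W ℓ (fun a => (β (s + 1) - β s)
              * entropy (refDist G W ℓ a (2 * (s + 1) + π))
            + 2 * (g (s + 1) - g s)
              * (∑ k, √(refDist G W ℓ a (2 * (s + 1) + π) k) - 1)) ≤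
      (if late (s + 1) then
            4 / β (s + 1) * ∑ k ∈ univ.erase kstar,
              meanDist G W ℓ (2 * (s + 1) + π) k *
              (blockLoss W ℓ (2 * (s + 1) + π) k - blockLoss W ℓ (2 * (s + 1) + π) kstar) ^ 2
            else 16 * (B : ℝ))
          + ∑ k ∈ univ.erase kstar,
            (B * δ k / 4 * meanDist G W ℓ (2 * (s + 1) + π) k
              + 19208 / (N * δ k) * (1 / ((s : ℝ) + 1))
              + B / √L * (1 / √((s : ℝ) + 1) *
                  Real.exp (-(δ k * √L / 8 * √((s : ℝ) + 1))))) := by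
    intro s _
    set τ := 2 * (s + 1) + π with hτ
    have hs1 : (0 : ℝ) < (s : ℝ) + 1 := by positivity
    have hs1' := Real.sqrt_pos.mpr hs1
    have hmax : ((max (s + 1) 1 : ℕ) : ℝ) = (s : ℝ) + 1 := by
      rw [show max (s + 1) 1 = s + 1 by omega, Nat.cast_add_one]
    set w := √((B : ℝ) / N) * (1 / √((s : ℝ) + 1)) with hwdef
    have hw0 : 0 ≤ w := by positivity
    have hwB : w ≤ B := by
      have : 1 / √((s : ℝ) + 1) ≤ 1 := by
        rw [div_le_one hs1']
        exact Real.one_le_sqrt.mpr (by linarith [Nat.cast_nonneg (α := ℝ) s])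
      calc w ≤ B * 1 := mul_le_mul hBN this (by positivity) (by linarith)
        _ = B := mul_one _
    have hwN : ∀ x : ℝ, x * (B : ℝ) / (N * g (s + 1)) = x * w := by
      intro x
      rw [hw, hmax]
    set Q : Fin K → ℝ := fun k => actionExp G W ℓ fun a => √(refDist G W ℓ a τ k) with hQ
    have hQ0 : ∀ k, 0 ≤ Q k := by
      intro k
      have := actionExp_mono hs ℓ (f := fun _ => 0) fun a => Real.sqrt_nonneg (refDist G W ℓ a τ k)
      rwa [actionExp_const hs] at this
    have hQs : 0 ≤ w * ∑ k ∈ univ.erase kstar, Q k :=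
      mul_nonneg hw0 (Finset.sum_nonneg fun k _ => hQ0 k)
    -- stability
    have hst : (if late (s + 1) then
          4 / β (s + 1) * ∑ k ∈ univ.erase kstar,
            (actionExp G W ℓ fun a => refDist G W ℓ a τ k) *
            (blockLoss W ℓ τ k - blockLoss W ℓ τ kstar) ^ 2
          + 96 * B / (N * g (s + 1)) * ∑ k ∈ univ.erase kstar, Q k
        else 4 * (B : ℝ) ^ 2 / β (s + 1)
          + 12 * B / (N * g (s + 1)) *
            actionExp G W ℓ fun a => ∑ k, √(refDist G W ℓ a τ k)) ≤
        (if late (s + 1) then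
            4 / β (s + 1) * ∑ k ∈ univ.erase kstar, meanDist G W ℓ τ k *
              (blockLoss W ℓ τ k - blockLoss W ℓ τ kstar) ^ 2
            else 16 * (B : ℝ)) + 96 * w * ∑ k ∈ univ.erase kstar, Q k := by
      -- For an early block, 16B = 4B + 12B: the mean part, and the noise with √q(kstar) ≤ 1. The
      -- noise of the other arms fits under the coefficient 96.
      split_ifs with hl
      · rw [hwN]
        exact le_rfl
      · rw [hwN]
        have i1 : actionExp G W ℓ (fun a => ∑ k, √(refDist G W ℓ a τ k))
            ≤ 1 + ∑ k ∈ univ.erase kstar, Q k := by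
          rw [actionExp_sum, ← Finset.add_sum_erase univ _ (mem_univ kstar)]
          refine add_le_add ?_ le_rfl
          have := actionExp_mono hs ℓ fun a => Real.sqrt_le_one.mpr
            (le_one_of_mem_stdSimplex (refDist_mem hs ℓ a τ) kstar)
          rwa [actionExp_const hs] at this
        have i2 := mul_le_mul_of_nonneg_left i1 (show 0 ≤ 12 * w by positivity)
        have i3 := hB' (s + 1)
        rw [mul_div_assoc]
        nlinarith
    -- penalty, pointwise in the actions
    have hpt : ∀ a, (β (s + 1) - β s) * entropy (refDist G W ℓ a τ)
            + 2 * (g (s + 1) - g s) * (∑ k, √(refDist G W ℓ a τ k) - 1)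
          + 96 * w * ∑ k ∈ univ.erase kstar, √(refDist G W ℓ a τ k) ≤
        ∑ k ∈ univ.erase kstar, (B * δ k / 4 * refDist G W ℓ a τ k
              + 19208 / (N * δ k) * (1 / ((s : ℝ) + 1))
              + B / √L * (1 / √((s : ℝ) + 1) *
                  Real.exp (-(δ k * √L / 8 * √((s : ℝ) + 1))))) := by
      intro a
      have hq := refDist_mem hs ℓ a τ
      set q := refDist G W ℓ a τ with hqdef
      set A := B / √L * (1 / √((s : ℝ) + 1)) with hA
      have hA0 : 0 < A := by positivity
      have j1 : (β (s + 1) - β s) * entropy q ≤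
          A * ∑ k ∈ univ.erase kstar, (-(q k * Real.log (q k)) + q k) := by
        have k1 : 0 ≤ ∑ k ∈ univ.erase kstar, (-(q k * Real.log (q k)) + q k) := by
          refine Finset.sum_nonneg fun k _ => ?_
          have := Real.mul_log_nonpos (hq.1 k) (le_one_of_mem_stdSimplex hq k)
          linarith [hq.1 k]
        have k2 : 0 ≤ β (s + 1) - β s := sub_nonneg.mpr (invEta_mono K B (Nat.le_succ s))
        exact (mul_le_mul_of_nonneg_left (entropy_le hq kstar) k2).trans
          (mul_le_mul_of_nonneg_right (invEta_succ_sub_le hs.two_le_K s) k1)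
      have j2 : 2 * (g (s + 1) - g s) * (∑ k, √(q k) - 1) ≤
          2 * w * ∑ k ∈ univ.erase kstar, √(q k) := by
        have k0 : 0 ≤ ∑ k ∈ univ.erase kstar, √(q k) :=
          Finset.sum_nonneg fun k _ => Real.sqrt_nonneg _
        have k1 : ∑ k, √(q k) - 1 ≤ ∑ k ∈ univ.erase kstar, √(q k) := by
          rw [← Finset.add_sum_erase univ _ (mem_univ kstar)]
          have := Real.sqrt_le_one.mpr (le_one_of_mem_stdSimplex hq kstar)
          linarith
        have k2 : 0 ≤ g (s + 1) - g s := sub_nonneg.mpr (invGamma_mono N B (Nat.le_succ s))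
        have k3 : g (s + 1) - g s ≤ w := invGamma_succ_sub_le N B s
        calc 2 * (g (s + 1) - g s) * (∑ k, √(q k) - 1)
            ≤ 2 * (g (s + 1) - g s) * ∑ k ∈ univ.erase kstar, √(q k) :=
              mul_le_mul_of_nonneg_left k1 (by positivity)
          _ ≤ _ := mul_le_mul_of_nonneg_right (by linarith) k0
      have j3 : A * ∑ k ∈ univ.erase kstar, (-(q k * Real.log (q k)) + q k)
          + 98 * w * ∑ k ∈ univ.erase kstar, √(q k) ≤
          ∑ k ∈ univ.erase kstar, (B * δ k / 4 * q k
              + 19208 / (N * δ k) * (1 / ((s : ℝ) + 1))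
              + B / √L * (1 / √((s : ℝ) + 1) *
                  Real.exp (-(δ k * √L / 8 * √((s : ℝ) + 1))))) := by
        rw [Finset.mul_sum, Finset.mul_sum, ← Finset.sum_add_distrib]
        refine Finset.sum_le_sum fun k hk => ?_
        have hδk := hδ k (Finset.ne_of_mem_erase hk)
        -- The entropy and the square root terms each receive half of the budget Bδ/4. The
        -- coefficient 98 collects 96 from stability and 2 from the penalty, and 98²·8/4 = 19208.
        have hb : 0 < B * δ k / 8 := by positivity
        have k1 := entropy_term_le (b := B * δ k / 8) hA0 (hq.1 k)
        have k2 := sqrt_term_le (c := 98 * w) hb (hq.1 k)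
        have k3 : B * δ k / 8 / A = δ k * √L / 8 * √((s : ℝ) + 1) := by
          rw [hA]
          field_simp
        have k4 : (98 * w) ^ 2 / (4 * (B * δ k / 8)) = 19208 / (N * δ k) * (1 / ((s : ℝ) + 1)) := by
          rw [hwdef, mul_pow, mul_pow, div_pow, Real.sq_sqrt (by positivity), Real.sq_sqrt hs1.le]
          field_simp
          norm_num
        rw [k3] at k1
        rw [k4] at k2
        have k5 : A * Real.exp (-(δ k * √L / 8 * √((s : ℝ) + 1)))
            = B / √L * (1 / √((s : ℝ) + 1) *
                Real.exp (-(δ k * √L / 8 * √((s : ℝ) + 1)))) := by rw [hA]; ring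
        rw [k5] at k1
        linarith
      linarith
    have hE := actionExp_mono hs ℓ hpt
    rw [actionExp_add, actionExp_const_mul, actionExp_sum] at hE
    have hR : actionExp G W ℓ (fun a => ∑ k ∈ univ.erase kstar, (B * δ k / 4 * refDist G W ℓ a τ k
              + 19208 / (N * δ k) * (1 / ((s : ℝ) + 1))
              + B / √L * (1 / √((s : ℝ) + 1) *
                  Real.exp (-(δ k * √L / 8 * √((s : ℝ) + 1))))))
        = ∑ k ∈ univ.erase kstar, (B * δ k / 4 * meanDist G W ℓ τ k
              + 19208 / (N * δ k) * (1 / ((s : ℝ) + 1))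
              + B / √L * (1 / √((s : ℝ) + 1) *
                  Real.exp (-(δ k * √L / 8 * √((s : ℝ) + 1))))) := by
      rw [actionExp_sum]
      refine Finset.sum_congr rfl fun k _ => ?_
      rw [actionExp_add, actionExp_add, actionExp_const_mul, actionExp_const hs,
        actionExp_const hs, hmean]
    rw [hR] at hE
    linarith
  have hsum := Finset.sum_le_sum hstep
  rw [Finset.sum_add_distrib] at hsum
  linarith

end SelfBound

/-! ### Measurability -/

/-- The minimizer is obtained by choice, so its measurability comes from Lipschitz continuity. -/
theorem measurable_ftrl (N : ℕ) {K B : ℕ} (hK : 2 ≤ K) (hB : 0 < B) (s : ℕ) :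
    Measurable (ftrl N K B s) := by
  have hL : LipschitzWith (2 * K / B) (ftrl N K B s) := by
    refine LipschitzWith.of_dist_le_mul fun Z Z' => ?_
    rw [dist_pi_le_iff (by positivity)]
    intro k
    have := ftrl_lipschitz N hK hB s (Z := Z) (Z' := Z') (fun k => dist_le_pi_dist Z Z' k) k
    rw [Real.dist_eq]
    refine this.trans (le_of_eq ?_)
    push_cast
    ring
  exact hL.continuous.measurable

theorem measurable_gossipSeq {N K : ℕ} (G : SimpleGraph (Fin N)) (W : Matrix (Fin N) (Fin N) ℝ) :
    ∀ n, Measurable fun x : Fin N → Fin K → ℝ => gossipSeq G W x n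
  | 0 => measurable_id
  | 1 => measurable_id
  | n + 2 => by
    have h1 : ∀ i k, Measurable fun x : Fin N → Fin K → ℝ => gossipSeq G W x (n + 1) i k :=
      fun i k => (measurable_pi_apply k).comp
        ((measurable_pi_apply i).comp (measurable_gossipSeq G W (n + 1)))
    have h0 : ∀ i k, Measurable fun x : Fin N → Fin K → ℝ => gossipSeq G W x n i k :=
      fun i k => (measurable_pi_apply k).comp
        ((measurable_pi_apply i).comp (measurable_gossipSeq G W n))
    refine measurable_pi_lambda _ fun i => measurable_pi_lambda _ fun k => ?_
    simp only [gossipSeq, neighborAverage]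
    exact ((Finset.measurable_sum _ fun j _ => (h1 j k).const_mul _).const_mul _).sub
      ((h0 i k).const_mul _)

section Measurability

variable {T N K : ℕ} {G : SimpleGraph (Fin N)} {W : Matrix (Fin N) (Fin N) ℝ}

theorem measurable_loss (t : Fin T) (i : Fin N) (k : Fin K) :
    Measurable fun ℓ : Losses T N K => ℓ t i k :=
  (measurable_pi_apply k).comp ((measurable_pi_apply i).comp (measurable_pi_apply t))

theorem measurable_mixUniform {K : ℕ} (T : ℕ) : Measurable (mixUniform T : (Fin K → ℝ) → _) :=
  measurable_pi_lambda _ fun k => ((measurable_pi_apply k).const_mul _).add_const _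

theorem measurable_blockEstimate (B τ : ℕ) {p : Losses T N K → Fin N → Fin K → ℝ}
    (hp : Measurable p) (a : Actions T N K) (i : Fin N) (k : Fin K) :
    Measurable fun ℓ => blockEstimate B τ (p ℓ) ℓ a i k := by
  unfold blockEstimate
  refine Finset.measurable_sum _ fun t _ => ?_
  split_ifs
  · exact (measurable_loss t i k).div
      ((measurable_pi_apply k).comp ((measurable_pi_apply i).comp hp))
  · exact measurable_const

theorem measurable_feedbackSum (hs : Setting G W K T) (a : Actions T N K) :
    ∀ τ, Measurable fun ℓ => feedbackSum G W ℓ a τ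
  | 0 => measurable_const
  | 1 => measurable_const
  | τ + 2 => by
    have ih := measurable_feedbackSum hs a τ
    have hp : Measurable fun ℓ j => mixUniform T
        (ftrl N K (blockLength W K T) (τ / 2) (feedbackSum G W ℓ a τ j)) :=
      measurable_pi_lambda _ fun j => (measurable_mixUniform T).comp
        ((measurable_ftrl N hs.two_le_K hs.B_pos _).comp ((measurable_pi_apply j).comp ih))
    have hg : Measurable fun ℓ => gossip G W (blockLength W K T)
        (blockEstimate (blockLength W K T) τ (fun j => mixUniform T
          (ftrl N K (blockLength W K T) (τ / 2) (feedbackSum G W ℓ a τ j))) ℓ a) :=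
      (measurable_gossipSeq G W _).comp (measurable_pi_lambda _ fun i =>
        measurable_pi_lambda _ fun k => measurable_blockEstimate _ _ hp a i k)
    exact measurable_pi_lambda _ fun i => measurable_pi_lambda _ fun k =>
      ((measurable_pi_apply k).comp ((measurable_pi_apply i).comp ih)).add
        ((measurable_pi_apply k).comp ((measurable_pi_apply i).comp hg))

theorem measurable_policy (hs : Setting G W K T) (a : Actions T N K) (τ : ℕ) :
    Measurable fun ℓ => policy G W ℓ a τ :=
  measurable_pi_lambda _ fun i => (measurable_mixUniform T).comp
    ((measurable_ftrl N hs.two_le_K hs.B_pos _).comp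
      ((measurable_pi_apply i).comp (measurable_feedbackSum hs a τ)))

theorem measurable_refSum (hs : Setting G W K T) (a : Actions T N K) :
    ∀ τ, Measurable fun ℓ => refSum G W ℓ a τ
  | 0 => measurable_const
  | 1 => measurable_const
  | τ + 2 => by
    refine measurable_pi_lambda _ fun k =>
      ((measurable_pi_apply k).comp (measurable_refSum hs a τ)).add ?_
    unfold refEst
    exact (Finset.measurable_sum _ fun j _ =>
      measurable_blockEstimate _ _ (measurable_policy hs a τ) a j k).const_mul _

theorem measurable_refDist (hs : Setting G W K T) (a : Actions T N K) (τ : ℕ) :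
    Measurable fun ℓ => refDist G W ℓ a τ :=
  (measurable_ftrl N hs.two_le_K hs.B_pos _).comp (measurable_refSum hs a τ)

theorem measurable_actionProb (hs : Setting G W K T) (a : Actions T N K) :
    Measurable fun ℓ => actionProb G W ℓ a :=
  Finset.measurable_prod _ fun _ _ => Finset.measurable_prod _ fun i _ =>
    (measurable_pi_apply _).comp ((measurable_pi_apply i).comp (measurable_policy hs a _))

theorem measurable_actionExp (hs : Setting G W K T) {f : Losses T N K → Actions T N K → ℝ}
    (hf : ∀ a, Measurable fun ℓ => f ℓ a) : Measurable fun ℓ => actionExp G W ℓ (f ℓ) :=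
  Finset.measurable_sum _ fun a _ => (measurable_actionProb hs a).mul (hf a)

theorem measurable_meanDist (hs : Setting G W K T) (τ : ℕ) (k : Fin K) :
    Measurable fun ℓ : Losses T N K => meanDist G W ℓ τ k :=
  measurable_actionExp hs fun a => (measurable_pi_apply k).comp (measurable_refDist hs a τ)

theorem measurable_avgLoss (t : Fin T) (k : Fin K) :
    Measurable fun ℓ : Losses T N K => avgLoss ℓ t k :=
  (Finset.measurable_sum _ fun i _ => measurable_loss t i k).const_mul _

theorem measurable_blockLoss (τ : ℕ) (k : Fin K) :
    Measurable fun ℓ : Losses T N K => blockLoss W ℓ τ k :=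
  Finset.measurable_sum _ fun t _ => measurable_avgLoss t k

theorem measurable_expectedLoss (hs : Setting G W K T) (i : Fin N) :
    Measurable fun ℓ : Losses T N K => expectedLoss G W ℓ i :=
  measurable_actionExp hs fun _ => Finset.measurable_sum _ fun t _ => measurable_avgLoss t _

theorem meanDist_mem_Icc (hs : Setting G W K T) (ℓ : Losses T N K) (τ : ℕ) (k : Fin K) :
    meanDist G W ℓ τ k ∈ Set.Icc (0 : ℝ) 1 := by
  constructor
  · rw [← actionExp_const (G := G) (W := W) hs ℓ 0]
    exact actionExp_mono hs ℓ fun a => (refDist_mem hs ℓ a τ).1 k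
  · rw [← actionExp_const (G := G) (W := W) hs ℓ 1]
    exact actionExp_mono hs ℓ fun a => le_one_of_mem_stdSimplex (refDist_mem hs ℓ a τ) k

theorem expectedLoss_mem_Icc (hs : Setting G W K T) {ℓ : Losses T N K}
    (hℓ : ∀ t i k, ℓ t i k ∈ Set.Icc (0 : ℝ) 1) (i : Fin N) :
    expectedLoss G W ℓ i ∈ Set.Icc (0 : ℝ) T := by
  change actionExp G W ℓ (fun a => ∑ t, avgLoss ℓ t (a t i)) ∈ _
  constructor
  · rw [← actionExp_const (G := G) (W := W) hs ℓ 0]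
    exact actionExp_mono hs ℓ fun a =>
      Finset.sum_nonneg fun t _ => (avgLoss_mem_Icc hs.N_pos hℓ t _).1
  · rw [← actionExp_const (G := G) (W := W) hs ℓ T]
    refine actionExp_mono hs ℓ fun a => ?_
    refine (Finset.sum_le_card_nsmul _ _ 1
      fun t _ => (avgLoss_mem_Icc hs.N_pos hℓ t _).2).trans ?_
    simp

/-- The mean reference distribution of a block is determined by the losses of earlier blocks. -/
theorem meanDist_congr (hs : Setting G W K T) {ℓ ℓ' : Losses T N K} {τ : ℕ}
    (h : ∀ t : Fin T, (t : ℕ) / blockLength W K T < τ → ℓ t = ℓ' t) (k : Fin K) :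
    meanDist G W ℓ τ k = meanDist G W ℓ' τ k := by
  have : Nonempty (Fin K) := ⟨⟨0, hs.K_pos⟩⟩
  unfold meanDist
  -- The full action probability involves policies of later blocks, hence later losses. Replacing
  -- those rules by uniform sampling removes this dependence without changing the mean.
  rw [actionExp_eq_stagedExp, actionExp_eq_stagedExp,
    (sampler_isStaged hs ℓ).stagedExp_eq_partialExp
      (isPast_comp_refDist (G := G) ℓ τ fun q => q k).dependsOn,
    (sampler_isStaged hs ℓ').stagedExp_eq_partialExp
      (isPast_comp_refDist (G := G) ℓ' τ fun q => q k).dependsOn]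
  unfold partialExp
  refine Finset.sum_congr rfl fun b _ => ?_
  beta_reduce
  rw [refDist_congr (G := G) (a := Function.curry b) (a' := Function.curry b) h fun _ _ => rfl]
  congr 2
  refine Finset.prod_congr rfl fun c hc => ?_
  have hc' := (Finset.mem_filter.mp hc).2
  unfold sampler
  rw [policy_congr (G := G) (ℓ := ℓ) (ℓ' := ℓ') (fun t ht => h t (by omega)) fun _ _ => rfl]

end Measurability

/-! ### Stochastic environments -/

theorem card_block_eq {T B τ : ℕ} (hB : 0 < B) (hτ : (τ + 1) * B ≤ T) :
    #(univ.filter fun t : Fin T => (t : ℕ) / B = τ) = B := by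
  have h : (univ.filter fun t : Fin T => (t : ℕ) / B = τ).map Fin.valEmbedding
      = Finset.Ico (τ * B) ((τ + 1) * B) := by
    ext x
    simp only [Finset.mem_map, mem_filter, mem_univ, true_and, Fin.valEmbedding_apply,
      Finset.mem_Ico]
    have hx : x / B = τ ↔ τ * B ≤ x ∧ x < (τ + 1) * B := by
      rw [← Nat.le_div_iff_mul_le hB, ← Nat.div_lt_iff_lt_mul hB]
      omega
    rw [← hx]
    constructor
    · rintro ⟨t, ht, rfl⟩
      exact ht
    · intro hx
      exact ⟨⟨x, by
        have := (Nat.div_lt_iff_lt_mul hB (x := x) (y := τ + 1)).mp (by omega)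
        omega⟩, hx, rfl⟩
  have h2 := congrArg Finset.card h
  rw [Finset.card_map, Nat.card_Ico] at h2
  rw [h2, ← Nat.sub_mul]
  simp

section Stochastic

variable {T N K : ℕ} {G : SimpleGraph (Fin N)} {W : Matrix (Fin N) (Fin N) ℝ}
  {Ω : Type*} [MeasurableSpace Ω] {P : Measure Ω} {ℓ : Ω → Losses T N K} {μ : Fin N → Fin K → ℝ}

theorem IsStochasticEnv.measurable_losses (hE : IsStochasticEnv P ℓ μ) : Measurable ℓ :=
  measurable_pi_lambda _ hE.measurable

/-- Functions of the losses in disjoint sets of rounds are independent. -/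
theorem IsStochasticEnv.indepFun_comp (hE : IsStochasticEnv P ℓ μ) {S S' : Finset (Fin T)}
    (hSS' : Disjoint S S') {f g : Losses T N K → ℝ} (hf : Measurable f) (hg : Measurable g)
    (hfS : DependsOn f (S : Set (Fin T))) (hgS : DependsOn g (S' : Set (Fin T))) :
    IndepFun (fun ω => f (ℓ ω)) (fun ω => g (ℓ ω)) P := by
  classical
  -- Losses outside the relevant rounds are replaced by 0, so that each function factors through a
  -- restriction.
  have hpad : ∀ U : Finset (Fin T), Measurable fun (v : U → Fin N → Fin K → ℝ) (t : Fin T) =>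
      if h : t ∈ U then v ⟨t, h⟩ else 0 := by
    intro U
    refine measurable_pi_lambda _ fun t => ?_
    split_ifs with h
    · exact measurable_pi_apply _
    · exact measurable_const
  have h := (hE.indep.indepFun_finset S S' hSS' hE.measurable).comp (hf.comp (hpad S))
    (hg.comp (hpad S'))
  convert h using 1
  · funext ω
    exact hfS fun t ht => by simp [Finset.mem_coe.mp ht]
  · funext ω
    exact hgS fun t ht => by simp [Finset.mem_coe.mp ht]

theorem dependsOn_avgLoss (t : Fin T) (k : Fin K) :
    DependsOn (fun ℓ : Losses T N K => avgLoss ℓ t k) {t} := fun ℓ ℓ' h => by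
  simp only [avgLoss, h t rfl]

/-- Excess loss of arm `k` over arm `kstar` in block `τ`. -/
def blockExcess (W : Matrix (Fin N) (Fin N) ℝ) (ℓ : Losses T N K) (kstar : Fin K) (τ : ℕ)
    (k : Fin K) : ℝ := blockLoss W ℓ τ k - blockLoss W ℓ τ kstar

theorem measurable_blockExcess (kstar : Fin K) (τ : ℕ) (k : Fin K) :
    Measurable fun ℓ : Losses T N K => blockExcess W ℓ kstar τ k :=
  (measurable_blockLoss τ k).sub (measurable_blockLoss τ kstar)

theorem abs_blockExcess_le (hs : Setting G W K T) {ℓ : Losses T N K}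
    (hℓ : ∀ t i k, ℓ t i k ∈ Set.Icc (0 : ℝ) 1) (kstar : Fin K) (τ : ℕ) (k : Fin K) :
    |blockExcess W ℓ kstar τ k| ≤ blockLength W K T := by
  have h1 := blockLoss_mem_Icc hs hℓ τ k
  have h2 := blockLoss_mem_Icc hs hℓ τ kstar
  unfold blockExcess
  exact abs_le.mpr ⟨by linarith [h1.1, h2.2], by linarith [h1.2, h2.1]⟩

/-- The first variable is a function of the rounds before block τ, the second of the rounds in it.
Averaging over the actions beforehand makes both functions of the losses only. -/
theorem IsStochasticEnv.indepFun_meanDist (hs : Setting G W K T) (hE : IsStochasticEnv P ℓ μ)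
    (kstar : Fin K) (τ : ℕ) (k k' : Fin K) :
    IndepFun (fun ω => meanDist G W (ℓ ω) τ k) (fun ω => blockExcess W (ℓ ω) kstar τ k') P := by
  refine hE.indepFun_comp (S := univ.filter fun t : Fin T => (t : ℕ) / blockLength W K T < τ)
    (S' := univ.filter fun t : Fin T => (t : ℕ) / blockLength W K T = τ) ?_
    (measurable_meanDist hs τ k) (measurable_blockExcess kstar τ k') ?_ ?_
  · rw [Finset.disjoint_filter]
    intro t _ h h'
    omega
  · intro l l' h
    exact meanDist_congr hs (fun t ht => h t (by simpa using ht)) k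
  · intro l l' h
    simp only [blockExcess, blockLoss]
    congr 1 <;>
    · refine Finset.sum_congr rfl fun t ht => dependsOn_avgLoss t _ fun t' ht' => ?_
      rw [Set.mem_singleton_iff.mp ht']
      exact h t ht

theorem integrable_of_abs_le [IsProbabilityMeasure P] {f : Ω → ℝ} (hf : Measurable f) {c : ℝ}
    (h : ∀ ω, |f ω| ≤ c) : Integrable f P :=
  Integrable.of_bound hf.aestronglyMeasurable c (ae_of_all _ h)

variable [IsProbabilityMeasure P]

theorem IsStochasticEnv.integrable_loss (hE : IsStochasticEnv P ℓ μ) (t : Fin T) (i : Fin N)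
    (k : Fin K) : Integrable (fun ω => ℓ ω t i k) P :=
  integrable_of_abs_le ((measurable_loss t i k).comp hE.measurable_losses) (c := 1) fun ω => by
    have := hE.mem_Icc ω t i k
    exact abs_le.mpr ⟨by linarith [this.1], this.2⟩

theorem IsStochasticEnv.integrable_avgLoss (hE : IsStochasticEnv P ℓ μ) (t : Fin T) (k : Fin K) :
    Integrable (fun ω => avgLoss (ℓ ω) t k) P :=
  (integrable_finsetSum _ fun i _ => hE.integrable_loss t i k).const_mul _

theorem IsStochasticEnv.integral_avgLoss (hE : IsStochasticEnv P ℓ μ) (t : Fin T) (k : Fin K) :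
    ∫ ω, avgLoss (ℓ ω) t k ∂P = globalMean μ k := by
  unfold avgLoss globalMean
  rw [integral_const_mul, integral_finsetSum _ fun i _ => hE.integrable_loss t i k]
  simp only [hE.mean]

theorem IsStochasticEnv.gap_le_one (hN : 0 < N) (hT : 0 < T) (hE : IsStochasticEnv P ℓ μ)
    (kstar k : Fin K) : gap μ kstar k ≤ 1 := by
  have h : ∀ k, globalMean μ k ∈ Set.Icc (0 : ℝ) 1 := by
    intro k
    rw [← hE.integral_avgLoss ⟨0, hT⟩ k]
    have hb := fun ω => avgLoss_mem_Icc hN (hE.mem_Icc ω) ⟨0, hT⟩ k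
    refine ⟨integral_nonneg fun ω => (hb ω).1, ?_⟩
    have := integral_mono (hE.integrable_avgLoss ⟨0, hT⟩ k) (integrable_const (1 : ℝ))
      fun ω => (hb ω).2
    simpa using this
  unfold gap
  linarith [(h k).2, (h kstar).1]

theorem IsStochasticEnv.integrable_expectedLoss (hs : Setting G W K T)
    (hE : IsStochasticEnv P ℓ μ) (i : Fin N) :
    Integrable (fun ω => expectedLoss G W (ℓ ω) i) P :=
  integrable_of_abs_le ((measurable_expectedLoss hs i).comp hE.measurable_losses) (c := T)
    fun ω => by
      have := expectedLoss_mem_Icc hs (hE.mem_Icc ω) i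
      exact abs_le.mpr ⟨by linarith [this.1, (Nat.cast_nonneg T : (0 : ℝ) ≤ T)], this.2⟩

theorem IsStochasticEnv.integral_blockExcess (hs : Setting G W K T)
    (hE : IsStochasticEnv P ℓ μ) {τ : ℕ} (hτ : (τ + 1) * blockLength W K T ≤ T)
    (kstar k : Fin K) :
    ∫ ω, blockExcess W (ℓ ω) kstar τ k ∂P = blockLength W K T * gap μ kstar k := by
  have h : ∀ k, ∫ ω, blockLoss W (ℓ ω) τ k ∂P = blockLength W K T * globalMean μ k := by
    intro k
    unfold blockLoss
    rw [integral_finsetSum _ fun t _ => hE.integrable_avgLoss t k]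
    simp only [hE.integral_avgLoss, Finset.sum_const, card_block_eq hs.B_pos hτ, nsmul_eq_mul]
  have hi : ∀ k, Integrable (fun ω => blockLoss W (ℓ ω) τ k) P := fun k =>
    integrable_finsetSum _ fun t _ => hE.integrable_avgLoss t k
  unfold blockExcess
  rw [integral_sub (hi k) (hi kstar), h, h, gap]
  ring

/-- Squared mean plus variance. The block has B independent rounds, each of variance at most 1;
dependence within a round is harmless. -/
theorem IsStochasticEnv.integral_blockExcess_sq_le (hs : Setting G W K T)
    (hE : IsStochasticEnv P ℓ μ) {τ : ℕ} (hτ : (τ + 1) * blockLength W K T ≤ T)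
    (kstar k : Fin K) :
    ∫ ω, blockExcess W (ℓ ω) kstar τ k ^ 2 ∂P ≤
      (blockLength W K T * gap μ kstar k) ^ 2 + blockLength W K T := by
  set S := univ.filter fun t : Fin T => (t : ℕ) / blockLength W K T = τ with hS
  set X : Fin T → Ω → ℝ := fun t ω => avgLoss (ℓ ω) t k - avgLoss (ℓ ω) t kstar with hX
  have hXm : ∀ t, Measurable (X t) := fun t =>
    ((measurable_avgLoss t k).sub (measurable_avgLoss t kstar)).comp hE.measurable_losses
  have hXb : ∀ t ω, |X t ω| ≤ 1 := fun t ω => by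
    have h1 := avgLoss_mem_Icc hs.N_pos (hE.mem_Icc ω) t k
    have h2 := avgLoss_mem_Icc hs.N_pos (hE.mem_Icc ω) t kstar
    exact abs_le.mpr ⟨by simp only [hX]; linarith [h1.1, h2.2],
      by simp only [hX]; linarith [h1.2, h2.1]⟩
  have hXL : ∀ t, MemLp (X t) 2 P := fun t =>
    MemLp.of_bound (hXm t).aestronglyMeasurable 1 (ae_of_all _ (hXb t))
  have hD : (fun ω => blockExcess W (ℓ ω) kstar τ k) = ∑ t ∈ S, X t := by
    funext ω
    simp only [blockExcess, blockLoss, Finset.sum_apply, hX, Finset.sum_sub_distrib, hS]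
  have hvar : Var[∑ t ∈ S, X t; P] ≤ blockLength W K T := by
    rw [IndepFun.variance_sum (fun t _ => hXL t)]
    · have h1 : ∀ t ∈ S, Var[X t; P] ≤ 1 := by
        intro t _
        refine (variance_le_expectation_sq (hXm t).aestronglyMeasurable).trans ?_
        have := integral_mono (hXL t).integrable_sq (integrable_const (1 : ℝ)) fun ω => by
          have := hXb t ω
          rw [← sq_abs]
          exact pow_le_one₀ (abs_nonneg _) this
        simpa using this
      refine (Finset.sum_le_card_nsmul _ _ 1 h1).trans ?_
      rw [card_block_eq hs.B_pos hτ]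
      simp
    · intro t _ t' _ htt'
      refine hE.indepFun_comp (S := {t}) (S' := {t'}) (by simpa using htt')
        (f := fun l => avgLoss l t k - avgLoss l t kstar)
        (g := fun l => avgLoss l t' k - avgLoss l t' kstar)
        ((measurable_avgLoss t k).sub (measurable_avgLoss t kstar))
        ((measurable_avgLoss t' k).sub (measurable_avgLoss t' kstar)) ?_ ?_
      · intro l l' h
        rw [Finset.coe_singleton] at h
        simp only [dependsOn_avgLoss t k h, dependsOn_avgLoss t kstar h]
      · intro l l' h
        rw [Finset.coe_singleton] at h
        simp only [dependsOn_avgLoss t' k h, dependsOn_avgLoss t' kstar h]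
  have hmean := hE.integral_blockExcess hs hτ kstar k
  have hv := variance_eq_sub (memLp_finsetSum' S fun t _ => hXL t)
  rw [hv, ← hD] at hvar
  simp only [Pi.pow_apply] at hvar
  rw [hmean] at hvar
  linarith

/-- Mean of the reference distribution of block `τ`, including the randomness of the losses. -/
def meanProb (P : Measure Ω) (G : SimpleGraph (Fin N)) (W : Matrix (Fin N) (Fin N) ℝ)
    (ℓ : Ω → Losses T N K) (τ : ℕ) (k : Fin K) : ℝ := ∫ ω, meanDist G W (ℓ ω) τ k ∂P

theorem IsStochasticEnv.integrable_meanDist (hs : Setting G W K T) (hE : IsStochasticEnv P ℓ μ)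
    (τ : ℕ) (k : Fin K) : Integrable (fun ω => meanDist G W (ℓ ω) τ k) P :=
  integrable_of_abs_le ((measurable_meanDist hs τ k).comp hE.measurable_losses) (c := 1)
    fun ω => by
      have := meanDist_mem_Icc hs (ℓ ω) τ k
      exact abs_le.mpr ⟨by linarith [this.1], this.2⟩

theorem IsStochasticEnv.meanProb_mem_Icc (hs : Setting G W K T) (hE : IsStochasticEnv P ℓ μ)
    (τ : ℕ) (k : Fin K) : meanProb P G W ℓ τ k ∈ Set.Icc (0 : ℝ) 1 := by
  refine ⟨integral_nonneg fun ω => (meanDist_mem_Icc hs (ℓ ω) τ k).1, ?_⟩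
  have := integral_mono (hE.integrable_meanDist hs τ k) (integrable_const (1 : ℝ))
    fun ω => (meanDist_mem_Icc hs (ℓ ω) τ k).2
  simpa [meanProb] using this

theorem IsStochasticEnv.integrable_meanDist_mul_pow (hs : Setting G W K T)
    (hE : IsStochasticEnv P ℓ μ) (kstar : Fin K) (τ : ℕ) (k : Fin K) (m : ℕ) :
    Integrable (fun ω => meanDist G W (ℓ ω) τ k * blockExcess W (ℓ ω) kstar τ k ^ m) P := by
  refine integrable_of_abs_le (((measurable_meanDist hs τ k).mul
    ((measurable_blockExcess kstar τ k).pow_const m)).comp hE.measurable_losses)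
    (c := 1 * (blockLength W K T : ℝ) ^ m) fun ω => ?_
  have h := meanDist_mem_Icc hs (ℓ ω) τ k
  rw [abs_mul, abs_pow]
  exact mul_le_mul (abs_le.mpr ⟨by linarith [h.1], h.2⟩)
    (pow_le_pow_left₀ (abs_nonneg _) (abs_blockExcess_le hs (hE.mem_Icc ω) kstar τ k) m)
    (by positivity) zero_le_one

theorem IsStochasticEnv.integral_meanDist_mul (hs : Setting G W K T)
    (hE : IsStochasticEnv P ℓ μ) {τ : ℕ} (hτ : (τ + 1) * blockLength W K T ≤ T)
    (kstar k : Fin K) :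
    ∫ ω, meanDist G W (ℓ ω) τ k * blockExcess W (ℓ ω) kstar τ k ∂P
      = meanProb P G W ℓ τ k * (blockLength W K T * gap μ kstar k) := by
  rw [(hE.indepFun_meanDist hs kstar τ k k).integral_fun_mul_eq_mul_integral
    ((measurable_meanDist hs τ k).comp hE.measurable_losses).aestronglyMeasurable
    ((measurable_blockExcess kstar τ k).comp hE.measurable_losses).aestronglyMeasurable,
    hE.integral_blockExcess hs hτ]
  rfl

theorem IsStochasticEnv.integral_meanDist_mul_sq_le (hs : Setting G W K T)
    (hE : IsStochasticEnv P ℓ μ) {τ : ℕ} (hτ : (τ + 1) * blockLength W K T ≤ T)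
    (kstar k : Fin K) :
    ∫ ω, meanDist G W (ℓ ω) τ k * blockExcess W (ℓ ω) kstar τ k ^ 2 ∂P ≤
      meanProb P G W ℓ τ k *
        ((blockLength W K T * gap μ kstar k) ^ 2 + blockLength W K T) := by
  have hind : IndepFun (fun ω => meanDist G W (ℓ ω) τ k)
      (fun ω => blockExcess W (ℓ ω) kstar τ k ^ 2) P :=
    (hE.indepFun_meanDist hs kstar τ k k).comp measurable_id (measurable_id.pow_const 2)
  rw [hind.integral_fun_mul_eq_mul_integral
    ((measurable_meanDist hs τ k).comp hE.measurable_losses).aestronglyMeasurable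
    (((measurable_blockExcess kstar τ k).comp
      hE.measurable_losses).pow_const 2).aestronglyMeasurable]
  exact mul_le_mul_of_nonneg_left (hE.integral_blockExcess_sq_le hs hτ kstar k)
    (hE.meanProb_mem_Icc hs τ k).1

end Stochastic

/-- The squared gap is absorbed into Bδa/8 because β ≥ 32B and δ ≤ 1. The variance part is at most
4√(L/s)·a, which `linear_term_le` splits into another Bδa/8 and an exponential residue. -/
theorem late_term_le {B L β δ a s : ℝ} (hB : 1 ≤ B) (hL : 0 < L) (hs : 0 < s)
    (hβ1 : 32 * B ≤ β) (hβ2 : B * √(s / L) ≤ β) (hδ0 : 0 < δ) (hδ1 : δ ≤ 1) (ha0 : 0 ≤ a)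
    (ha1 : a ≤ 1) :
    4 / β * (a * ((B * δ) ^ 2 + B)) ≤
      B * δ / 4 * a + 4 * √L * (1 / √s * Real.exp (-(B * δ / (32 * √L) * √s))) := by
  have hB0 : 0 < B := by linarith
  have hβ : 0 < β := by linarith
  have hLs := Real.sqrt_pos.mpr hL
  have hss := Real.sqrt_pos.mpr hs
  have h1 : 4 / β * (a * (B * δ) ^ 2) ≤ B * δ / 8 * a := by
    have h : 4 / β * (B * δ) ^ 2 ≤ B * δ / 8 := by
      rw [div_mul_eq_mul_div, div_le_iff₀ hβ]
      have h2 : B * δ * (32 * B) ≤ B * δ * β := mul_le_mul_of_nonneg_left hβ1 (by positivity)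
      have h3 : B * δ * (B * δ) ≤ B * δ * B :=
        mul_le_mul_of_nonneg_left (mul_le_of_le_one_right hB0.le hδ1) (by positivity)
      nlinarith
    calc _ = 4 / β * (B * δ) ^ 2 * a := by ring
      _ ≤ _ := mul_le_mul_of_nonneg_right h ha0
  have h2 : 4 / β * (a * B) ≤ 4 * √L / √s * a := by
    have h : 4 / β * B ≤ 4 * √L / √s := by
      rw [div_mul_eq_mul_div, div_le_div_iff₀ hβ hss]
      rw [Real.sqrt_div hs.le] at hβ2
      have h3 := mul_le_mul_of_nonneg_left hβ2 hLs.le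
      have h4 : √L * (B * (√s / √L)) = B * √s := by field_simp
      rw [h4] at h3
      linarith
    calc _ = 4 / β * B * a := by ring
      _ ≤ _ := mul_le_mul_of_nonneg_right h ha0
  have h3 := linear_term_le (x := 4 * √L / √s) (b := B * δ / 8) (by positivity) ha0 ha1
  have e1 : B * δ / 8 / (4 * √L / √s) = B * δ / (32 * √L) * √s := by
    field_simp
    ring
  rw [e1] at h3
  calc _ = 4 / β * (a * (B * δ) ^ 2) + 4 / β * (a * B) := by ring
    _ ≤ B * δ / 8 * a + (B * δ / 8 * a
        + 4 * √L / √s * Real.exp (-(B * δ / (32 * √L) * √s))) :=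
      add_le_add h1 (h2.trans h3)
    _ = _ := by ring

-- Fewer than x of the integers s + 1 lie below the threshold x; each of them costs c.
open Classical in
theorem sum_early_le {x c : ℝ} (hx : 0 ≤ x) (hc : 0 ≤ c) (n : ℕ) :
    ∑ s ∈ range n, (if x ≤ ((s + 1 : ℕ) : ℝ) then 0 else c) ≤ x * c := by
  have h : ∀ n : ℕ, ∑ s ∈ range n, (if x ≤ ((s + 1 : ℕ) : ℝ) then 0 else c) ≤ min (n : ℝ) x * c := by
    intro n
    induction n with
    | zero => simp [hx]
    | succ n ih =>
      rw [Finset.sum_range_succ]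
      split_ifs with h
      · rw [add_zero]
        refine ih.trans (mul_le_mul_of_nonneg_right (min_le_min_right x ?_) hc)
        push_cast
        linarith
      · rw [not_le] at h
        rw [min_eq_left h.le]
        have h' : (n : ℝ) ≤ x := by
          push_cast at h
          linarith
        rw [min_eq_left h'] at ih
        have e : ((n + 1 : ℕ) : ℝ) * c = n * c + c := by
          push_cast
          ring
        linarith
  exact (h n).trans (mul_le_mul_of_nonneg_right (min_le_right _ _) hc)

/-! ### Integration of the self-bounding inequality over the losses -/

section Stochastic

variable {T N K : ℕ} {G : SimpleGraph (Fin N)} {W : Matrix (Fin N) (Fin N) ℝ}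
  {Ω : Type*} [MeasurableSpace Ω] {P : Measure Ω} {ℓ : Ω → Losses T N K} {μ : Fin N → Fin K → ℝ}
  [IsProbabilityMeasure P]

theorem IsStochasticEnv.integral_sum_meanDist_mul (hs : Setting G W K T)
    (hE : IsStochasticEnv P ℓ μ) {τ : ℕ} (hτ : (τ + 1) * blockLength W K T ≤ T) (kstar : Fin K) :
    Integrable (fun ω => ∑ k ∈ univ.erase kstar, meanDist G W (ℓ ω) τ k *
      (blockLoss W (ℓ ω) τ k - blockLoss W (ℓ ω) τ kstar)) P ∧
    ∫ ω, ∑ k ∈ univ.erase kstar, meanDist G W (ℓ ω) τ k *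
      (blockLoss W (ℓ ω) τ k - blockLoss W (ℓ ω) τ kstar) ∂P
      = ∑ k ∈ univ.erase kstar,
          meanProb P G W ℓ τ k * (blockLength W K T * gap μ kstar k) := by
  have hi : ∀ k, Integrable (fun ω => meanDist G W (ℓ ω) τ k *
      (blockLoss W (ℓ ω) τ k - blockLoss W (ℓ ω) τ kstar)) P := fun k => by
    have := hE.integrable_meanDist_mul_pow hs kstar τ k 1
    simpa [blockExcess] using this
  refine ⟨integrable_finsetSum _ fun k _ => hi k, ?_⟩
  rw [integral_finsetSum _ fun k _ => hi k]
  exact Finset.sum_congr rfl fun k _ => hE.integral_meanDist_mul hs hτ kstar k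

theorem IsStochasticEnv.integral_sum_meanDist_mul_sq (hs : Setting G W K T)
    (hE : IsStochasticEnv P ℓ μ) {τ : ℕ} (hτ : (τ + 1) * blockLength W K T ≤ T) (kstar : Fin K) :
    Integrable (fun ω => ∑ k ∈ univ.erase kstar, meanDist G W (ℓ ω) τ k *
      (blockLoss W (ℓ ω) τ k - blockLoss W (ℓ ω) τ kstar) ^ 2) P ∧
    ∫ ω, ∑ k ∈ univ.erase kstar, meanDist G W (ℓ ω) τ k *
      (blockLoss W (ℓ ω) τ k - blockLoss W (ℓ ω) τ kstar) ^ 2 ∂P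
      ≤ ∑ k ∈ univ.erase kstar, meanProb P G W ℓ τ k *
          ((blockLength W K T * gap μ kstar k) ^ 2 + blockLength W K T) := by
  have hi : ∀ k, Integrable (fun ω => meanDist G W (ℓ ω) τ k *
      (blockLoss W (ℓ ω) τ k - blockLoss W (ℓ ω) τ kstar) ^ 2) P := fun k =>
    hE.integrable_meanDist_mul_pow hs kstar τ k 2
  refine ⟨integrable_finsetSum _ fun k _ => hi k, ?_⟩
  rw [integral_finsetSum _ fun k _ => hi k]
  exact Finset.sum_le_sum fun k _ => hE.integral_meanDist_mul_sq_le hs hτ kstar k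

/-- Expected per-round form of the self-bounding inequality. -/
theorem IsStochasticEnv.integral_step_le (hs : Setting G W K T) (hE : IsStochasticEnv P ℓ μ)
    {kstar : Fin K} (hgap : ∀ k, k ≠ kstar → 0 < gap μ kstar k) {τ : ℕ}
    (hτ : (τ + 1) * blockLength W K T ≤ T) {s : ℕ} (hs0 : 0 < s)
    {late : Prop} [Decidable late] (hlate : late ↔ 1024 * Real.log K ≤ (s : ℝ)) (c : Fin K → ℝ) :
    Integrable (fun ω => (if late then 4 / invEta K (blockLength W K T) s *
        ∑ k ∈ univ.erase kstar, meanDist G W (ℓ ω) τ k *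
          (blockLoss W (ℓ ω) τ k - blockLoss W (ℓ ω) τ kstar) ^ 2
        else 16 * (blockLength W K T : ℝ)) + ∑ k ∈ univ.erase kstar,
        (blockLength W K T * gap μ kstar k / 4 * meanDist G W (ℓ ω) τ k + c k)) P ∧
    ∫ ω, ((if late then 4 / invEta K (blockLength W K T) s *
        ∑ k ∈ univ.erase kstar, meanDist G W (ℓ ω) τ k *
          (blockLoss W (ℓ ω) τ k - blockLoss W (ℓ ω) τ kstar) ^ 2
        else 16 * (blockLength W K T : ℝ)) + ∑ k ∈ univ.erase kstar,
        (blockLength W K T * gap μ kstar k / 4 * meanDist G W (ℓ ω) τ k + c k)) ∂P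
      ≤ (if late then 0 else 16 * (blockLength W K T : ℝ)) + ∑ k ∈ univ.erase kstar,
        (meanProb P G W ℓ τ k * (blockLength W K T * gap μ kstar k) / 2 + c k
          + 4 * √(Real.log K) * (1 / √(s : ℝ) *
            Real.exp (-(blockLength W K T * gap μ kstar k / (32 * √(Real.log K)) * √(s : ℝ))))) := by
  set B := blockLength W K T with hB
  set L := Real.log K with hL
  have hL0 : 0 < L := log_natCast_pos hs.two_le_K
  have hB1 : (1 : ℝ) ≤ B := by exact_mod_cast hs.B_pos
  have hsr : (0 : ℝ) < s := by exact_mod_cast hs0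
  have hm : ∀ k, Integrable (fun ω => B * gap μ kstar k / 4 * meanDist G W (ℓ ω) τ k) P :=
    fun k => (hE.integrable_meanDist hs τ k).const_mul _
  have hmc : ∀ k, Integrable (fun ω => B * gap μ kstar k / 4 * meanDist G W (ℓ ω) τ k + c k) P :=
    fun k => (hm k).add (integrable_const _)
  have hsum : Integrable (fun ω => ∑ k ∈ univ.erase kstar,
      (B * gap μ kstar k / 4 * meanDist G W (ℓ ω) τ k + c k)) P :=
    integrable_finsetSum _ fun k _ => hmc k
  have hsumI : ∫ ω, ∑ k ∈ univ.erase kstar,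
      (B * gap μ kstar k / 4 * meanDist G W (ℓ ω) τ k + c k) ∂P
      = ∑ k ∈ univ.erase kstar, (B * gap μ kstar k / 4 * meanProb P G W ℓ τ k + c k) := by
    rw [integral_finsetSum _ fun k _ => hmc k]
    refine Finset.sum_congr rfl fun k _ => ?_
    rw [integral_add (hm k) (integrable_const _), integral_const_mul]
    simp [meanProb]
  have hE2 : ∀ k, 0 ≤ 4 * √L * (1 / √(s : ℝ) *
      Real.exp (-(B * gap μ kstar k / (32 * √L) * √(s : ℝ)))) := fun k => by positivity
  by_cases h : late
  · simp only [if_pos h]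
    obtain ⟨hqi, hq⟩ := hE.integral_sum_meanDist_mul_sq hs hτ kstar
    refine ⟨(hqi.const_mul _).add hsum, ?_⟩
    have h32 : 32 * (B : ℝ) ≤ invEta K B s :=
      invEta_ge_of_le (x := 32) hs.two_le_K (by norm_num; exact hlate.mp h)
    have hβ2 : (B : ℝ) * √((s : ℝ) / L) ≤ invEta K B s := by
      unfold invEta
      rw [max_eq_left (show 1 ≤ s from hs0)]
      exact le_max_right _ _
    have hβ : 0 < invEta K B s := by linarith
    rw [integral_add (hqi.const_mul _) hsum, integral_const_mul, hsumI, zero_add]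
    refine (add_le_add_left (mul_le_mul_of_nonneg_left hq (by positivity)) _).trans ?_
    rw [Finset.mul_sum, ← Finset.sum_add_distrib]
    refine Finset.sum_le_sum fun k hk => ?_
    have ha := hE.meanProb_mem_Icc hs τ k
    -- This uses up a second quarter of the regret of the block, next to the quarter already
    -- present; together they give the factor 1/2.
    have := late_term_le hB1 hL0 hsr h32 hβ2 (hgap k (Finset.ne_of_mem_erase hk))
      (hE.gap_le_one hs.N_pos hs.T_pos kstar k) ha.1 ha.2
    linarith
  · simp only [if_neg h]
    refine ⟨(integrable_const _).add hsum, ?_⟩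
    rw [integral_add (integrable_const _) hsum, hsumI]
    simp only [integral_const, probReal_univ, one_smul]
    refine add_le_add_right (Finset.sum_le_sum fun k hk => ?_) _
    have ha := hE.meanProb_mem_Icc hs τ k
    have h1 := hE2 k
    have h2 : 0 ≤ B * gap μ kstar k * meanProb P G W ℓ τ k :=
      mul_nonneg (mul_nonneg (by linarith) (hgap k (Finset.ne_of_mem_erase hk)).le) ha.1
    linarith

end Stochastic

section Stochastic

variable {T N K : ℕ} {G : SimpleGraph (Fin N)} {W : Matrix (Fin N) (Fin N) ℝ}
  {Ω : Type*} [MeasurableSpace Ω] {P : Measure Ω} {ℓ : Ω → Losses T N K} {μ : Fin N → Fin K → ℝ}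
  [IsProbabilityMeasure P]

/-- Expected regret of the reference process over the blocks of one parity, before the
deterministic residues are summed. -/
theorem IsStochasticEnv.sum_meanProb_le (hs : Setting G W K T) (hE : IsStochasticEnv P ℓ μ)
    {kstar : Fin K} (hgap : ∀ k, k ≠ kstar → 0 < gap μ kstar k) {π : ℕ} (hπ : π < 2) {n : ℕ}
    (hn : 2 * n + π < T / blockLength W K T) :
    ∑ s ∈ range (n + 1), ∑ k ∈ univ.erase kstar,
        meanProb P G W ℓ (2 * s + π) k * (blockLength W K T * gap μ kstar k) ≤
      2 * ((2 * blockLength W K T * Real.log K + 4 * blockLength W K T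
          + 14 * blockLength W K T * √K)
        + 1024 * Real.log K * (16 * blockLength W K T)
        + ∑ k ∈ univ.erase kstar, (19208 / (N * gap μ kstar k) * (1 + Real.log n)
          + 16 * blockLength W K T / (Real.log K * gap μ kstar k)
          + 256 * Real.log K / (blockLength W K T * gap μ kstar k))) := by
  classical
  set B := blockLength W K T with hB
  set L := Real.log K with hL
  have hL0 : 0 < L := log_natCast_pos hs.two_le_K
  have hLs := Real.sqrt_pos.mpr hL0
  have hB0 : 0 < B := hs.B_pos
  have hB1 : (1 : ℝ) ≤ B := by exact_mod_cast hB0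
  have hτ : ∀ s ≤ n, (2 * s + π + 1) * B ≤ T := fun s hsn =>
    (Nat.le_div_iff_mul_le hB0).mp (by omega)
  set δ := gap μ kstar with hδ
  set A : ℕ → ℝ := fun s => ∑ k ∈ univ.erase kstar,
    meanProb P G W ℓ (2 * s + π) k * (B * δ k) with hA
  have hA0 : ∀ s, 0 ≤ A s := fun s => Finset.sum_nonneg fun k hk =>
    mul_nonneg (hE.meanProb_mem_Icc hs _ k).1
      (mul_nonneg (by linarith) (hgap k (Finset.ne_of_mem_erase hk)).le)
  set c : ℕ → Fin K → ℝ := fun s k => 19208 / (N * δ k) * (1 / ((s : ℝ) + 1))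
    + B / √L * (1 / √((s : ℝ) + 1) * Real.exp (-(δ k * √L / 8 * √((s : ℝ) + 1)))) with hc
  set r : ℕ → Fin K → ℝ := fun s k => 4 * √L * (1 / √((s : ℝ) + 1) *
    Real.exp (-(B * δ k / (32 * √L) * √((s : ℝ) + 1)))) with hr
  set c₀ : ℝ := 2 * B * L + 4 * B + 14 * B * √K with hc₀
  have hstep := fun s (hsn : s < n) => hE.integral_step_le (P := P) hs hgap
    (τ := 2 * (s + 1) + π) (hτ (s + 1) hsn) (s := s + 1) (Nat.succ_pos s)
    (late := 1024 * L ≤ ((s + 1 : ℕ) : ℝ)) Iff.rfl (c s)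
  have hlin : ∀ s ∈ range (n + 1), Integrable (fun ω => ∑ k ∈ univ.erase kstar,
      meanDist G W (ℓ ω) (2 * s + π) k * (blockLoss W (ℓ ω) (2 * s + π) k
        - blockLoss W (ℓ ω) (2 * s + π) kstar)) P := fun s hsn =>
    (hE.integral_sum_meanDist_mul hs (hτ s (by have := mem_range.mp hsn; omega)) kstar).1
  have hmain : ∑ s ∈ range (n + 1), A s ≤ c₀ + ∑ s ∈ range n,
      ((if 1024 * L ≤ ((s + 1 : ℕ) : ℝ) then 0 else 16 * (B : ℝ)) + ∑ k ∈ univ.erase kstar,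
        (meanProb P G W ℓ (2 * (s + 1) + π) k * (B * δ k) / 2 + c s k + r s k)) := by
    have e1 : ∑ s ∈ range (n + 1), A s = ∫ ω, ∑ s ∈ range (n + 1), ∑ k ∈ univ.erase kstar,
        meanDist G W (ℓ ω) (2 * s + π) k * (blockLoss W (ℓ ω) (2 * s + π) k
          - blockLoss W (ℓ ω) (2 * s + π) kstar) ∂P := by
      rw [integral_finsetSum _ hlin]
      exact Finset.sum_congr rfl fun s hsn => ((hE.integral_sum_meanDist_mul hs
        (hτ s (by have := mem_range.mp hsn; omega)) kstar).2).symm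
    have hsumI := integrable_finsetSum (range n) fun s hsn => (hstep s (mem_range.mp hsn)).1
    rw [e1]
    refine (integral_mono (integrable_finsetSum _ hlin) ((integrable_const c₀).add hsumI)
      fun ω => ?_).trans ?_
    · have h := actionExp_regret_self_bound (G := G) hs (hE.mem_Icc ω) hπ (n := n)
        ((Nat.mul_le_mul_right _ (Nat.le_succ _)).trans (hτ n le_rfl)) kstar hgap
      simp only [Pi.add_apply]
      refine h.trans (le_of_eq ?_)
      simp only [hc, hc₀, add_assoc]
      rfl
    · simp only [Pi.add_apply]
      rw [integral_add (integrable_const _) hsumI, integral_finsetSum _ fun s hsn =>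
        (hstep s (mem_range.mp hsn)).1]
      simp only [integral_const, probReal_univ, one_smul]
      refine add_le_add_right (Finset.sum_le_sum fun s hsn => ?_) _
      refine (hstep s (mem_range.mp hsn)).2.trans (le_of_eq ?_)
      simp only [hr, Nat.cast_add_one]
      rfl
  have e2 : ∀ s, ∑ k ∈ univ.erase kstar,
      (meanProb P G W ℓ (2 * (s + 1) + π) k * (B * δ k) / 2 + c s k + r s k)
      = A (s + 1) / 2 + ∑ k ∈ univ.erase kstar, (c s k + r s k) := by
    intro s
    simp only [hA, Finset.sum_div, ← Finset.sum_add_distrib, add_assoc]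
  simp only [e2, Finset.sum_add_distrib, ← Finset.sum_div] at hmain
  have hearly := sum_early_le (x := 1024 * L) (c := 16 * (B : ℝ)) (by positivity) (by positivity) n
  -- The terms are nonnegative, so at most half of the total appears on the right. Absorbing it
  -- causes the factor 2 in the conclusion.
  have hshift : ∑ s ∈ range n, A (s + 1) ≤ ∑ s ∈ range (n + 1), A s := by
    rw [Finset.sum_range_succ']
    linarith [hA0 0]
  have hres : ∑ s ∈ range n, ∑ k ∈ univ.erase kstar, c s k
      + ∑ s ∈ range n, ∑ k ∈ univ.erase kstar, r s k ≤
      ∑ k ∈ univ.erase kstar, (19208 / (N * δ k) * (1 + Real.log n)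
          + 16 * B / (L * δ k) + 256 * L / (B * δ k)) := by
    rw [Finset.sum_comm, Finset.sum_comm (f := fun s k => r s k), ← Finset.sum_add_distrib]
    refine Finset.sum_le_sum fun k hk => ?_
    have hδk : 0 < δ k := hgap k (Finset.ne_of_mem_erase hk)
    simp only [hc, hr, Finset.sum_add_distrib, ← Finset.mul_sum]
    have h1 := mul_le_mul_of_nonneg_left (sum_inv_le_one_add_log n)
      (show 0 ≤ 19208 / (N * δ k) by positivity)
    have h2 := mul_le_mul_of_nonneg_left
      (sum_inv_sqrt_mul_exp_le (c := δ k * √L / 8) (by positivity) n)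
      (show 0 ≤ B / √L by positivity)
    have h3 := mul_le_mul_of_nonneg_left
      (sum_inv_sqrt_mul_exp_le (c := B * δ k / (32 * √L)) (by positivity) n)
      (show 0 ≤ 4 * √L by positivity)
    have e3 : B / √L * (2 / (δ k * √L / 8)) = 16 * B / (L * δ k) := by
      field_simp
      rw [Real.sq_sqrt hL0.le]
      ring
    have e4 : 4 * √L * (2 / (B * δ k / (32 * √L))) = 256 * L / (B * δ k) := by
      field_simp
      rw [Real.sq_sqrt hL0.le]
      ring
    rw [e3] at h2
    rw [e4] at h3
    linarith
  linarith

theorem IsStochasticEnv.sum_meanProb_le' (hs : Setting G W K T) (hBT : blockLength W K T ≤ T)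
    (hE : IsStochasticEnv P ℓ μ)
    {kstar : Fin K} (hgap : ∀ k, k ≠ kstar → 0 < gap μ kstar k) {π : ℕ} (hπ : π < 2) {n : ℕ}
    (hn : 2 * n + π < T / blockLength W K T) :
    ∑ s ∈ range (n + 1), ∑ k ∈ univ.erase kstar,
        meanProb P G W ℓ (2 * s + π) k * (blockLength W K T * gap μ kstar k) ≤
      39016 * ((blockLength W K T : ℝ) / N * ∑ k ∈ univ.erase kstar,
          Real.log ((T : ℝ) / blockLength W K T) / gap μ kstar k
        + ∑ k ∈ univ.erase kstar, (blockLength W K T : ℝ) ^ 2 / (gap μ kstar k * Real.log K)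
        + (blockLength W K T : ℝ) ^ 2 * Real.log K) := by
  refine (hE.sum_meanProb_le hs hgap hπ hn).trans ?_
  set B := blockLength W K T with hB
  set L := Real.log K with hL
  set δ := gap μ kstar with hδ
  have hL0 : 0 < L := log_natCast_pos hs.two_le_K
  have hL2 : 1 / 2 ≤ L := half_le_log hs.two_le_K
  have hB0 : 0 < B := hs.B_pos
  have hB1 : (1 : ℝ) ≤ B := by exact_mod_cast hB0
  have hLB : L ≤ B := log_le_blockLength' hs
  have hN1 : (1 : ℝ) ≤ N := by exact_mod_cast hs.N_pos
  have hlog0 : 0 ≤ Real.log ((T : ℝ) / B) :=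
    Real.log_nonneg ((one_le_div (by linarith)).mpr (by exact_mod_cast hBT))
  have hlogn : Real.log n ≤ Real.log ((T : ℝ) / B) := by
    rcases Nat.eq_zero_or_pos n with rfl | hn0
    · simpa using hlog0
    · refine Real.log_le_log (by exact_mod_cast hn0) ?_
      refine le_trans ?_ (Nat.cast_div_le (α := ℝ) (m := T) (n := B))
      exact_mod_cast (by omega : n ≤ T / B)
  have hBL : B * L ≤ (B : ℝ) ^ 2 * L :=
    mul_le_mul_of_nonneg_right (by nlinarith) hL0.le
  have hBL' : (B : ℝ) ≤ 2 * (B ^ 2 * L) := by nlinarith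
  -- Since δ ≤ 1 and log K ≤ B, each suboptimal arm provides at least B in the second sum of the
  -- bound.
  have hterm : ∀ k ∈ univ.erase kstar, 0 < δ k ∧ (B : ℝ) ≤ B ^ 2 / (δ k * L) := by
    intro k hk
    have hδk : 0 < δ k := hgap k (Finset.ne_of_mem_erase hk)
    have hδ1 : δ k ≤ 1 := hE.gap_le_one hs.N_pos hs.T_pos kstar k
    refine ⟨hδk, ?_⟩
    rw [le_div_iff₀ (by positivity)]
    have : δ k * L ≤ 1 * B := mul_le_mul hδ1 hLB hL0.le zero_le_one
    nlinarith
  -- √K ≤ 2(K - 1), so the cost of the first block is distributed over the K - 1 suboptimal arms.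
  -- With 19208 + 16 + 256 = 19480, the final constant is 39016 = 2(19480 + 28).
  have hK : 14 * B * √K ≤ 28 * ∑ k ∈ univ.erase kstar, (B : ℝ) ^ 2 / (δ k * L) := by
    have h1 := Finset.card_nsmul_le_sum _ _ _ fun k hk => (hterm k hk).2
    rw [Finset.card_erase_of_mem (mem_univ _), Finset.card_fin, nsmul_eq_mul,
      Nat.cast_sub hs.K_pos, Nat.cast_one] at h1
    have hK2 : (2 : ℝ) ≤ K := by exact_mod_cast hs.two_le_K
    have h2 : √(K : ℝ) ≤ 2 * (K - 1) := by
      refine Real.sqrt_le_iff.mpr ⟨by linarith, by nlinarith⟩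
    have h3 := mul_le_mul_of_nonneg_left h2 (show (0 : ℝ) ≤ 14 * B by positivity)
    linarith
  have hsum : ∑ k ∈ univ.erase kstar, (19208 / (N * δ k) * (1 + Real.log n)
      + 16 * B / (L * δ k) + 256 * L / (B * δ k)) ≤
      19208 * ((B : ℝ) / N * ∑ k ∈ univ.erase kstar, Real.log ((T : ℝ) / B) / δ k)
      + 19480 * ∑ k ∈ univ.erase kstar, (B : ℝ) ^ 2 / (δ k * L) := by
    rw [Finset.mul_sum, Finset.mul_sum, Finset.mul_sum, ← Finset.sum_add_distrib]
    refine Finset.sum_le_sum fun k hk => ?_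
    have hδk := (hterm k hk).1
    have h1 : 19208 / (N * δ k) * (1 + Real.log n)
        ≤ 19208 * (B ^ 2 / (δ k * L)) + 19208 * (B / N * (Real.log ((T : ℝ) / B) / δ k)) := by
      have h2 : 19208 / (N * δ k) * (1 + Real.log n) ≤
          19208 / (N * δ k) * (1 + Real.log ((T : ℝ) / B)) := by gcongr
      have h3 : 1 / (N * δ k) ≤ B ^ 2 / (δ k * L) := by
        rw [div_le_div_iff₀ (by positivity) (by positivity), one_mul, mul_comm (δ k) L,
          ← mul_assoc]
        refine mul_le_mul_of_nonneg_right ?_ hδk.le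
        nlinarith
      have h4 : 1 / N * (Real.log ((T : ℝ) / B) / δ k)
          ≤ B / N * (Real.log ((T : ℝ) / B) / δ k) := by gcongr
      have e : 19208 / (N * δ k) * (1 + Real.log ((T : ℝ) / B)) = 19208 * (1 / (N * δ k))
          + 19208 * (1 / N * (Real.log ((T : ℝ) / B) / δ k)) := by
        field_simp
      linarith
    have h5 : 16 * B / (L * δ k) ≤ 16 * (B ^ 2 / (δ k * L)) := by
      rw [mul_comm L, mul_div_assoc]
      gcongr
      nlinarith
    have h6 : 256 * L / (B * δ k) ≤ 256 * (B ^ 2 / (δ k * L)) := by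
      rw [mul_div_assoc]
      refine mul_le_mul_of_nonneg_left ?_ (by norm_num)
      rw [div_le_div_iff₀ (by positivity) (by positivity)]
      have h7 : L * L ≤ B * B := mul_le_mul hLB hLB hL0.le (by linarith)
      have h8 : L * L * δ k ≤ B ^ 2 * B * δ k := by
        refine mul_le_mul_of_nonneg_right ?_ hδk.le
        nlinarith
      linarith
    linarith
  have hS0 : 0 ≤ ∑ k ∈ univ.erase kstar, (B : ℝ) ^ 2 / (δ k * L) :=
    Finset.sum_nonneg fun k hk => by
      have := (hterm k hk).1
      positivity
  have hS1 : 0 ≤ (B : ℝ) / N * ∑ k ∈ univ.erase kstar, Real.log ((T : ℝ) / B) / δ k :=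
    mul_nonneg (by positivity) (Finset.sum_nonneg fun k hk => div_nonneg hlog0 (hterm k hk).1.le)
  nlinarith

theorem IsStochasticEnv.stochRegret_le (hs : Setting G W K T) (hBT : blockLength W K T ≤ T)
    (hE : IsStochasticEnv P ℓ μ)
    {kstar : Fin K} (hgap : ∀ k, k ≠ kstar → 0 < gap μ kstar k) :
    stochRegret P G W ℓ ≤
      78040 * ((blockLength W K T : ℝ) / N * ∑ k ∈ univ.erase kstar,
          Real.log ((T : ℝ) / blockLength W K T) / gap μ kstar k
        + ∑ k ∈ univ.erase kstar, (blockLength W K T : ℝ) ^ 2 / (gap μ kstar k * Real.log K)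
        + (blockLength W K T : ℝ) ^ 2 * Real.log K) := by
  have hne : Nonempty (Fin N) := ⟨⟨0, hs.N_pos⟩⟩
  have hneK : Nonempty (Fin K) := ⟨⟨0, hs.K_pos⟩⟩
  set X : ℝ := (blockLength W K T : ℝ) / N * ∑ k ∈ univ.erase kstar,
          Real.log ((T : ℝ) / blockLength W K T) / gap μ kstar k
        + ∑ k ∈ univ.erase kstar, (blockLength W K T : ℝ) ^ 2 / (gap μ kstar k * Real.log K)
        + (blockLength W K T : ℝ) ^ 2 * Real.log K with hX
  set B := blockLength W K T with hB
  have hL2 : 1 / 2 ≤ Real.log K := half_le_log hs.two_le_K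
  have hB1 : (1 : ℝ) ≤ B := by exact_mod_cast hs.B_pos
  -- The remainder satisfies 3 + B ≤ 4B ≤ 8X, whence 78040 = 2·39016 + 8.
  have hBX : (B : ℝ) ≤ 2 * X := by
    have h1 : 0 ≤ Real.log ((T : ℝ) / B) :=
      Real.log_nonneg ((one_le_div (by linarith)).mpr (by exact_mod_cast hBT))
    have h2 : 0 ≤ (B : ℝ) / N * ∑ k ∈ univ.erase kstar,
        Real.log ((T : ℝ) / B) / gap μ kstar k :=
      mul_nonneg (by positivity) (Finset.sum_nonneg fun k hk =>
        div_nonneg h1 (hgap k (Finset.ne_of_mem_erase hk)).le)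
    have h3 : 0 ≤ ∑ k ∈ univ.erase kstar, (B : ℝ) ^ 2 / (gap μ kstar k * Real.log K) :=
      Finset.sum_nonneg fun k hk => by
        have := hgap k (Finset.ne_of_mem_erase hk)
        positivity
    have h4 : (B : ℝ) ≤ 2 * (B ^ 2 * Real.log K) := by nlinarith
    linarith
  refine ciSup_le fun i => ?_
  have hsumI : ∀ k, ∫ ω, ∑ t, avgLoss (ℓ ω) t k ∂P = T * globalMean μ k := by
    intro k
    rw [integral_finsetSum _ fun t _ => hE.integrable_avgLoss t k]
    simp [hE.integral_avgLoss]
  have hinf : T * globalMean μ kstar ≤ ⨅ k : Fin K, ∫ ω, ∑ t, avgLoss (ℓ ω) t k ∂P := by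
    refine le_ciInf fun k => ?_
    rw [hsumI]
    refine mul_le_mul_of_nonneg_left ?_ (Nat.cast_nonneg T)
    by_cases hk : k = kstar
    · rw [hk]
    · have := hgap k hk
      unfold gap at this
      linarith
  have hτ : ∀ τ ∈ range (T / B), (τ + 1) * B ≤ T := fun τ h =>
    (Nat.le_div_iff_mul_le hs.B_pos).mp (mem_range.mp h)
  have hlin := fun τ (h : τ ∈ range (T / B)) => hE.integral_sum_meanDist_mul hs (hτ τ h) kstar
  have hli := integrable_finsetSum (range (T / B)) fun τ h => (hlin τ h).1
  have hla : Integrable (fun ω => ∑ t, avgLoss (ℓ ω) t kstar) P :=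
    integrable_finsetSum _ fun t _ => hE.integrable_avgLoss t kstar
  have hle := integral_mono ((hE.integrable_expectedLoss hs i).sub hla)
    (hli.add (integrable_const (3 + (B : ℝ)))) fun ω => by
      have := expectedLoss_sub_le hs (hE.mem_Icc ω) i kstar
      simp only [actionExp_blockLoss_mul hs] at this
      exact this
  simp only [Pi.sub_apply, Pi.add_apply] at hle
  rw [integral_sub (hE.integrable_expectedLoss hs i) hla, hsumI,
    integral_add hli (integrable_const _), integral_finsetSum _ fun τ h => (hlin τ h).1,
    Finset.sum_congr rfl fun τ h => (hlin τ h).2] at hle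
  simp only [integral_const, probReal_univ, one_smul] at hle
  have hpar := sum_range_le_of_parity (X := 39016 * X) (M := T / B) (f := fun τ =>
      ∑ k ∈ univ.erase kstar, meanProb P G W ℓ τ k * (B * gap μ kstar k)) (by linarith)
    fun π hπ n hn => hE.sum_meanProb_le' hs hBT hgap hπ hn
  linarith

end Stochastic

end DistBandit

end

/-! ### The main theorem -/

theorem mainTheorem4 :
    ∃ (C : ℝ) (c : ℕ), 0 < C ∧
      ∀ (N K T : ℕ), 2 ≤ K → 3 ≤ T →
      ∀ (G : SimpleGraph (Fin N)) (W : Matrix (Fin N) (Fin N) ℝ),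
        G.Connected → DistBandit.IsGossipMatrix G W → DistBandit.sigma2 W < 1 →
      -- adversarial environment
      (∀ ℓ : DistBandit.Losses T N K, (∀ t i k, ℓ t i k ∈ Set.Icc (0 : ℝ) 1) →
        DistBandit.regret G W ℓ ≤
            C * (√((DistBandit.blockLength W K T : ℝ) * T * Real.log K)
              + √((K : ℝ) * T / N)
              + (DistBandit.blockLength W K T : ℝ) * Real.log K) ∧
        DistBandit.regret G W ℓ ≤
            C * Real.log ((K : ℝ) * N * T) ^ c *
              (√(1 / √(DistBandit.spectralGap W) * T)
                + √((K : ℝ) * T / N)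
                + 1 / √(DistBandit.spectralGap W))) ∧
      -- stochastic environment
      (DistBandit.blockLength W K T ≤ T →
        ∀ (Ω : Type*) [MeasurableSpace Ω] (P : Measure Ω) [IsProbabilityMeasure P]
          (ℓ : Ω → DistBandit.Losses T N K) (μ : Fin N → Fin K → ℝ) (kstar : Fin K),
          DistBandit.IsStochasticEnv P ℓ μ →
          (∀ k, k ≠ kstar → DistBandit.globalMean μ kstar < DistBandit.globalMean μ k) →
          (∀ i, Integrable (fun ω => DistBandit.expectedLoss G W (ℓ ω) i) P) ∧
          DistBandit.stochRegret P G W ℓ ≤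
            C * ((DistBandit.blockLength W K T : ℝ) / N
                  * ∑ k ∈ univ.erase kstar,
                      Real.log ((T : ℝ) / DistBandit.blockLength W K T)
                        / DistBandit.gap μ kstar k
              + ∑ k ∈ univ.erase kstar,
                  (DistBandit.blockLength W K T : ℝ) ^ 2
                    / (DistBandit.gap μ kstar k * Real.log K)
              + (DistBandit.blockLength W K T : ℝ) ^ 2 * Real.log K)) := by
  -- The largest of the constants 76, 2356 and 78040. The exponent 2 counts one logarithm in the
  -- block length and one from log K.
  refine ⟨78040, 2, by norm_num, fun N K T hK hT G W hG hW hσ => ?_⟩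
  have hs : DistBandit.Setting G W K T :=
    ⟨Fin.pos_iff_nonempty.mpr hG.nonempty, hK, hT, hW, hσ⟩
  have hlog : 0 ≤ Real.log K := (DistBandit.log_natCast_pos hK).le
  refine ⟨fun ℓ hℓ => ⟨?_, ?_⟩, ?_⟩
  · refine (DistBandit.regret_adversarial hs hℓ).trans
      (mul_le_mul_of_nonneg_right (by norm_num) (by positivity))
  · refine (DistBandit.regret_adversarial_spectralGap hs hℓ).trans
      (mul_le_mul_of_nonneg_right (mul_le_mul_of_nonneg_right (by norm_num) (sq_nonneg _))
        (by positivity))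
  · intro hBT Ω _ P _ ℓ μ kstar hE hmin
    exact ⟨hE.integrable_expectedLoss hs,
      hE.stochRegret_le hs hBT fun k hk => sub_pos.mpr (hmin k hk)⟩
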